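/- Throughout, $\mathbf{Cat}$ is the bicategory of (small) categories, functors and natural transformations, taken in a universe containing the hom-categories of the bicategory under consideration; $\mathbf{Bicat}(\mathcal A^{op},\mathbf{Cat})$ is the bicategory of pseudofunctors, pseudonatural transformations and modifications; coherence isomorphisms are not written. **Extrapseudonatural transformations.** Let $P\colon \mathcal B^{op}\times\mathcal B\to\mathcal C$ be a pseudofunctor of bicategories and $X\in\mathcal C$. An extrapseudonatural transformation $j\colon P\Rightarrow X$ consists of $1$-cells $j_b\colon P(b,b)\to X$ and invertible $2$-cells $j_f\colon j_b\circ P(f,1_b)\Rightarrow j_{b'}\circ P(1_{b'},f)$ for $f\colon b\to b'$, such that * for $f\colon b\to b'$ and $g\colon b'\to b''$, the cell $j_{gf}$ is the pasting of $j_f P(g,1)$, the isomorphism $P(1,f)P(g,1)\cong P(g,1)P(1,f)$, and $j_g P(1,f)$; * $j_{1_b}$ is the identity $2$-cell; * $j_g\cdot(j_b\, P(\gamma,1)) = (j_{b'}\, P(1,\gamma))\cdot j_f$ for every $2$-cell $\gamma\colon f\Rightarrow g$. **Bicodescent objects.** $i\colon P\Rightarrow X$ exhibits $X$ as the bicodescent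 object (bicoend) $\int^b P(b,b)$ if * for every extrapseudonatural $j\colon P\Rightarrow Y$ there are a $1$-cell $t\colon X\to Y$ and invertible $2$-cells $J_b\colon t\,i_b\Rightarrow j_b$ with $j_f\cdot (J_b P(f,1)) = (J_{b'}P(1,f))\cdot (t\, i_f)$ for all $f\colon b\to b'$; * for all $1$-cells $h,k\colon X\to Y$ and all families of $2$-cells $\Gamma_b\colon h\,i_b\Rightarrow k\,i_b$ with $(k\,i_f)\cdot(\Gamma_b P(f,1)) = (\Gamma_{b'}P(1,f))\cdot(h\,i_f)$ for all $f\colon b\to b'$, there is a unique $2$-cell $\gamma\colon h\Rightarrow k$ with $\gamma\, i_b=\Gamma_b$ for all $b$. **Lemma.** Let $\mathcal A$ be a bicategory. There is a pseudofunctor $$I=\int^{a}-(a)\times\mathcal A(-,a)\colon \mathbf{Bicat}(\mathcal A^{op},\mathbf{Cat})\to\mathbf{Bicat}(\mathcal A^{op},\mathbf{Cat}).$$ Precisely: regard $(F,a,b)\mapsto F(a)\times\mathcal A(-,b)$ as a pseudofunctor $\mathbf{Bicat}(\mathcal A^{op},\mathbf{Cat})\times\mathcal A^{op}\times\mathcal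 A\to\mathbf{Bicat}(\mathcal A^{op},\mathbf{Cat})$. There are a pseudofunctor $I$ as displayed and, for each $F$, an extrapseudonatural transformation $i^F\colon F(-)\times\mathcal A(-,-)\Rightarrow I(F)$, with components $i^F_a\colon F(a)\times\mathcal A(-,a)\to I(F)$, such that: 1. for every $F$, $i^F$ exhibits $I(F)$ as the bicodescent object $\int^a F(a)\times\mathcal A(-,a)$ in $\mathbf{Bicat}(\mathcal A^{op},\mathbf{Cat})$; moreover, for every object $x$ of $\mathcal A$, the components of $i^F$ at $x$ exhibit the category $I(F)(x)$ as the bicodescent object $\int^a F(a)\times\mathcal A(x,a)$ in $\mathbf{Cat}$; 2. the action of $I$ on $1$-cells and $2$-cells and its constraints are the induced ones: there are invertible modifications $$\Gamma^\gamma_a\colon i^G_a\circ(\gamma_a\times 1)\cong I(\gamma)\circ i^F_a\qquad(\gamma\colon F\Rightarrow G)$$ which for each fixed $a$ make $(i^F_a)_F$ a pseudonatural transformation $-(a)\times\mathcal A(-,a)\Rightarrow I$ (so they are natural with respect to modifications $\gamma\Rrightarrow\delta$ and compatible with the identity and composition constraints of $I$), and which, for each $\gamma$ and each $f\colon a\to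 a'$ in $\mathcal A$, are compatible with the extrapseudonaturality cells: the two pastings of $i^F_f$, $i^G_f$, $\Gamma^\gamma_a$, $\Gamma^\gamma_{a'}$ and the isomorphisms that interchange $\gamma$ and $f$, from $i^G_a\circ(G(f)\times 1)\circ(\gamma_{a'}\times 1)$ to $I(\gamma)\circ i^F_{a'}\circ(1\times\mathcal A(-,f))$, are equal. -/

import Mathlib

open CategoryTheory Bicategory Opposite
open scoped CategoryTheory.Pseudofunctor.StrongTrans CategoryTheory.Prod

universe w₁ w₂ w₃ v₁ v₂ v₃ u₁ u₂ u₃ w v u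

namespace Bicoend

/-! ### Components of pseudonatural transformations into `Cat` -/

section
variable {B : Type u₁} [Bicategory.{w₁, v₁} B] {F G H : B ⥤ᵖ Cat.{v, u}}

theorem cat_hom_inv {C D : Cat.{v,u}} {E : Type*} [Category* E] {P Q : C ⟶ D} (e : P ≅ Q) (K : D ⥤ E)
    (x : C) {Y : E} (k : K.obj (P.toFunctor.obj x) ⟶ Y) :
    K.map (e.hom.toNatTrans.app x) ≫ K.map (e.inv.toNatTrans.app x) ≫ k = k := by
  rw [← Functor.map_comp_assoc, Cat.Hom.hom_inv_id_toNatTrans_app]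
  simp

theorem st_nat (α : F ⟶ G) {a b : B} {f g : a ⟶ b} (η : f ⟶ g) (s : F.obj a) :
   (α.app b).toFunctor.map ((F.map₂ η).toNatTrans.app s) ≫ (α.naturality g).hom.toNatTrans.app s =
     (α.naturality f).hom.toNatTrans.app s ≫ (G.map₂ η).toNatTrans.app ((α.app a).toFunctor.obj s) := by
  have := congr($(α.naturality_naturality η).toNatTrans.app s)
  simpa [-Pseudofunctor.StrongTrans.naturality_naturality] using this

theorem st_mod {α β : F ⟶ G} (Γ : α ⟶ β) {a b : B} (f : a ⟶ b) (s : F.obj a) :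
   (Γ.as.app b).toNatTrans.app ((F.map f).toFunctor.obj s) ≫ (β.naturality f).hom.toNatTrans.app s =
     (α.naturality f).hom.toNatTrans.app s ≫ (G.map f).toFunctor.map ((Γ.as.app a).toNatTrans.app s) := by
  have := congr($(Γ.as.naturality f).toNatTrans.app s)
  simpa [-Pseudofunctor.StrongTrans.Modification.naturality] using this

theorem st_comp (α : F ⟶ G) {a b c : B} (f : a ⟶ b) (g : b ⟶ c) (s : F.obj a) :
   (α.naturality (f ≫ g)).hom.toNatTrans.app s ≫ (G.mapComp f g).hom.toNatTrans.app ((α.app a).toFunctor.obj s) =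
    (α.app c).toFunctor.map ((F.mapComp f g).hom.toNatTrans.app s) ≫
     (α.naturality g).hom.toNatTrans.app ((F.map f).toFunctor.obj s) ≫ 
      (G.map g).toFunctor.map ((α.naturality f).hom.toNatTrans.app s) := by
  have := congr($(α.naturality_comp f g).toNatTrans.app s)
  simpa [-Pseudofunctor.StrongTrans.naturality_comp] using this

theorem st_id (α : F ⟶ G) (a : B) (s : F.obj a) :
   (α.naturality (𝟙 a)).hom.toNatTrans.app s ≫ (G.mapId a).hom.toNatTrans.app ((α.app a).toFunctor.obj s) =
    (α.app a).toFunctor.map ((F.mapId a).hom.toNatTrans.app s) := by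
  have := congr($(α.naturality_id a).toNatTrans.app s)
  simpa [-Pseudofunctor.StrongTrans.naturality_id] using this

theorem st_vcomp (α : F ⟶ G) (β : G ⟶ H) {a b : B} (f : a ⟶ b) (s : F.obj a) :
   ((α ≫ β).naturality f).hom.toNatTrans.app s = 
    (β.app b).toFunctor.map ((α.naturality f).hom.toNatTrans.app s) ≫
     (β.naturality f).hom.toNatTrans.app ((α.app a).toFunctor.obj s) := by
  change 𝟙 _ ≫ (β.app b).toFunctor.map ((α.naturality f).hom.toNatTrans.app s) ≫ 𝟙 _ ≫
     (β.naturality f).hom.toNatTrans.app ((α.app a).toFunctor.obj s) ≫ 𝟙 _ = _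
  simp

theorem st_vid {a b : B} (f : a ⟶ b) (s : F.obj a) :
   (Pseudofunctor.StrongTrans.naturality (𝟙 F) f).hom.toNatTrans.app s = 𝟙 _ := by
  change 𝟙 _ ≫ 𝟙 _ = _
  simp; rfl

end

/-! ### The integrand `F(a) × A(-, b)` -/

section
variable {B : Type u₁} [Bicategory.{w₁, v₁} B] {Z : Type u₃} [Bicategory.{w₃, v₃} Z]

/-- The composition constraint of `evalFst`. -/
def evalFstMapComp {X Y W : (B ⥤ᵖ Cat.{v,u}) × (B × Z)} (f : X ⟶ Y) (g : Y ⟶ W) :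
   X.1.map (f.2.1 ≫ g.2.1) ≫ f.1.app W.2.1 ≫ g.1.app W.2.1 ≅ 
    (X.1.map f.2.1 ≫ f.1.app Y.2.1) ≫ (Y.1.map g.2.1 ≫ g.1.app W.2.1) :=
  whiskerRightIso (X.1.mapComp f.2.1 g.2.1) (f.1.app W.2.1 ≫ g.1.app W.2.1) ≪≫ α_ _ _ _ ≪≫
      whiskerLeftIso (X.1.map f.2.1) ((α_ _ _ _).symm ≪≫
        whiskerRightIso (f.1.naturality g.2.1) (g.1.app W.2.1) ≪≫ α_ _ _ _) ≪≫ (α_ _ _ _).symm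

theorem evalFstMapComp_hom {X Y W : (B ⥤ᵖ Cat.{v,u}) × (B × Z)} (f : X ⟶ Y) (g : Y ⟶ W) (s : X.1.obj X.2.1) :
   (evalFstMapComp f g).hom.toNatTrans.app s = (g.1.app W.2.1).toFunctor.map (
     (f.1.app W.2.1).toFunctor.map ((X.1.mapComp f.2.1 g.2.1).hom.toNatTrans.app s) ≫
     (f.1.naturality g.2.1).hom.toNatTrans.app ((X.1.map f.2.1).toFunctor.obj s)) := by
  simp [evalFstMapComp]

theorem evalFstMapComp_inv {X Y W : (B ⥤ᵖ Cat.{v,u}) × (B × Z)} (f : X ⟶ Y) (g : Y ⟶ W) (s : X.1.obj X.2.1) :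
   (evalFstMapComp f g).inv.toNatTrans.app s = (g.1.app W.2.1).toFunctor.map (
     (f.1.naturality g.2.1).inv.toNatTrans.app ((X.1.map f.2.1).toFunctor.obj s) ≫
     (f.1.app W.2.1).toFunctor.map ((X.1.mapComp f.2.1 g.2.1).inv.toNatTrans.app s)) := by
  simp [evalFstMapComp]

variable (B Z)

/-- Evaluation: the pseudofunctor `(F, (b, z)) ↦ F b`, which ignores the variable `z`. It sends the
1-cell `(γ, (f, _)) : (F, (b, z)) ⟶ (G, (b', z'))` to the composite `F b ⟶ F b' ⟶ G b'` of `F f`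
and `γ_{b'}`. -/
def evalFst : ((B ⥤ᵖ Cat.{v,u}) × (B × Z)) ⥤ᵖ Cat.{v,u} where
  obj X := X.1.obj X.2.1
  map {X Y} f := X.1.map f.2.1 ≫ f.1.app Y.2.1
  map₂ {X Y f g} η := X.1.map₂ η.2.1 ▷ f.1.app Y.2.1 ≫ X.1.map g.2.1 ◁ η.1.as.app Y.2.1
  map₂_id := by intros; simp
  map₂_comp := by intros X Y f g h η θ; ext s; simp
  mapId X := ρ_ (X.1.map (𝟙 X.2.1)) ≪≫ X.1.mapId X.2.1
  mapComp f g := evalFstMapComp f g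
  map₂_whisker_left := by
    intros a b c f g h η
    ext s
    have := congr((h.1.app c.2.1).toFunctor.map $(st_nat f.1 η.2.1 ((a.1.map f.2.1).toFunctor.obj s)))
    simp only [Functor.map_comp] at this
    simp [evalFstMapComp_hom, evalFstMapComp_inv, ← reassoc_of% this]
    simp [← Functor.map_comp]
  map₂_whisker_right := by
    intros a b c f g η h
    ext s
    have h1 := st_mod η.1 h.2.1 ((a.1.map g.2.1).toFunctor.obj s)
    have h2 := (f.1.naturality h.2.1).hom.toNatTrans.naturality ((a.1.map₂ η.2.1).toNatTrans.app s)
    simp at h2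
    simp [evalFstMapComp_hom, evalFstMapComp_inv]
    simp only [← Functor.map_comp]
    congr 1
    rw [← reassoc_of% h2, ← reassoc_of% h1]
    simp
  map₂_associator := by
    intros a b c d f g h
    ext s
    change (h.1.app d.2.1).toFunctor.map ((g.1.app d.2.1).toFunctor.map ((f.1.app d.2.1).toFunctor.map
       ((a.1.map₂ (α_ f.2.1 g.2.1 h.2.1).hom).toNatTrans.app s))) ≫ 𝟙 _ = 
      (evalFstMapComp (f ≫ g) h).hom.toNatTrans.app s ≫
       (c.1.map h.2.1 ≫ h.1.app d.2.1).toFunctor.map ((evalFstMapComp f g).hom.toNatTrans.app s) ≫ 𝟙 _ ≫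
        (evalFstMapComp g h).inv.toNatTrans.app ((a.1.map f.2.1 ≫ f.1.app b.2.1).toFunctor.obj s) ≫
        (evalFstMapComp f (g ≫ h)).inv.toNatTrans.app s
    simp only [evalFstMapComp_hom, evalFstMapComp_inv]
    erw [st_vcomp]
    have h1 := st_comp f.1 g.2.1 h.2.1 ((a.1.map f.2.1).toFunctor.obj s)
    have h1' : (b.1.mapComp g.2.1 h.2.1).inv.toNatTrans.app
          ((f.1.app b.2.1).toFunctor.obj ((a.1.map f.2.1).toFunctor.obj s)) ≫
        (f.1.naturality (g.2.1 ≫ h.2.1)).inv.toNatTrans.app ((a.1.map f.2.1).toFunctor.obj s) =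
        (b.1.map h.2.1).toFunctor.map
          ((f.1.naturality g.2.1).inv.toNatTrans.app ((a.1.map f.2.1).toFunctor.obj s)) ≫
        (f.1.naturality h.2.1).inv.toNatTrans.app
          ((a.1.map g.2.1).toFunctor.obj ((a.1.map f.2.1).toFunctor.obj s)) ≫
        (f.1.app d.2.1).toFunctor.map
          ((a.1.mapComp g.2.1 h.2.1).inv.toNatTrans.app ((a.1.map f.2.1).toFunctor.obj s)) := by
      simp only [← cancel_epi ((b.1.mapComp g.2.1 h.2.1).hom.toNatTrans.app _),
        ← cancel_epi ((f.1.naturality (g.2.1 ≫ h.2.1)).hom.toNatTrans.app _),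
        reassoc_of% h1, cat_hom_inv]
      rw [Cat.Hom.hom_inv_id_toNatTrans_app_assoc, ← Functor.map_comp,
        Cat.Hom.hom_inv_id_toNatTrans_app]
      rw [← reassoc_of% h1]
      simp
    have h2 := (f.1.naturality h.2.1).hom.toNatTrans.naturality
      ((a.1.mapComp f.2.1 g.2.1).hom.toNatTrans.app s)
    simp at h2
    have h3 := (g.1.naturality h.2.1).hom.toNatTrans.naturality
      ((f.1.app c.2.1).toFunctor.map ((a.1.mapComp f.2.1 g.2.1).hom.toNatTrans.app s) ≫
            (f.1.naturality g.2.1).hom.toNatTrans.app ((a.1.map f.2.1).toFunctor.obj s))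
    have h4 := congr($(a.1.map₂_associator f.2.1 g.2.1 h.2.1).toNatTrans.app s)
    simp [-Pseudofunctor.map₂_associator] at h4
    simp only [Category.comp_id, Category.id_comp]
    change _ = (h.1.app d.2.1).toFunctor.map
        ((g.1.app d.2.1).toFunctor.map ((f.1.app d.2.1).toFunctor.map
            ((a.1.mapComp (f.2.1 ≫ g.2.1) h.2.1).hom.toNatTrans.app s)) ≫
          (g.1.app d.2.1).toFunctor.map
              ((f.1.naturality h.2.1).hom.toNatTrans.app
                ((a.1.map (f.2.1 ≫ g.2.1)).toFunctor.obj s)) ≫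
            (g.1.naturality h.2.1).hom.toNatTrans.app
              ((f.1.app c.2.1).toFunctor.obj ((a.1.map (f.2.1 ≫ g.2.1)).toFunctor.obj s))) ≫
      (h.1.app d.2.1).toFunctor.map ((c.1.map h.2.1).toFunctor.map
          ((g.1.app c.2.1).toFunctor.map
            ((f.1.app c.2.1).toFunctor.map ((a.1.mapComp f.2.1 g.2.1).hom.toNatTrans.app s) ≫
              (f.1.naturality g.2.1).hom.toNatTrans.app ((a.1.map f.2.1).toFunctor.obj s)))) ≫
          (h.1.app d.2.1).toFunctor.map
              ((g.1.naturality h.2.1).inv.toNatTrans.app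
                  ((b.1.map g.2.1).toFunctor.obj
                    ((f.1.app b.2.1).toFunctor.obj ((a.1.map f.2.1).toFunctor.obj s))) ≫
                (g.1.app d.2.1).toFunctor.map
                  ((b.1.mapComp g.2.1 h.2.1).inv.toNatTrans.app
                    ((f.1.app b.2.1).toFunctor.obj ((a.1.map f.2.1).toFunctor.obj s)))) ≫
            (h.1.app d.2.1).toFunctor.map ((g.1.app d.2.1).toFunctor.map
              ((f.1.naturality (g.2.1 ≫ h.2.1)).inv.toNatTrans.app
                  ((a.1.map f.2.1).toFunctor.obj s) ≫
                (f.1.app d.2.1).toFunctor.map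
                  ((a.1.mapComp f.2.1 (g.2.1 ≫ h.2.1)).inv.toNatTrans.app s)))
    rw [h4]
    simp only [← Functor.map_comp]
    congr 1
    simp only [Category.assoc]
    erw [← reassoc_of% h3]
    simp
    simp only [← Functor.map_comp]
    congr 1
    rw [← reassoc_of% h2, reassoc_of% h1', cat_hom_inv]
    simp
  map₂_left_unitor := by
    intros a b f 
    ext s
    have h4 := congr($(a.1.map₂_left_unitor f.2.1).toNatTrans.app s)
    simp [-Pseudofunctor.map₂_left_unitor] at h4
    change (f.1.app b.2.1).toFunctor.map ((a.1.map₂ (λ_ f.2.1).hom).toNatTrans.app s) ≫ 𝟙 _ = 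
      (evalFstMapComp (𝟙 a) f).hom.toNatTrans.app s ≫
       (a.1.map f.2.1 ≫ f.1.app b.2.1).toFunctor.map (𝟙 _ ≫ (a.1.mapId a.2.1).hom.toNatTrans.app s) ≫ 𝟙 _
    rw [evalFstMapComp_hom]
    erw [st_vid]
    rw [h4]
    change _ = (f.1.app b.2.1).toFunctor.map
        ((a.1.mapComp (𝟙 a.2.1) f.2.1).hom.toNatTrans.app s ≫ 𝟙 _) ≫
      (f.1.app b.2.1).toFunctor.map ((a.1.map f.2.1).toFunctor.map
        (𝟙 _ ≫ (a.1.mapId a.2.1).hom.toNatTrans.app s)) ≫ 𝟙 _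
    simp
  map₂_right_unitor := by
    intros a b f 
    ext s
    have := st_id f.1 b.2.1 ((a.1.map f.2.1).toFunctor.obj s)
    have h4 := congr($(a.1.map₂_right_unitor f.2.1).toNatTrans.app s)
    simp [-Pseudofunctor.map₂_right_unitor] at h4
    change (f.1.app b.2.1).toFunctor.map ((a.1.map₂ (ρ_ f.2.1).hom).toNatTrans.app s) ≫ 𝟙 _ = 
      (evalFstMapComp f (𝟙 b)).hom.toNatTrans.app s ≫
       (𝟙 _ ≫ (b.1.mapId b.2.1).hom.toNatTrans.app ((a.1.map f.2.1 ≫ f.1.app b.2.1).toFunctor.obj s)) ≫ 𝟙 _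
    rw [evalFstMapComp_hom, h4]
    change _ = ((f.1.app b.2.1).toFunctor.map
          ((a.1.mapComp f.2.1 (𝟙 b.2.1)).hom.toNatTrans.app s) ≫
          (f.1.naturality (𝟙 b.2.1)).hom.toNatTrans.app ((a.1.map f.2.1).toFunctor.obj s)) ≫
      (𝟙 _ ≫ (b.1.mapId b.2.1).hom.toNatTrans.app
        ((f.1.app b.2.1).toFunctor.obj ((a.1.map f.2.1).toFunctor.obj s))) ≫ 𝟙 _
    simp [this]
end

section
variable {C C' D D' : Cat.{v, u}}

/-- The product `F × G` of two functors. -/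
def catProdMap (F : C ⟶ C') (G : D ⟶ D') : Cat.of (C × D) ⟶ Cat.of (C' × D') :=
  (F.toFunctor.prod G.toFunctor).toCatHom

/-- The product `α × β` of two natural transformations. -/
def catProdMap₂ {F F' : C ⟶ C'} {G G' : D ⟶ D'} (α : F ⟶ F') (β : G ⟶ G') :
    catProdMap F G ⟶ catProdMap F' G' :=
  (NatTrans.prod α.toNatTrans β.toNatTrans).toCatHom₂

/-- The product of two natural isomorphisms. -/
def catProdIso {F F' : C ⟶ C'} {G G' : D ⟶ D'} (α : F ≅ F') (β : G ≅ G') :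
    catProdMap F G ≅ catProdMap F' G' where
  hom := catProdMap₂ α.hom β.hom
  inv := catProdMap₂ α.inv β.inv
  hom_inv_id := congrArg₂ catProdMap₂ α.hom_inv_id β.hom_inv_id
  inv_hom_id := congrArg₂ catProdMap₂ α.inv_hom_id β.inv_hom_id
end

section
variable {B : Type u₁} [Bicategory.{w₁, v₁} B]

/-- The pseudofunctor `K × G(-)`, for a category `K` and a pseudofunctor `G` into `Cat`. -/
def constProd (K : Cat.{v,u}) (G : B ⥤ᵖ Cat.{v,u}) : B ⥤ᵖ Cat.{v,u} where
  obj y := Cat.of (K × G.obj y)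
  map g := catProdMap (𝟙 K) (G.map g)
  map₂ η := catProdMap₂ (𝟙 (𝟙 K)) (G.map₂ η)
  map₂_id g := congrArg (catProdMap₂ _) (G.map₂_id g)
  map₂_comp η θ := congrArg₂ catProdMap₂ (Category.id_comp _).symm (G.map₂_comp η θ)
  mapId y := catProdIso (Iso.refl (𝟙 K)) (G.mapId y)
  mapComp g h := catProdIso (λ_ (𝟙 K)).symm (G.mapComp g h)
  map₂_whisker_left f g h η := congrArg₂ catProdMap₂
    (show 𝟙 (𝟙 K) = (λ_ (𝟙 K)).inv ≫ 𝟙 K ◁ 𝟙 (𝟙 K) ≫ (λ_ (𝟙 K)).hom by simp)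
    (G.map₂_whisker_left f η)
  map₂_whisker_right η h := congrArg₂ catProdMap₂
    (show 𝟙 (𝟙 K) = (λ_ (𝟙 K)).inv ≫ 𝟙 (𝟙 K) ▷ 𝟙 K ≫ (λ_ (𝟙 K)).hom by simp)
    (G.map₂_whisker_right η h)
  map₂_associator f g h := congrArg₂ catProdMap₂
    (show 𝟙 (𝟙 K) = (λ_ (𝟙 K)).inv ≫ (λ_ (𝟙 K)).inv ▷ 𝟙 K ≫ (α_ (𝟙 K) (𝟙 K) (𝟙 K)).hom ≫
      𝟙 K ◁ (λ_ (𝟙 K)).hom ≫ (λ_ (𝟙 K)).hom by ext s; simp)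
    (G.map₂_associator f g h)
  map₂_left_unitor f := congrArg₂ catProdMap₂
    (show 𝟙 (𝟙 K) = (λ_ (𝟙 K)).inv ≫ 𝟙 (𝟙 K) ▷ 𝟙 K ≫ (λ_ (𝟙 K)).hom by simp)
    (G.map₂_left_unitor f)
  map₂_right_unitor f := congrArg₂ catProdMap₂
    (show 𝟙 (𝟙 K) = (λ_ (𝟙 K)).inv ≫ 𝟙 K ◁ 𝟙 (𝟙 K) ≫ (ρ_ (𝟙 K)).hom by simp)
    (G.map₂_right_unitor f)

/-- The pseudonatural transformation `k × α : K × G(-) ⟶ K' × G'(-)`. -/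
def constProdMap {K K' : Cat.{v,u}} {G G' : B ⥤ᵖ Cat.{v,u}} (k : K ⟶ K') (α : G ⟶ G') :
    constProd K G ⟶ constProd K' G' where
  app y := catProdMap k (α.app y)
  naturality g := catProdIso (λ_ k ≪≫ (ρ_ k).symm) (α.naturality g)
  naturality_naturality η := congrArg₂ catProdMap₂
    (show 𝟙 (𝟙 K) ▷ k ≫ ((λ_ k).hom ≫ (ρ_ k).inv) =
      ((λ_ k).hom ≫ (ρ_ k).inv) ≫ k ◁ 𝟙 (𝟙 K') by ext s; simp)
    (α.naturality_naturality η)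
  naturality_id a := congrArg₂ catProdMap₂
    (show ((λ_ k).hom ≫ (ρ_ k).inv) ≫ k ◁ 𝟙 (𝟙 K') =
      𝟙 (𝟙 K) ▷ k ≫ (λ_ k).hom ≫ (ρ_ k).inv by ext s; simp)
    (α.naturality_id a)
  naturality_comp f g := congrArg₂ catProdMap₂
    (show ((λ_ k).hom ≫ (ρ_ k).inv) ≫ k ◁ (λ_ (𝟙 K')).inv =
      (λ_ (𝟙 K)).inv ▷ k ≫ (α_ (𝟙 K) (𝟙 K) k).hom ≫ 𝟙 K ◁ ((λ_ k).hom ≫ (ρ_ k).inv) ≫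
        (α_ (𝟙 K) k (𝟙 K')).inv ≫ ((λ_ k).hom ≫ (ρ_ k).inv) ▷ 𝟙 K' ≫
        (α_ k (𝟙 K') (𝟙 K')).hom by ext s; simp)
    (α.naturality_comp f g)

/-- The modification `κ × Γ`. -/
def constProdMap₂ {K K' : Cat.{v,u}} {G G' : B ⥤ᵖ Cat.{v,u}} {k k' : K ⟶ K'} {α α' : G ⟶ G'}
   (κ : k ⟶ k') (Γ : α ⟶ α') : constProdMap k α ⟶ constProdMap k' α' where
  as := {
    app y := catProdMap₂ κ (Γ.as.app y)
    naturality g := congrArg₂ catProdMap₂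
      (show 𝟙 K ◁ κ ≫ ((λ_ k').hom ≫ (ρ_ k').inv) = ((λ_ k).hom ≫ (ρ_ k).inv) ≫ κ ▷ 𝟙 K'
        by ext s; simp)
      (Γ.as.naturality g) }

variable {X : Type u₃} [Bicategory.{w₃, v₃} X]

/-- The pseudofunctor `x ↦ R x × (S x)(-)`. -/
def prodPt (R : X ⥤ᵖ Cat.{v,u}) (S : X ⥤ᵖ (B ⥤ᵖ Cat.{v,u})) : X ⥤ᵖ (B ⥤ᵖ Cat.{v,u}) where
  obj x := constProd (R.obj x) (S.obj x)
  map f := constProdMap (R.map f) (S.map f)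
  map₂ η := constProdMap₂ (R.map₂ η) (S.map₂ η)
  map₂_id f := congrArg₂ constProdMap₂ (R.map₂_id f) (S.map₂_id f)
  map₂_comp η θ := congrArg₂ constProdMap₂ (R.map₂_comp η θ) (S.map₂_comp η θ)
  mapId x := {
    hom := ⟨{
      app y := catProdMap₂ (R.mapId x).hom ((S.mapId x).hom.as.app y)
      naturality g := congrArg₂ catProdMap₂
        (show 𝟙 _ ◁ (R.mapId x).hom ≫ ((ρ_ (𝟙 (R.obj x))).hom ≫ (λ_ (𝟙 (R.obj x))).inv) =
          ((λ_ (R.map (𝟙 x))).hom ≫ (ρ_ (R.map (𝟙 x))).inv) ≫ (R.mapId x).hom ▷ 𝟙 _ by cat_disch)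
        ((S.mapId x).hom.as.naturality g) }⟩
    inv := ⟨{
      app y := catProdMap₂ (R.mapId x).inv ((S.mapId x).inv.as.app y)
      naturality g := congrArg₂ catProdMap₂
        (show 𝟙 _ ◁ (R.mapId x).inv ≫ ((λ_ (R.map (𝟙 x))).hom ≫ (ρ_ (R.map (𝟙 x))).inv) =
          ((ρ_ (𝟙 (R.obj x))).hom ≫ (λ_ (𝟙 (R.obj x))).inv) ≫ (R.mapId x).inv ▷ 𝟙 _ by cat_disch)
        ((S.mapId x).inv.as.naturality g) }⟩
    hom_inv_id := by
      ext y : 1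
      exact congrArg₂ catProdMap₂ (R.mapId x).hom_inv_id congr($((S.mapId x).hom_inv_id).as.app y)
    inv_hom_id := by
      ext y : 1
      exact congrArg₂ catProdMap₂ (R.mapId x).inv_hom_id congr($((S.mapId x).inv_hom_id).as.app y) }
  mapComp {x x' x''} f g := {
    hom := ⟨{
      app y := catProdMap₂ (R.mapComp f g).hom ((S.mapComp f g).hom.as.app y)
      naturality h := congrArg₂ catProdMap₂
        (show 𝟙 _ ◁ (R.mapComp f g).hom ≫
            ((α_ _ _ _).inv ≫ ((λ_ _).hom ≫ (ρ_ _).inv) ▷ _ ≫ (α_ _ _ _).hom ≫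
              _ ◁ ((λ_ _).hom ≫ (ρ_ _).inv) ≫ (α_ _ _ _).inv) =
          ((λ_ (R.map (f ≫ g))).hom ≫ (ρ_ (R.map (f ≫ g))).inv) ≫ (R.mapComp f g).hom ▷ 𝟙 _
          by ext s; simp)
        ((S.mapComp f g).hom.as.naturality h) }⟩
    inv := ⟨{
      app y := catProdMap₂ (R.mapComp f g).inv ((S.mapComp f g).inv.as.app y)
      naturality h := congrArg₂ catProdMap₂
        (show 𝟙 _ ◁ (R.mapComp f g).inv ≫
          ((λ_ (R.map (f ≫ g))).hom ≫ (ρ_ (R.map (f ≫ g))).inv) =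
            ((α_ _ _ _).inv ≫ ((λ_ _).hom ≫ (ρ_ _).inv) ▷ _ ≫ (α_ _ _ _).hom ≫
              _ ◁ ((λ_ _).hom ≫ (ρ_ _).inv) ≫ (α_ _ _ _).inv) ≫ (R.mapComp f g).inv ▷ 𝟙 _
          by ext s; simp)
        ((S.mapComp f g).inv.as.naturality h) }⟩
    hom_inv_id := by
      ext y : 1
      exact congrArg₂ catProdMap₂ (R.mapComp f g).hom_inv_id
        congr($((S.mapComp f g).hom_inv_id).as.app y)
    inv_hom_id := by
      ext y : 1
      exact congrArg₂ catProdMap₂ (R.mapComp f g).inv_hom_id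
        congr($((S.mapComp f g).inv_hom_id).as.app y) }
  map₂_whisker_left f g h η := by
    ext y : 1
    exact congrArg₂ catProdMap₂ (R.map₂_whisker_left f η)
      congr($(S.map₂_whisker_left f η).as.app y)
  map₂_whisker_right η h := by
    ext y : 1
    exact congrArg₂ catProdMap₂ (R.map₂_whisker_right η h)
      congr($(S.map₂_whisker_right η h).as.app y)
  map₂_associator f g h := by
    ext y : 1
    exact congrArg₂ catProdMap₂ (R.map₂_associator f g h)
      congr($(S.map₂_associator f g h).as.app y)
  map₂_left_unitor f := by
    ext y : 1
    exact congrArg₂ catProdMap₂ (R.map₂_left_unitor f)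
      congr($(S.map₂_left_unitor f).as.app y)
  map₂_right_unitor f := by
    ext y : 1
    exact congrArg₂ catProdMap₂ (R.map₂_right_unitor f)
      congr($(S.map₂_right_unitor f).as.app y)

end

/-- A pseudofunctor `G` on `Z`, regarded as a pseudofunctor of `(y, (x, z))` that ignores `y`
and `x`. -/
def inLastVariable (Y : Type u₁) [Bicategory.{w₁, v₁} Y] (X : Type u₂) [Bicategory.{w₂, v₂} X]
    {Z : Type u₃} [Bicategory.{w₃, v₃} Z] {C : Type u} [Bicategory.{w, v} C] (G : Z ⥤ᵖ C) :
    (Y × (X × Z)) ⥤ᵖ C where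
  obj p := G.obj p.2.2
  map f := G.map f.2.2
  map₂ η := G.map₂ η.2.2
  map₂_id f := G.map₂_id f.2.2
  map₂_comp η θ := G.map₂_comp η.2.2 θ.2.2
  mapId p := G.mapId p.2.2
  mapComp f g := G.mapComp f.2.2 g.2.2
  map₂_whisker_left f _ _ η := G.map₂_whisker_left f.2.2 η.2.2
  map₂_whisker_right η h := G.map₂_whisker_right η.2.2 h.2.2
  map₂_associator f g h := G.map₂_associator f.2.2 g.2.2 h.2.2
  map₂_left_unitor f := G.map₂_left_unitor f.2.2
  map₂_right_unitor f := G.map₂_right_unitor f.2.2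

/-- The pseudofunctor `(F, (a, b)) ↦ F(a) × A(-, b)`, covariant in `F : Aᵒᵖ ⥤ᵖ Cat`, contravariant
in `a` and covariant in `b`. -/
def integrand (A : Type u) [Bicategory.{w, v} A] :
    ((Aᵒᵖ ⥤ᵖ Cat.{w, v}) × (Aᵒᵖ × A)) ⥤ᵖ (Aᵒᵖ ⥤ᵖ Cat.{w, v}) :=
  prodPt (evalFst Aᵒᵖ A) (inLastVariable (Aᵒᵖ ⥤ᵖ Cat.{w, v}) Aᵒᵖ (Bicategory.yoneda (B := A)))

/-! ### Pseudofunctors of two variables -/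

section
variable {Y : Type u₁} [Bicategory.{w₁, v₁} Y] {Z : Type u₂} [Bicategory.{w₂, v₂} Z]
  {C : Type u₃} [Bicategory.{w₃, v₃} C] (Q : (Y × Z) ⥤ᵖ C)

/-- The pseudofunctor `Q(y, -)`. -/
def fixFst (y : Y) : Z ⥤ᵖ C :=
  (Bicategory.Prod.sectR y Z).toPseudofunctor.comp Q

/-- The pseudofunctor `Q(-, z)`. -/
def fixSnd (z : Z) : Y ⥤ᵖ C :=
  (Bicategory.Prod.sectL Y z).toPseudofunctor.comp Q

/-- The constraint `Q(g ∘ f, 1) ≅ Q(g, 1) ∘ Q(f, 1)`. -/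
def fstComp {y y' y'' : Y} (f : y ⟶ y') (g : y' ⟶ y'') (z : Z) :
    Q.map ((f ≫ g) ×ₘ 𝟙 z) ≅ Q.map (f ×ₘ 𝟙 z) ≫ Q.map (g ×ₘ 𝟙 z) :=
  Q.map₂Iso (Iso.prod (Iso.refl (f ≫ g)) (λ_ (𝟙 z)).symm) ≪≫ Q.mapComp (f ×ₘ 𝟙 z) (g ×ₘ 𝟙 z)

/-- The constraint `Q(1, g ∘ f) ≅ Q(1, g) ∘ Q(1, f)`. -/
def sndComp (y : Y) {z z' z'' : Z} (f : z ⟶ z') (g : z' ⟶ z'') :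
    Q.map (𝟙 y ×ₘ (f ≫ g)) ≅ Q.map (𝟙 y ×ₘ f) ≫ Q.map (𝟙 y ×ₘ g) :=
  Q.map₂Iso (Iso.prod (λ_ (𝟙 y)).symm (Iso.refl (f ≫ g))) ≪≫ Q.mapComp (𝟙 y ×ₘ f) (𝟙 y ×ₘ g)

/-- The constraint `Q(1, g) ∘ Q(f, 1) ≅ Q(f, 1) ∘ Q(1, g)`. -/
def interchange {y y' : Y} (f : y ⟶ y') {z z' : Z} (g : z ⟶ z') :
    Q.map (f ×ₘ 𝟙 z) ≫ Q.map (𝟙 y' ×ₘ g) ≅ Q.map (𝟙 y ×ₘ g) ≫ Q.map (f ×ₘ 𝟙 z') :=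
  (Q.mapComp (f ×ₘ 𝟙 z) (𝟙 y' ×ₘ g)).symm ≪≫
    Q.map₂Iso (Iso.prod (ρ_ f ≪≫ (λ_ f).symm) (λ_ g ≪≫ (ρ_ g).symm)) ≪≫
      Q.mapComp (𝟙 y ×ₘ g) (f ×ₘ 𝟙 z')

end

/-! ### Extrapseudonatural transformations and bicodescent objects -/

section
variable {B : Type u₁} [Bicategory.{w₁, v₁} B] {C : Type u₂} [Bicategory.{w₂, v₂} C]

/-- An extrapseudonatural transformation from `P : Bᵒᵖ × B ⥤ᵖ C` to (the constant pseudofunctor at)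
an object `X` of `C`. -/
structure Extrapseudonat (P : (Bᵒᵖ × B) ⥤ᵖ C) (X : C) where
  /-- The 1-cells `P(b, b) ⟶ X`. -/
  app (b : B) : P.obj (op b, b) ⟶ X
  /-- The invertible 2-cells `app b ∘ P(f, 1) ≅ app b' ∘ P(1, f)` for `f : b ⟶ b'`, between
  1-cells `P(b', b) ⟶ X`. -/
  cell {b b' : B} (f : b ⟶ b') :
    P.map (f.op ×ₘ 𝟙 b) ≫ app b ≅ P.map (𝟙 (op b') ×ₘ f) ≫ app b'
  /-- Compatibility with composition. -/
  cell_comp {b b' b'' : B} (f : b ⟶ b') (g : b' ⟶ b'') :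
    (fstComp P g.op f.op b).inv ▷ app b ≫ (cell (f ≫ g)).hom ≫
        (sndComp P (op b'') f g).hom ▷ app b'' =
      (α_ _ _ _).hom ≫ P.map (g.op ×ₘ 𝟙 b) ◁ (cell f).hom ≫ (α_ _ _ _).inv ≫
        (interchange P g.op f).hom ▷ app b' ≫
        (α_ _ _ _).hom ≫ P.map (𝟙 (op b'') ×ₘ f) ◁ (cell g).hom ≫ (α_ _ _ _).inv
  /-- Compatibility with identities. -/
  cell_id (b : B) : cell (𝟙 b) = Iso.refl (P.map (𝟙 (op b) ×ₘ 𝟙 b) ≫ app b)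
  /-- Compatibility with 2-cells. -/
  cell_naturality {b b' : B} {f g : b ⟶ b'} (γ : f ⟶ g) :
    P.map₂ (Bicategory.Opposite.op2 γ ×ₘ 𝟙 (𝟙 b)) ▷ app b ≫ (cell g).hom =
      (cell f).hom ≫ P.map₂ (𝟙 (𝟙 (op b')) ×ₘ γ) ▷ app b'

/-- `i : P ⇒ X` exhibits `X` as the bicodescent object (bicoend) `∫ᵇ P(b, b)`. -/
structure Extrapseudonat.IsBicodescent {P : (Bᵒᵖ × B) ⥤ᵖ C} {X : C} (i : Extrapseudonat P X) :
    Prop where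
  /-- The one-dimensional universal property. -/
  exists_desc : ∀ (Y : C) (j : Extrapseudonat P Y),
    ∃ (t : X ⟶ Y) (J : ∀ b, i.app b ≫ t ≅ j.app b), ∀ {b b' : B} (f : b ⟶ b'),
      P.map (f.op ×ₘ 𝟙 b) ◁ (J b).hom ≫ (j.cell f).hom =
        (α_ _ _ _).inv ≫ (i.cell f).hom ▷ t ≫ (α_ _ _ _).hom ≫
          P.map (𝟙 (op b') ×ₘ f) ◁ (J b').hom
  /-- The two-dimensional universal property. -/
  existsUnique_desc₂ : ∀ (Y : C) (h k : X ⟶ Y) (Γ : ∀ b, i.app b ≫ h ⟶ i.app b ≫ k),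
    (∀ {b b' : B} (f : b ⟶ b'),
      P.map (f.op ×ₘ 𝟙 b) ◁ Γ b ≫ (α_ _ _ _).inv ≫ (i.cell f).hom ▷ k ≫ (α_ _ _ _).hom =
        (α_ _ _ _).inv ≫ (i.cell f).hom ▷ h ≫ (α_ _ _ _).hom ≫
          P.map (𝟙 (op b') ×ₘ f) ◁ Γ b') →
    ∃! γ : h ⟶ k, ∀ b, i.app b ◁ γ = Γ b

end

section
variable {D : Type u₁} [Bicategory.{w₁, v₁} D] {B : Type u₂} [Bicategory.{w₂, v₂} B]
  {C : Type u₃} [Bicategory.{w₃, v₃} C]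

/-- An extrapseudonatural transformation from `P : D × (Bᵒᵖ × B) ⥤ᵖ C` to `Q : D ⥤ᵖ C`:
pseudonatural in `d` and extrapseudonatural in `b`. -/
structure ParamExtrapseudonat (P : (D × (Bᵒᵖ × B)) ⥤ᵖ C) (Q : D ⥤ᵖ C) where
  /-- The extrapseudonatural transformation `P(d, -, -) ⇒ Q(d)`. -/
  fix (d : D) : Extrapseudonat (fixFst P d) (Q.obj d)
  /-- The pseudonaturality 2-cells in `d`. -/
  nat {d d' : D} (k : d ⟶ d') (b : B) :
    P.map (k ×ₘ 𝟙 (op b, b)) ≫ (fix d').app b ≅ (fix d).app b ≫ Q.map k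
  /-- For fixed `b`, these 2-cells form a pseudonatural transformation `P(-, b, b) ⇒ Q`. -/
  nat_naturality {d d' : D} {k l : d ⟶ d'} (η : k ⟶ l) (b : B) :
    (fixSnd P (op b, b)).map₂ η ▷ (fix d').app b ≫ (nat l b).hom =
      (nat k b).hom ≫ (fix d).app b ◁ Q.map₂ η
  nat_id (d : D) (b : B) :
    (nat (𝟙 d) b).hom ≫ (fix d).app b ◁ (Q.mapId d).hom =
      ((fixSnd P (op b, b)).mapId d).hom ▷ (fix d).app b ≫
        (λ_ ((fix d).app b)).hom ≫ (ρ_ ((fix d).app b)).inv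
  nat_comp {d d' d'' : D} (k : d ⟶ d') (l : d' ⟶ d'') (b : B) :
    (nat (k ≫ l) b).hom ≫ (fix d).app b ◁ (Q.mapComp k l).hom =
      ((fixSnd P (op b, b)).mapComp k l).hom ▷ (fix d'').app b ≫ (α_ _ _ _).hom ≫
        (fixSnd P (op b, b)).map k ◁ (nat l b).hom ≫ (α_ _ _ _).inv ≫
        (nat k b).hom ▷ Q.map l ≫ (α_ _ _ _).hom
  /-- Compatibility of the pseudonaturality cells in `d` with the extrapseudonaturality cells
  in `b`. -/
  nat_cell {d d' : D} (k : d ⟶ d') {b b' : B} (g : b ⟶ b') :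
    P.map (k ×ₘ 𝟙 (op b', b)) ◁ ((fix d').cell g).hom ≫ (α_ _ _ _).inv ≫
        (interchange P k (𝟙 (op b') ×ₘ g)).hom ▷ (fix d').app b' ≫ (α_ _ _ _).hom ≫
        P.map (𝟙 d ×ₘ (𝟙 (op b') ×ₘ g)) ◁ (nat k b').hom =
      (α_ _ _ _).inv ≫ (interchange P k (g.op ×ₘ 𝟙 b)).hom ▷ (fix d').app b ≫
        (α_ _ _ _).hom ≫ P.map (𝟙 d ×ₘ (g.op ×ₘ 𝟙 b)) ◁ (nat k b).hom ≫
        (α_ _ _ _).inv ≫ ((fix d).cell g).hom ▷ Q.map k ≫ (α_ _ _ _).hom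

end

/-! ### Evaluation of extrapseudonatural transformations at an object -/

section
variable {E : Type u₁} [Bicategory.{w₁, v₁} E] {C : Type u₂} [Bicategory.{w₂, v₂} C]
  {B : Type u₃} [Bicategory.{w₃, v₃} B]

/-- The strict pseudofunctor `F ↦ F x` of evaluation at an object `x`. -/
def evalPt (x : E) : (E ⥤ᵖ C) ⥤ᵖ C where
  obj F := F.obj x
  map γ := γ.app x
  map₂ Γ := Γ.as.app x
  mapId F := Iso.refl (𝟙 (F.obj x))
  mapComp γ δ := Iso.refl (γ.app x ≫ δ.app x)
  map₂_left_unitor {F G} γ := by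
    have : 𝟙 (𝟙 (F.obj x)) ▷ γ.app x = 𝟙 (𝟙 (F.obj x) ≫ γ.app x) := id_whiskerRight _ _
    change (λ_ (γ.app x)).hom = 𝟙 _ ≫ 𝟙 (𝟙 (F.obj x)) ▷ γ.app x ≫ (λ_ (γ.app x)).hom
    rw [this, Category.id_comp, Category.id_comp]
  map₂_right_unitor {F G} γ := by
    have : γ.app x ◁ 𝟙 (𝟙 (G.obj x)) = 𝟙 (γ.app x ≫ 𝟙 (G.obj x)) := whiskerLeft_id _ _
    change (ρ_ (γ.app x)).hom = 𝟙 _ ≫ γ.app x ◁ 𝟙 (𝟙 (G.obj x)) ≫ (ρ_ (γ.app x)).hom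
    rw [this, Category.id_comp, Category.id_comp]

/-- The component at `x` of an invertible modification. -/
def isoPt {F G : E ⥤ᵖ C} {γ δ : F ⟶ G} (e : γ ≅ δ) (x : E) : γ.app x ≅ δ.app x where
  hom := e.hom.as.app x
  inv := e.inv.as.app x
  hom_inv_id := congr($(e.hom_inv_id).as.app x)
  inv_hom_id := congr($(e.inv_hom_id).as.app x)

theorem fstComp_evalPt {Y : Type*} [Bicategory Y] {Z : Type*} [Bicategory Z]
    (P : (Y × Z) ⥤ᵖ (E ⥤ᵖ C)) (x : E) {y y' y'' : Y} (f : y ⟶ y') (g : y' ⟶ y'') (z : Z) :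
    fstComp (P.comp (Bicoend.evalPt x)) f g z = isoPt (fstComp P f g z) x :=
  Iso.ext (congrArg ((P.map₂ _).as.app x ≫ ·) (Category.comp_id ((P.mapComp _ _).hom.as.app x)))

theorem sndComp_evalPt {Y : Type*} [Bicategory Y] {Z : Type*} [Bicategory Z]
    (P : (Y × Z) ⥤ᵖ (E ⥤ᵖ C)) (x : E) (y : Y) {z z' z'' : Z} (f : z ⟶ z') (g : z' ⟶ z'') :
    sndComp (P.comp (Bicoend.evalPt x)) y f g = isoPt (sndComp P y f g) x :=
  Iso.ext (congrArg ((P.map₂ _).as.app x ≫ ·) (Category.comp_id ((P.mapComp _ _).hom.as.app x)))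

theorem interchange_evalPt {Y : Type*} [Bicategory Y] {Z : Type*} [Bicategory Z]
    (P : (Y × Z) ⥤ᵖ (E ⥤ᵖ C)) (x : E) {y y' : Y} (f : y ⟶ y') {z z' : Z} (g : z ⟶ z') :
    interchange (P.comp (Bicoend.evalPt x)) f g = isoPt (interchange P f g) x :=
  Iso.ext (congrArg₂ (fun s t => s ≫ (P.map₂ _).as.app x ≫ t)
    (Category.id_comp ((P.mapComp _ _).inv.as.app x))
    (Category.comp_id ((P.mapComp _ _).hom.as.app x)))

/-- The component at an object `x` of an extrapseudonatural transformation in a bicategory of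
pseudofunctors. -/
def Extrapseudonat.evalPt {P : (Bᵒᵖ × B) ⥤ᵖ (E ⥤ᵖ C)} {X : E ⥤ᵖ C} (i : Extrapseudonat P X)
    (x : E) : Extrapseudonat (P.comp (Bicoend.evalPt x)) (X.obj x) where
  app b := (i.app b).app x
  cell f := isoPt (i.cell f) x
  cell_comp f g := by
    rw [fstComp_evalPt, sndComp_evalPt, interchange_evalPt]
    exact congr($(i.cell_comp f g).as.app x)
  cell_id b := by rw [i.cell_id]; rfl
  cell_naturality γ := congr($(i.cell_naturality γ).as.app x)

end

end Bicoend

/-! This is the co-Yoneda lemma, one dimension up: the bicodescent object of `F(-) × A(-, -)` is `F`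
itself. So `I` can be taken to be the identity pseudofunctor, and no colimit has to be constructed,
whatever the size of `A`. The component `i^F_b` is evaluation, `(s, h) ↦ F(h)(s)`. Its cells at `f`
are the inverse composition constraints `F(h)(F(f)(s)) ≅ F(h ≫ f)(s)`, and the cells `Γ^γ` are the
inverse naturality constraints `G(h)(γ s) ≅ γ(F(h)(s))`. Every axiom for these data is a coherence
axiom of `F`, of `γ` or of a modification.

One-dimensional property: an extrapseudonatural `j` induces `t_x(s) = j_x(s, 1)`. The cell of `j` at
`h : x ⟶ b` and a left unitor give `t_x(F(h)(s)) = j_x(F(h)(s), 1) ≅ j_b(s, h)` (`Wedge.descIso`),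
and the composition axiom of `j` makes this compatible with all cells (`Wedge.descIso_cell`). When
`j` lives in pseudofunctors, `t` is pseudonatural through `j_y(F(g)(s), 1) ≅ j_x(s, g) ≅ j_x(s, g ≫
1) ≅ G(g)(j_x(s, 1))`. All its coherence follows from `Extrapseudonat.descNat_unitIso` and the
axioms of `j`.

Two-dimensional property: the unit `F(1)(s) ≅ s` shows that a 2-cell out of `F` is determined by its
values at the objects `F(1)(s)`, that is, by the given family at `(s, 1)`. Conjugating by this unit
also defines the 2-cell (`descHomApp`). The hypothesis on the cell at `h` then gives back the whole
family (`descHomApp_act`).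

The main bookkeeping concerns units. The cell at `f` goes literally from `(F(f)(s), h ≫ 1)` to
`(F(1)(s), h ≫ f)`. The structure `Wedge` uses cells from `(F(f)(s), h)` to `(s, h ≫ f)` instead.
The lemmas `insertUnits_…_iff` show that each axiom holds with the units exactly when it holds
without them. They are used in one direction to read off a wedge and in the other to build the
evaluation cells. -/

namespace Bicoend

/-! ### Pseudofunctors into `Cat` as actions -/

section
variable {A : Type u₁} [Bicategory.{w₁, v₁} A] (F : Aᵒᵖ ⥤ᵖ Cat.{v, u})

/-- The functor `F b ⥤ F a` induced by `f : a ⟶ b`. -/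
def act {a b : A} (f : a ⟶ b) : F.obj (op b) ⥤ F.obj (op a) := (F.map f.op).toFunctor

/-- The 2-functorial action on 2-cells. -/
def actMap₂ {a b : A} {f g : a ⟶ b} (η : f ⟶ g) (s : F.obj (op b)) :
    (act F f).obj s ⟶ (act F g).obj s :=
  (F.map₂ (Bicategory.Opposite.op2 η)).toNatTrans.app s

/-- The identity constraint of the action. -/
def actId {a : A} (s : F.obj (op a)) : (act F (𝟙 a)).obj s ≅ s :=
  (Cat.Hom.toNatIso (F.mapId (op a))).app s

/-- The composition constraint of the action. -/
def actComp {a b c : A} (f : a ⟶ b) (g : b ⟶ c) (s : F.obj (op c)) :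
    (act F (f ≫ g)).obj s ≅ (act F f).obj ((act F g).obj s) :=
  (Cat.Hom.toNatIso (F.mapComp g.op f.op)).app s

theorem actMap₂_naturality {a b : A} {f g : a ⟶ b} (η : f ⟶ g) {s t : F.obj (op b)} (σ : s ⟶ t) :
    (act F f).map σ ≫ actMap₂ F η t = actMap₂ F η s ≫ (act F g).map σ :=
  (F.map₂ (Bicategory.Opposite.op2 η)).toNatTrans.naturality σ

@[simp]
theorem actMap₂_id {a b : A} (f : a ⟶ b) (s : F.obj (op b)) : actMap₂ F (𝟙 f) s = 𝟙 _ :=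
  congr($(F.map₂_id f.op).toNatTrans.app s)

theorem actMap₂_comp {a b : A} {f g h : a ⟶ b} (η : f ⟶ g) (θ : g ⟶ h) (s : F.obj (op b)) :
    actMap₂ F (η ≫ θ) s = actMap₂ F η s ≫ actMap₂ F θ s :=
  congr($(F.map₂_comp (Bicategory.Opposite.op2 η) (Bicategory.Opposite.op2 θ)).toNatTrans.app s)

theorem actId_naturality {a : A} {s t : F.obj (op a)} (σ : s ⟶ t) :
    (act F (𝟙 a)).map σ ≫ (actId F t).hom = (actId F s).hom ≫ σ :=
  (F.mapId (op a)).hom.toNatTrans.naturality σ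

theorem actComp_naturality {a b c : A} (f : a ⟶ b) (g : b ⟶ c) {s t : F.obj (op c)} (σ : s ⟶ t) :
    (act F (f ≫ g)).map σ ≫ (actComp F f g t).hom =
      (actComp F f g s).hom ≫ (act F f).map ((act F g).map σ) :=
  (F.mapComp g.op f.op).hom.toNatTrans.naturality σ

/-- Composition in `Aᵒᵖ` is reversed, so left and right are exchanged throughout: whiskering on the
right in `A` is governed by `map₂_whisker_left`, the left unitor by `map₂_right_unitor`, and the
inverse associator by `map₂_associator`. -/
theorem actMap₂_whiskerRight {a b c : A} {f f' : a ⟶ b} (η : f ⟶ f') (g : b ⟶ c)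
    (s : F.obj (op c)) :
    actMap₂ F (η ▷ g) s ≫ (actComp F f' g s).hom =
      (actComp F f g s).hom ≫ actMap₂ F η ((act F g).obj s) := by
  have h := congr($(F.map₂_whisker_left g.op (Bicategory.Opposite.op2 η)).toNatTrans.app s)
  replace h : actMap₂ F (η ▷ g) s =
    (actComp F f g s).hom ≫ actMap₂ F η ((act F g).obj s) ≫ (actComp F f' g s).inv := h
  simp [h]

theorem actMap₂_whiskerLeft {a b c : A} (f : a ⟶ b) {g g' : b ⟶ c} (η : g ⟶ g')
    (s : F.obj (op c)) :
    actMap₂ F (f ◁ η) s ≫ (actComp F f g' s).hom =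
      (actComp F f g s).hom ≫ (act F f).map (actMap₂ F η s) := by
  have h := congr($(F.map₂_whisker_right (Bicategory.Opposite.op2 η) f.op).toNatTrans.app s)
  replace h : actMap₂ F (f ◁ η) s =
    (actComp F f g s).hom ≫ (act F f).map (actMap₂ F η s) ≫ (actComp F f g' s).inv := h
  simp [h]

theorem actMap₂_associator_inv {a b c d : A} (f : a ⟶ b) (g : b ⟶ c) (h : c ⟶ d)
    (s : F.obj (op d)) :
    actMap₂ F (α_ f g h).inv s ≫ (actComp F (f ≫ g) h s).hom ≫
        (actComp F f g ((act F h).obj s)).hom =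
      (actComp F f (g ≫ h) s).hom ≫ (act F f).map (actComp F g h s).hom := by
  have e := congr($(F.map₂_associator h.op g.op f.op).toNatTrans.app s)
  -- The factor `𝟙 _` is the component of the associator of `Cat`.
  replace e : actMap₂ F (α_ f g h).inv s = (actComp F f (g ≫ h) s).hom ≫
    (act F f).map (actComp F g h s).hom ≫ 𝟙 _ ≫ (actComp F f g ((act F h).obj s)).inv ≫
      (actComp F (f ≫ g) h s).inv := e
  simp [e]

theorem actMap₂_leftUnitor {a b : A} (f : a ⟶ b) (s : F.obj (op b)) :
    actMap₂ F (λ_ f).hom s = (actComp F (𝟙 a) f s).hom ≫ (actId F ((act F f).obj s)).hom := by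
  have e := congr($(F.map₂_right_unitor f.op).toNatTrans.app s)
  replace e : actMap₂ F (λ_ f).hom s =
    (actComp F (𝟙 a) f s).hom ≫ (actId F ((act F f).obj s)).hom ≫ 𝟙 _ := e
  simp [e]

theorem actMap₂_rightUnitor {a b : A} (f : a ⟶ b) (s : F.obj (op b)) :
    actMap₂ F (ρ_ f).hom s = (actComp F f (𝟙 b) s).hom ≫ (act F f).map (actId F s).hom := by
  have e := congr($(F.map₂_left_unitor f.op).toNatTrans.app s)
  replace e : actMap₂ F (ρ_ f).hom s =
    (actComp F f (𝟙 b) s).hom ≫ (act F f).map (actId F s).hom ≫ 𝟙 _ := e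
  simp [e]

end

/-! ### Pseudonatural transformations and modifications, fibre by fibre -/

section
variable {A : Type u₁} [Bicategory.{w₁, v₁} A] {F G H : Aᵒᵖ ⥤ᵖ Cat.{v, u}}

/-- The component functor of a pseudonatural transformation. -/
def fib (γ : F ⟶ G) (a : A) : F.obj (op a) ⥤ G.obj (op a) := (γ.app (op a)).toFunctor

/-- The naturality constraint of a pseudonatural transformation, at an object. -/
def fibNat (γ : F ⟶ G) {a b : A} (f : a ⟶ b) (s : F.obj (op b)) :
    (fib γ a).obj ((act F f).obj s) ≅ (act G f).obj ((fib γ b).obj s) :=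
  (Cat.Hom.toNatIso (γ.naturality f.op)).app s

theorem fibNat_naturality (γ : F ⟶ G) {a b : A} (f : a ⟶ b) {s t : F.obj (op b)} (σ : s ⟶ t) :
    (fib γ a).map ((act F f).map σ) ≫ (fibNat γ f t).hom =
      (fibNat γ f s).hom ≫ (act G f).map ((fib γ b).map σ) :=
  (γ.naturality f.op).hom.toNatTrans.naturality σ

theorem fibNat_map₂ (γ : F ⟶ G) {a b : A} {f g : a ⟶ b} (η : f ⟶ g) (s : F.obj (op b)) :
    (fib γ a).map (actMap₂ F η s) ≫ (fibNat γ g s).hom =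
      (fibNat γ f s).hom ≫ actMap₂ G η ((fib γ b).obj s) :=
  st_nat γ (Bicategory.Opposite.op2 η) s

theorem fibNat_comp (γ : F ⟶ G) {a b c : A} (f : a ⟶ b) (g : b ⟶ c) (s : F.obj (op c)) :
    (fibNat γ (f ≫ g) s).hom ≫ (actComp G f g ((fib γ c).obj s)).hom =
      (fib γ a).map (actComp F f g s).hom ≫ (fibNat γ f ((act F g).obj s)).hom ≫
        (act G f).map (fibNat γ g s).hom :=
  st_comp γ g.op f.op s

theorem fibNat_id (γ : F ⟶ G) {a : A} (s : F.obj (op a)) :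
    (fibNat γ (𝟙 a) s).hom ≫ (actId G ((fib γ a).obj s)).hom = (fib γ a).map (actId F s).hom :=
  st_id γ (op a) s

/-- The component of a modification at an object. -/
def fibMap₂ {γ δ : F ⟶ G} (Γ : γ ⟶ δ) {a : A} (s : F.obj (op a)) :
    (fib γ a).obj s ⟶ (fib δ a).obj s :=
  (Γ.as.app (op a)).toNatTrans.app s

theorem fibMap₂_naturality {γ δ : F ⟶ G} (Γ : γ ⟶ δ) {a : A} {s t : F.obj (op a)} (σ : s ⟶ t) :
    (fib γ a).map σ ≫ fibMap₂ Γ t = fibMap₂ Γ s ≫ (fib δ a).map σ :=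
  (Γ.as.app (op a)).toNatTrans.naturality σ

theorem fibMap₂_fibNat {γ δ : F ⟶ G} (Γ : γ ⟶ δ) {a b : A} (f : a ⟶ b) (s : F.obj (op b)) :
    fibMap₂ Γ ((act F f).obj s) ≫ (fibNat δ f s).hom =
      (fibNat γ f s).hom ≫ (act G f).map (fibMap₂ Γ s) :=
  st_mod Γ f.op s

theorem fibNat_vcomp_hom (γ : F ⟶ G) (δ : G ⟶ H) {a b : A} (f : a ⟶ b) (s : F.obj (op b)) :
    (fibNat (γ ≫ δ) f s).hom =
      (fib δ a).map (fibNat γ f s).hom ≫ (fibNat δ f ((fib γ b).obj s)).hom :=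
  st_vcomp γ δ f.op s

theorem fibNat_vid_hom {a b : A} (f : a ⟶ b) (s : F.obj (op b)) :
    (fibNat (𝟙 F) f s).hom = 𝟙 _ :=
  st_vid f.op s

/-- Pseudonatural transformations into `Cat`-valued pseudofunctors from fibrewise data. -/
def mkTrans (φ : ∀ a : A, F.obj (op a) ⥤ G.obj (op a))
    (ν : ∀ {a b : A} (f : a ⟶ b) (s : F.obj (op b)),
      (φ a).obj ((act F f).obj s) ≅ (act G f).obj ((φ b).obj s))
    (hν : ∀ {a b : A} (f : a ⟶ b) {s t : F.obj (op b)} (σ : s ⟶ t),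
      (φ a).map ((act F f).map σ) ≫ (ν f t).hom = (ν f s).hom ≫ (act G f).map ((φ b).map σ))
    (hmap₂ : ∀ {a b : A} {f g : a ⟶ b} (η : f ⟶ g) (s : F.obj (op b)),
      (φ a).map (actMap₂ F η s) ≫ (ν g s).hom = (ν f s).hom ≫ actMap₂ G η ((φ b).obj s))
    (hid : ∀ {a : A} (s : F.obj (op a)),
      (ν (𝟙 a) s).hom ≫ (actId G ((φ a).obj s)).hom = (φ a).map (actId F s).hom)
    (hcomp : ∀ {a b c : A} (f : a ⟶ b) (g : b ⟶ c) (s : F.obj (op c)),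
      (ν (f ≫ g) s).hom ≫ (actComp G f g ((φ c).obj s)).hom =
        (φ a).map (actComp F f g s).hom ≫ (ν f ((act F g).obj s)).hom ≫
          (act G f).map (ν g s).hom) :
    F ⟶ G where
  app a := (φ a.unop).toCatHom
  naturality {a b} f := Cat.Hom.isoMk (NatIso.ofComponents
    (F := (act F f.unop) ⋙ φ b.unop) (G := φ a.unop ⋙ act G f.unop)
    (fun s => ν f.unop s) (fun σ => hν f.unop σ))
  naturality_naturality η := by
    ext s
    exact hmap₂ η.unop2 s
  naturality_id a := by
    ext s
    refine (hid (a := a.unop) s).trans ?_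
    -- The two identities are the components of the unitors of `Cat`.
    change _ = (φ a.unop).map (actId F s).hom ≫ 𝟙 _ ≫ 𝟙 _
    simp
  naturality_comp {a b c} f g := by
    ext s
    refine (hcomp g.unop f.unop s).trans ?_
    change _ = (φ c.unop).map (actComp F g.unop f.unop s).hom ≫ 𝟙 _ ≫
      (ν g.unop ((act F f.unop).obj s)).hom ≫ 𝟙 _ ≫ (act G g.unop).map (ν f.unop s).hom ≫ 𝟙 _
    simp

end
/-! ### The constraints of the integrand at an object -/

section
variable {C : Type u₁} [Category.{v₁} C]

theorem comp_eq_of_inv_eq_id {a b : C} (e : a ≅ a) (he : e.hom = 𝟙 a) (p : a ⟶ b) :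
    e.inv ≫ p = p := by
  rw [← cancel_epi e.hom, e.hom_inv_id_assoc, he, Category.id_comp]

theorem comp_eq_of_eq_id {a b : C} (p : a ⟶ b) {i : b ⟶ b} (hi : i = 𝟙 b) : p ≫ i = p := by
  rw [hi, Category.comp_id]

/-- This and the next two lemmas discard the identity factors left by the pseudofunctor axioms in
the constraints of the integrand. They are stated in an arbitrary category, so that they apply after
definitional unfolding. -/
theorem comp_id_twice {a b : C} {p q : a ⟶ b} (hp : p = q) {i : b ⟶ b} (hi : i = 𝟙 b) :
    (p ≫ i ≫ 𝟙 b) ≫ i ≫ 𝟙 b = q := by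
  simp [hp, hi]

theorem comp_id_inner {a b c : C} {p q : b ⟶ c} (hp : p = q) {i : b ⟶ b} (hi : i = 𝟙 b)
    (r : a ⟶ b) {t : a ⟶ c} (ht : r ≫ q = t) : (r ≫ 𝟙 b) ≫ (i ≫ 𝟙 b) ≫ p = t := by
  simp [hp, hi, ht]

theorem comp_id_middle {a b c d : C} {p p' : a ⟶ b} (hp : p = p') {q q' : c ⟶ d} (hq : q = q')
    {i : b ⟶ b} (hi : i = 𝟙 b) {j : c ⟶ c} (hj : j = 𝟙 c) (r : b ⟶ c) {t : a ⟶ d}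
    (ht : p' ≫ r ≫ q' = t) :
    (p ≫ i ≫ 𝟙 b) ≫ (r ≫ 𝟙 c) ≫ (j ≫ 𝟙 c) ≫ q = t := by
  simp [hp, hq, hi, hj, ht]

end

section
variable {A : Type u} [Bicategory.{w, v} A] (F : Aᵒᵖ ⥤ᵖ Cat.{w, v})

/-- The naturality constraints of `𝟙 F` are identities, so with the parameter fixed only the
composition constraint of `F` survives. -/
theorem evalFstMapComp_id_inv {a b c : A} {z z' z'' : A} (k : z ⟶ z') (l : z' ⟶ z'')
    (f : a ⟶ b) (g : b ⟶ c) (s : F.obj (op c)) :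
    (evalFstMapComp (X := (F, (op c, z))) (Y := (F, (op b, z'))) (W := (F, (op a, z'')))
      (𝟙 F, (g.op, k)) (𝟙 F, (f.op, l))).inv.toNatTrans.app s = (actComp F f g s).inv := by
  rw [evalFstMapComp_inv]
  change (fibNat (𝟙 F) f ((act F g).obj s)).inv ≫ (actComp F f g s).inv = _
  exact comp_eq_of_inv_eq_id (fibNat (𝟙 F) f ((act F g).obj s)) (fibNat_vid_hom f _) _

theorem evalFstMapComp_id_hom {a b c : A} {z z' z'' : A} (k : z ⟶ z') (l : z' ⟶ z'')
    (f : a ⟶ b) (g : b ⟶ c) (s : F.obj (op c)) :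
    (evalFstMapComp (X := (F, (op c, z))) (Y := (F, (op b, z'))) (W := (F, (op a, z'')))
      (𝟙 F, (g.op, k)) (𝟙 F, (f.op, l))).hom.toNatTrans.app s = (actComp F f g s).hom := by
  rw [evalFstMapComp_hom]
  change (actComp F f g s).hom ≫ (fibNat (𝟙 F) f ((act F g).obj s)).hom = _
  exact comp_eq_of_eq_id _ (fibNat_vid_hom f _)

/-- The two factors separate: the first gives the constraint of `F`, while the second consists of
structural 2-cells of `A` and is settled by coherence. -/
theorem fstComp_integrand_inv {x b b' b'' : A} (f : b ⟶ b') (g : b' ⟶ b'') (s : F.obj (op b''))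
    (h : x ⟶ b) :
    ((fstComp (fixFst (integrand A) F) g.op f.op b).inv.as.app (op x)).toNatTrans.app (s, h) =
      ((actComp F f g s).inv ×ₘ (ρ_ (h ≫ 𝟙 b)).hom) := by
  refine Prod.ext ?_ ?_
  · have e : (((fstComp (fixFst (integrand A) F) g.op f.op b).inv.as.app (op x)).toNatTrans.app
        (s, h)).1 = ((evalFstMapComp (X := (F, (op b'', b))) (Y := (F, (op b', b)))
          (W := (F, (op b, b))) (𝟙 F, (g.op, 𝟙 b)) (𝟙 F, (f.op, 𝟙 b))).inv.toNatTrans.app s ≫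
          (actMap₂ F (𝟙 _) s ≫ 𝟙 _)) ≫ (actMap₂ F (𝟙 _) s ≫ 𝟙 _) := rfl
    exact e.trans (comp_id_twice (evalFstMapComp_id_inv F (𝟙 b) (𝟙 b) f g s)
      (actMap₂_id F (f ≫ g) s))
  · have e : (((fstComp (fixFst (integrand A) F) g.op f.op b).inv.as.app (op x)).toNatTrans.app
        (s, h)).2 = ((α_ h (𝟙 b) (𝟙 b)).hom ≫ h ◁ 𝟙 _) ≫ h ◁ (λ_ (𝟙 b)).hom := rfl
    refine e.trans ?_
    change _ = (ρ_ (h ≫ 𝟙 b)).hom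
    rw [whiskerLeft_id, Category.comp_id]
    bicategory

/-- In the first factor, splitting `F(1)` into `F(1)F(1)` along `ρ⁻¹` inserts a unit inside `F(1)`,
by the right unit axiom. The second factor is a genuine associator. -/
theorem sndComp_integrand_hom {x b b' b'' c : A} (f : b ⟶ b') (g : b' ⟶ b'') (s : F.obj (op c))
    (h : x ⟶ b) :
    ((sndComp (fixFst (integrand A) F) (op c) f g).hom.as.app (op x)).toNatTrans.app (s, h) =
      ((act F (𝟙 c)).map (actId F s).inv ×ₘ (α_ h f g).inv) := by
  refine Prod.ext ?_ ?_
  · have e : (((sndComp (fixFst (integrand A) F) (op c) f g).hom.as.app (op x)).toNatTrans.app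
        (s, h)).1 = (actMap₂ F (ρ_ (𝟙 c)).inv s ≫ 𝟙 _) ≫ (actMap₂ F (𝟙 _) s ≫ 𝟙 _) ≫
        (evalFstMapComp (X := (F, (op c, b))) (Y := (F, (op c, b')))
          (W := (F, (op c, b''))) (𝟙 F, ((𝟙 c : c ⟶ c).op, f))
          (𝟙 F, ((𝟙 c : c ⟶ c).op, g))).hom.toNatTrans.app s := rfl
    have e' : actMap₂ F (ρ_ (𝟙 c)).inv s ≫ (actComp F (𝟙 c) (𝟙 c) s).hom =
        (act F (𝟙 c)).map (actId F s).inv := by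
      rw [← cancel_mono ((act F (𝟙 c)).map (actId F s).hom), Category.assoc,
        ← actMap₂_rightUnitor, ← actMap₂_comp, ← Functor.map_comp]
      simp
    exact e.trans (comp_id_inner (evalFstMapComp_id_hom F f g (𝟙 c) (𝟙 c) s)
      (actMap₂_id F (𝟙 c ≫ 𝟙 c) s) _ e')
  · have e : (((sndComp (fixFst (integrand A) F) (op c) f g).hom.as.app (op x)).toNatTrans.app
        (s, h)).2 = h ◁ 𝟙 _ ≫ h ◁ 𝟙 _ ≫ (α_ h f g).inv := rfl
    refine e.trans ?_
    change _ = (α_ h f g).inv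
    simp

/-- Interchange merely moves units: `F(1)F(g)` becomes `F(g)F(1)` by removing the outer unit and
inserting the inner one, and `h ≫ 1` is treated likewise. -/
theorem interchange_integrand_hom {x b b' c c' : A} (g : c ⟶ c') (f : b ⟶ b')
    (s : F.obj (op c')) (h : x ⟶ b) :
    ((interchange (fixFst (integrand A) F) g.op f).hom.as.app (op x)).toNatTrans.app (s, h) =
      ((actId F ((act F g).obj s)).hom ≫ (act F g).map (actId F s).inv ×ₘ
        (ρ_ h).hom ▷ f ≫ (ρ_ (h ≫ f)).inv) := by
  refine Prod.ext ?_ ?_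
  · have e : (((interchange (fixFst (integrand A) F) g.op f).hom.as.app (op x)).toNatTrans.app
        (s, h)).1 = ((evalFstMapComp (X := (F, (op c', b))) (Y := (F, (op c, b)))
          (W := (F, (op c, b'))) (𝟙 F, (g.op, 𝟙 b))
          (𝟙 F, ((𝟙 c : c ⟶ c).op, f))).inv.toNatTrans.app s ≫ (actMap₂ F (𝟙 _) s ≫ 𝟙 _)) ≫
        (actMap₂ F ((λ_ g).hom ≫ (ρ_ g).inv) s ≫ 𝟙 _) ≫ (actMap₂ F (𝟙 _) s ≫ 𝟙 _) ≫
        (evalFstMapComp (X := (F, (op c', b))) (Y := (F, (op c', b')))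
          (W := (F, (op c, b'))) (𝟙 F, ((𝟙 c' : c' ⟶ c').op, f))
          (𝟙 F, (g.op, 𝟙 b'))).hom.toNatTrans.app s := rfl
    have e' : (actComp F (𝟙 c) g s).inv ≫ actMap₂ F ((λ_ g).hom ≫ (ρ_ g).inv) s ≫
        (actComp F g (𝟙 c') s).hom =
          (actId F ((act F g).obj s)).hom ≫ (act F g).map (actId F s).inv := by
      rw [Iso.inv_comp_eq, ← cancel_mono ((act F g).map (actId F s).hom)]
      simp only [Category.assoc, ← Functor.map_comp, Iso.inv_hom_id, ← actMap₂_rightUnitor,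
        ← actMap₂_comp]
      simp [actMap₂_leftUnitor]
    exact e.trans (comp_id_middle (evalFstMapComp_id_inv F (𝟙 b) f (𝟙 c) g s)
      (evalFstMapComp_id_hom F f (𝟙 b') g (𝟙 c') s) (actMap₂_id F (𝟙 c ≫ g) s)
      (actMap₂_id F (g ≫ 𝟙 c') s) _ e')
  · have e : (((interchange (fixFst (integrand A) F) g.op f).hom.as.app (op x)).toNatTrans.app
        (s, h)).2 = ((α_ h (𝟙 b) f).hom ≫ h ◁ 𝟙 _) ≫ h ◁ ((λ_ f).hom ≫ (ρ_ f).inv) ≫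
          h ◁ 𝟙 _ ≫ (α_ h f (𝟙 b')).inv := rfl
    refine e.trans ?_
    change _ = (ρ_ h).hom ▷ f ≫ (ρ_ (h ≫ f)).inv
    simp

end
/-! ### Wedges: extrapseudonatural transformations with normalized cells -/

section
variable {C D E : Type*} [Category* C] [Category* D] [Category* E]

theorem map_mkHom_comp (Φ : C × D ⥤ E) {a b c : C} {x y z : D} (f : a ⟶ b) (g : b ⟶ c)
    (k : x ⟶ y) (l : y ⟶ z) :
    Φ.map (f ×ₘ k) ≫ Φ.map (g ×ₘ l) = Φ.map (f ≫ g ×ₘ k ≫ l) :=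
  (Φ.map_comp _ _).symm

theorem map_mkHom_id (Φ : C × D ⥤ E) (a : C) (x : D) : Φ.map (𝟙 a ×ₘ 𝟙 x) = 𝟙 (Φ.obj (a, x)) :=
  Φ.map_id (a, x)

end

section
variable {A : Type u} [Bicategory.{w, v} A]

/-- An extrapseudonatural transformation from `F(-) × A(x, -)` to the category `Y`, in which the
unit constraints have been removed from the cells. -/
structure Wedge (F : Aᵒᵖ ⥤ᵖ Cat.{w, v}) (x : A) (Y : Type v) [Category.{w} Y] where
  /-- The component functors. -/
  app (b : A) : F.obj (op b) × (x ⟶ b) ⥤ Y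
  /-- The cells. -/
  cell {b c : A} (f : b ⟶ c) (s : F.obj (op c)) (h : x ⟶ b) :
    (app b).obj ((act F f).obj s, h) ≅ (app c).obj (s, h ≫ f)
  cell_nat {b c : A} (f : b ⟶ c) {s t : F.obj (op c)} (σ : s ⟶ t) {h k : x ⟶ b} (θ : h ⟶ k) :
    (app b).map ((act F f).map σ ×ₘ θ) ≫ (cell f t k).hom =
      (cell f s h).hom ≫ (app c).map (σ ×ₘ θ ▷ f)
  cell_map₂ {b c : A} {f g : b ⟶ c} (η : f ⟶ g) (s : F.obj (op c)) (h : x ⟶ b) :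
    (app b).map (actMap₂ F η s ×ₘ 𝟙 h) ≫ (cell g s h).hom =
      (cell f s h).hom ≫ (app c).map (𝟙 s ×ₘ h ◁ η)
  cell_id {b : A} (s : F.obj (op b)) (h : x ⟶ b) :
    (cell (𝟙 b) s h).hom = (app b).map ((actId F s).hom ×ₘ (ρ_ h).inv)
  cell_comp {b c d : A} (f : b ⟶ c) (g : c ⟶ d) (s : F.obj (op d)) (h : x ⟶ b) :
    (app b).map ((actComp F f g s).hom ×ₘ 𝟙 h) ≫ (cell f ((act F g).obj s) h).hom ≫
        (cell g s (h ≫ f)).hom =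
      (cell (f ≫ g) s h).hom ≫ (app d).map (𝟙 s ×ₘ (α_ h f g).inv)

variable {F : Aᵒᵖ ⥤ᵖ Cat.{w, v}} {x : A} {Y : Type v} [Category.{w} Y]
  (Φ : ∀ b : A, F.obj (op b) × (x ⟶ b) ⥤ Y)

/-- Insertion of the unit constraints into a cell. -/
def insertUnits {b c : A} {f : b ⟶ c} {s : F.obj (op c)} {h : x ⟶ b}
    (n : (Φ b).obj ((act F f).obj s, h) ≅ (Φ c).obj (s, h ≫ f)) :
    (Φ b).obj ((act F f).obj s, h ≫ 𝟙 b) ≅ (Φ c).obj ((act F (𝟙 c)).obj s, h ≫ f) :=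
  (Φ b).mapIso (Iso.prod (Iso.refl _) (ρ_ h)) ≪≫ n ≪≫
    (Φ c).mapIso (Iso.prod (actId F s).symm (Iso.refl _))

/-- Removal of the unit constraints from a cell. -/
def removeUnits {b c : A} {f : b ⟶ c} {s : F.obj (op c)} {h : x ⟶ b}
    (n : (Φ b).obj ((act F f).obj s, h ≫ 𝟙 b) ≅ (Φ c).obj ((act F (𝟙 c)).obj s, h ≫ f)) :
    (Φ b).obj ((act F f).obj s, h) ≅ (Φ c).obj (s, h ≫ f) :=
  (Φ b).mapIso (Iso.prod (Iso.refl _) (ρ_ h).symm) ≪≫ n ≪≫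
    (Φ c).mapIso (Iso.prod (actId F s) (Iso.refl _))

theorem insertUnits_hom {b c : A} {f : b ⟶ c} {s : F.obj (op c)} {h : x ⟶ b}
    (n : (Φ b).obj ((act F f).obj s, h) ≅ (Φ c).obj (s, h ≫ f)) :
    (insertUnits Φ n).hom = (Φ b).map (𝟙 ((act F f).obj s) ×ₘ (ρ_ h).hom) ≫ n.hom ≫
      (Φ c).map ((actId F s).inv ×ₘ 𝟙 (h ≫ f)) := rfl

theorem removeUnits_hom {b c : A} {f : b ⟶ c} {s : F.obj (op c)} {h : x ⟶ b}
    (n : (Φ b).obj ((act F f).obj s, h ≫ 𝟙 b) ≅ (Φ c).obj ((act F (𝟙 c)).obj s, h ≫ f)) :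
    (removeUnits Φ n).hom = (Φ b).map (𝟙 ((act F f).obj s) ×ₘ (ρ_ h).inv) ≫ n.hom ≫
      (Φ c).map ((actId F s).hom ×ₘ 𝟙 (h ≫ f)) := rfl

theorem insertUnits_removeUnits {b c : A} {f : b ⟶ c} {s : F.obj (op c)} {h : x ⟶ b}
    (n : (Φ b).obj ((act F f).obj s, h ≫ 𝟙 b) ≅ (Φ c).obj ((act F (𝟙 c)).obj s, h ≫ f)) :
    insertUnits Φ (removeUnits Φ n) = n := by
  ext
  rw [insertUnits_hom, removeUnits_hom]
  simp only [Category.assoc, map_mkHom_comp, reassoc_of% map_mkHom_comp]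
  simp

variable (n : ∀ {b c : A} (f : b ⟶ c) (s : F.obj (op c)) (h : x ⟶ b),
  (Φ b).obj ((act F f).obj s, h) ≅ (Φ c).obj (s, h ≫ f))

/-- Unit constraints are natural, so both sides are the corresponding normalized sides flanked by
the same two isomorphisms, which cancel. The next two equivalences hold in the same way. -/
theorem insertUnits_nat_iff {b c : A} (f : b ⟶ c) {s t : F.obj (op c)} (σ : s ⟶ t) {h k : x ⟶ b}
    (θ : h ⟶ k) :
    (Φ b).map ((act F f).map σ ×ₘ θ ▷ 𝟙 b) ≫ (insertUnits Φ (n f t k)).hom =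
        (insertUnits Φ (n f s h)).hom ≫ (Φ c).map ((act F (𝟙 c)).map σ ×ₘ θ ▷ f) ↔
      (Φ b).map ((act F f).map σ ×ₘ θ) ≫ (n f t k).hom =
        (n f s h).hom ≫ (Φ c).map (σ ×ₘ θ ▷ f) := by
  have e : (actId F s).inv ≫ (act F (𝟙 c)).map σ = σ ≫ (actId F t).inv := by
    rw [Iso.inv_comp_eq, ← reassoc_of% actId_naturality]
    simp
  have h1 : (Φ b).map ((act F f).map σ ×ₘ θ ▷ 𝟙 b) ≫ (insertUnits Φ (n f t k)).hom =
      (Φ b).map (𝟙 ((act F f).obj s) ×ₘ (ρ_ h).hom) ≫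
        ((Φ b).map ((act F f).map σ ×ₘ θ) ≫ (n f t k).hom) ≫
        (Φ c).map ((actId F t).inv ×ₘ 𝟙 (k ≫ f)) := by
    rw [insertUnits_hom]
    simp only [Category.assoc, reassoc_of% map_mkHom_comp]
    simp
  have h2 : (insertUnits Φ (n f s h)).hom ≫ (Φ c).map ((act F (𝟙 c)).map σ ×ₘ θ ▷ f) =
      (Φ b).map (𝟙 ((act F f).obj s) ×ₘ (ρ_ h).hom) ≫
        ((n f s h).hom ≫ (Φ c).map (σ ×ₘ θ ▷ f)) ≫
        (Φ c).map ((actId F t).inv ×ₘ 𝟙 (k ≫ f)) := by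
    rw [insertUnits_hom]
    simp only [Category.assoc, map_mkHom_comp, e]
    simp
  rw [h1, h2]
  have : IsIso ((Φ b).map (𝟙 ((act F f).obj s) ×ₘ (ρ_ h).hom)) :=
    ((Φ b).mapIso (Iso.prod (Iso.refl _) (ρ_ h))).isIso_hom
  have : IsIso ((Φ c).map ((actId F t).inv ×ₘ 𝟙 (k ≫ f))) :=
    ((Φ c).mapIso (Iso.prod (actId F t).symm (Iso.refl _))).isIso_hom
  rw [cancel_epi, cancel_mono]

theorem insertUnits_map₂_iff {b c : A} {f g : b ⟶ c} (η : f ⟶ g) (s : F.obj (op c)) (h : x ⟶ b) :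
    (Φ b).map (actMap₂ F η s ×ₘ 𝟙 (h ≫ 𝟙 b)) ≫ (insertUnits Φ (n g s h)).hom =
        (insertUnits Φ (n f s h)).hom ≫ (Φ c).map (𝟙 ((act F (𝟙 c)).obj s) ×ₘ h ◁ η) ↔
      (Φ b).map (actMap₂ F η s ×ₘ 𝟙 h) ≫ (n g s h).hom =
        (n f s h).hom ≫ (Φ c).map (𝟙 s ×ₘ h ◁ η) := by
  have h1 : (Φ b).map (actMap₂ F η s ×ₘ 𝟙 (h ≫ 𝟙 b)) ≫ (insertUnits Φ (n g s h)).hom =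
      (Φ b).map (𝟙 ((act F f).obj s) ×ₘ (ρ_ h).hom) ≫
        ((Φ b).map (actMap₂ F η s ×ₘ 𝟙 h) ≫ (n g s h).hom) ≫
        (Φ c).map ((actId F s).inv ×ₘ 𝟙 (h ≫ g)) := by
    rw [insertUnits_hom]
    simp only [Category.assoc, reassoc_of% map_mkHom_comp]
    simp
  have h2 : (insertUnits Φ (n f s h)).hom ≫ (Φ c).map (𝟙 ((act F (𝟙 c)).obj s) ×ₘ h ◁ η) =
      (Φ b).map (𝟙 ((act F f).obj s) ×ₘ (ρ_ h).hom) ≫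
        ((n f s h).hom ≫ (Φ c).map (𝟙 s ×ₘ h ◁ η)) ≫
        (Φ c).map ((actId F s).inv ×ₘ 𝟙 (h ≫ g)) := by
    rw [insertUnits_hom]
    simp only [Category.assoc, map_mkHom_comp]
    simp
  rw [h1, h2]
  have : IsIso ((Φ b).map (𝟙 ((act F f).obj s) ×ₘ (ρ_ h).hom)) :=
    ((Φ b).mapIso (Iso.prod (Iso.refl _) (ρ_ h))).isIso_hom
  have : IsIso ((Φ c).map ((actId F s).inv ×ₘ 𝟙 (h ≫ g))) :=
    ((Φ c).mapIso (Iso.prod (actId F s).symm (Iso.refl _))).isIso_hom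
  rw [cancel_epi, cancel_mono]

theorem insertUnits_id_iff {b : A} (s : F.obj (op b)) (h : x ⟶ b) :
    (insertUnits Φ (n (𝟙 b) s h)).hom = 𝟙 _ ↔
      (n (𝟙 b) s h).hom = (Φ b).map ((actId F s).hom ×ₘ (ρ_ h).inv) := by
  have : IsIso ((Φ b).map (𝟙 ((act F (𝟙 b)).obj s) ×ₘ (ρ_ h).hom)) :=
    ((Φ b).mapIso (Iso.prod (Iso.refl _) (ρ_ h))).isIso_hom
  have : IsIso ((Φ b).map ((actId F s).inv ×ₘ 𝟙 (h ≫ 𝟙 b))) :=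
    ((Φ b).mapIso (Iso.prod (actId F s).symm (Iso.refl _))).isIso_hom
  have e : 𝟙 _ = (Φ b).map (𝟙 ((act F (𝟙 b)).obj s) ×ₘ (ρ_ h).hom) ≫
      (Φ b).map ((actId F s).hom ×ₘ (ρ_ h).inv) ≫
      (Φ b).map ((actId F s).inv ×ₘ 𝟙 (h ≫ 𝟙 b)) := by
    simp only [map_mkHom_comp]
    simp
  rw [insertUnits_hom, e, cancel_epi, cancel_mono]

/-- Here units also appear between the two cells. Naturality of the normalized cells (`hn`) slides a
right unitor through the cell at `f` and an identity constraint of `F` through the cell at `g`. What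
then remains in the middle is exactly the interchange isomorphism. -/
theorem insertUnits_comp_iff
    (hn : ∀ {b c : A} (f : b ⟶ c) {s t : F.obj (op c)} (σ : s ⟶ t) {h k : x ⟶ b} (θ : h ⟶ k),
      (Φ b).map ((act F f).map σ ×ₘ θ) ≫ (n f t k).hom =
        (n f s h).hom ≫ (Φ c).map (σ ×ₘ θ ▷ f))
    {b c d : A} (f : b ⟶ c) (g : c ⟶ d) (s : F.obj (op d)) (h : x ⟶ b) :
    (Φ b).map ((actComp F f g s).inv ×ₘ (ρ_ (h ≫ 𝟙 b)).hom) ≫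
          (insertUnits Φ (n (f ≫ g) s h)).hom ≫
          (Φ d).map ((act F (𝟙 d)).map (actId F s).inv ×ₘ (α_ h f g).inv) =
        (insertUnits Φ (n f ((act F g).obj s) (h ≫ 𝟙 b))).hom ≫
          (Φ c).map ((actId F ((act F g).obj s)).hom ≫ (act F g).map (actId F s).inv ×ₘ
            (ρ_ h).hom ▷ f ≫ (ρ_ (h ≫ f)).inv) ≫
          (insertUnits Φ (n g ((act F (𝟙 d)).obj s) (h ≫ f))).hom ↔
      (Φ b).map ((actComp F f g s).hom ×ₘ 𝟙 h) ≫ (n f ((act F g).obj s) h).hom ≫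
          (n g s (h ≫ f)).hom =
        (n (f ≫ g) s h).hom ≫ (Φ d).map (𝟙 s ×ₘ (α_ h f g).inv) := by
  have e : (actId F s).inv ≫ (act F (𝟙 d)).map (actId F s).inv =
      (actId F s).inv ≫ (actId F ((act F (𝟙 d)).obj s)).inv := by
    rw [← cancel_mono (actId F _).hom, Category.assoc, actId_naturality]
    simp
  have h1 : (Φ b).map ((actComp F f g s).inv ×ₘ (ρ_ (h ≫ 𝟙 b)).hom) ≫
      (insertUnits Φ (n (f ≫ g) s h)).hom ≫
      (Φ d).map ((act F (𝟙 d)).map (actId F s).inv ×ₘ (α_ h f g).inv) =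
      (Φ b).map ((actComp F f g s).inv ×ₘ (ρ_ (h ≫ 𝟙 b)).hom ≫ (ρ_ h).hom) ≫
      ((n (f ≫ g) s h).hom ≫ (Φ d).map (𝟙 s ×ₘ (α_ h f g).inv)) ≫
      (Φ d).map ((actId F s).inv ≫ (actId F ((act F (𝟙 d)).obj s)).inv ×ₘ 𝟙 ((h ≫ f) ≫ g)) := by
    rw [insertUnits_hom]
    simp only [Category.assoc, map_mkHom_comp, reassoc_of% map_mkHom_comp, e]
    simp
  have n1 := hn f (𝟙 ((act F g).obj s)) (ρ_ h).hom
  have n2 := hn g (actId F s).inv (𝟙 (h ≫ f))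
  have h2 : (insertUnits Φ (n f ((act F g).obj s) (h ≫ 𝟙 b))).hom ≫
      (Φ c).map ((actId F ((act F g).obj s)).hom ≫ (act F g).map (actId F s).inv ×ₘ
        (ρ_ h).hom ▷ f ≫ (ρ_ (h ≫ f)).inv) ≫
      (insertUnits Φ (n g ((act F (𝟙 d)).obj s) (h ≫ f))).hom =
      (Φ b).map ((actComp F f g s).inv ×ₘ (ρ_ (h ≫ 𝟙 b)).hom ≫ (ρ_ h).hom) ≫
      ((Φ b).map ((actComp F f g s).hom ×ₘ 𝟙 h) ≫ (n f ((act F g).obj s) h).hom ≫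
          (n g s (h ≫ f)).hom) ≫
      (Φ d).map ((actId F s).inv ≫ (actId F ((act F (𝟙 d)).obj s)).inv ×ₘ 𝟙 ((h ≫ f) ≫ g)) := by
    rw [insertUnits_hom, insertUnits_hom]
    have l1 : (Φ b).map ((actComp F f g s).inv ×ₘ (ρ_ (h ≫ 𝟙 b)).hom ≫ (ρ_ h).hom) ≫
        (Φ b).map ((actComp F f g s).hom ×ₘ 𝟙 h) =
        (Φ b).map (𝟙 ((act F f).obj ((act F g).obj s)) ×ₘ (ρ_ (h ≫ 𝟙 b)).hom) ≫
        (Φ b).map ((act F f).map (𝟙 _) ×ₘ (ρ_ h).hom) := by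
      rw [map_mkHom_comp, map_mkHom_comp, Iso.inv_hom_id, CategoryTheory.Functor.map_id, Category.comp_id,
        Category.comp_id]
    have l2 : (Φ d).map ((actId F s).inv ≫ (actId F ((act F (𝟙 d)).obj s)).inv ×ₘ
          𝟙 ((h ≫ f) ≫ g)) =
        (Φ d).map ((actId F s).inv ×ₘ 𝟙 (h ≫ f) ▷ g) ≫
        (Φ d).map ((actId F ((act F (𝟙 d)).obj s)).inv ×ₘ 𝟙 ((h ≫ f) ≫ g)) := by
      simp only [map_mkHom_comp, Category.comp_id, id_whiskerRight]
    have l3 : (Φ c).map (𝟙 ((act F g).obj s) ×ₘ (ρ_ h).hom ▷ f) ≫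
        (Φ c).map ((act F g).map (actId F s).inv ×ₘ 𝟙 (h ≫ f)) =
        (Φ c).map ((actId F ((act F g).obj s)).inv ×ₘ 𝟙 ((h ≫ 𝟙 b) ≫ f)) ≫
        (Φ c).map ((actId F ((act F g).obj s)).hom ≫ (act F g).map (actId F s).inv ×ₘ
          (ρ_ h).hom ▷ f ≫ (ρ_ (h ≫ f)).inv) ≫
        (Φ c).map (𝟙 ((act F g).obj ((act F (𝟙 d)).obj s)) ×ₘ (ρ_ (h ≫ f)).hom) := by
      simp only [map_mkHom_comp, Category.id_comp, Category.comp_id, Category.assoc,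
        Iso.inv_hom_id, Iso.inv_hom_id_assoc]
    simp only [Category.assoc]
    rw [reassoc_of% l1, l2, reassoc_of% n1, ← reassoc_of% n2, reassoc_of% l3]
  rw [h1, h2]
  have : IsIso ((Φ b).map ((actComp F f g s).inv ×ₘ (ρ_ (h ≫ 𝟙 b)).hom ≫ (ρ_ h).hom)) :=
    ((Φ b).mapIso (Iso.prod (actComp F f g s).symm (ρ_ (h ≫ 𝟙 b) ≪≫ ρ_ h))).isIso_hom
  have : IsIso ((Φ d).map ((actId F s).inv ≫ (actId F ((act F (𝟙 d)).obj s)).inv ×ₘ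
      𝟙 ((h ≫ f) ≫ g))) :=
    ((Φ d).mapIso (Iso.prod ((actId F s).symm ≪≫ (actId F ((act F (𝟙 d)).obj s)).symm)
      (Iso.refl _))).isIso_hom
  rw [cancel_epi, cancel_mono]
  -- The cell at `f ≫ g` is on the left with units and on the right without them.
  exact eq_comm

end
/-! ### Pseudonatural transformations out of `K × A(-, a)` -/

section
variable {A : Type u} [Bicategory.{w, v} A] {F : Aᵒᵖ ⥤ᵖ Cat.{w, v}}

/-- Pseudonatural transformations out of `K × A(-, a)` from their components. -/
def mkTensorTrans {K : Cat.{w, v}} {a : A} {G : Aᵒᵖ ⥤ᵖ Cat.{w, v}}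
    (φ : ∀ x : A, K × (x ⟶ a) ⥤ G.obj (op x))
    (ν : ∀ {x y : A} (g : y ⟶ x) (s : K) (h : x ⟶ a),
      (φ y).obj (s, g ≫ h) ≅ (act G g).obj ((φ x).obj (s, h)))
    (hν : ∀ {x y : A} (g : y ⟶ x) {s t : K} (σ : s ⟶ t) {h k : x ⟶ a} (θ : h ⟶ k),
      (φ y).map (σ ×ₘ g ◁ θ) ≫ (ν g t k).hom = (ν g s h).hom ≫ (act G g).map ((φ x).map (σ ×ₘ θ)))
    (hmap₂ : ∀ {x y : A} {f g : y ⟶ x} (η : f ⟶ g) (s : K) (h : x ⟶ a),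
      (φ y).map (𝟙 s ×ₘ η ▷ h) ≫ (ν g s h).hom =
        (ν f s h).hom ≫ actMap₂ G η ((φ x).obj (s, h)))
    (hid : ∀ {x : A} (s : K) (h : x ⟶ a),
      (ν (𝟙 x) s h).hom ≫ (actId G ((φ x).obj (s, h))).hom = (φ x).map (𝟙 s ×ₘ (λ_ h).hom))
    (hcomp : ∀ {x y z : A} (f : z ⟶ y) (g : y ⟶ x) (s : K) (h : x ⟶ a),
      (ν (f ≫ g) s h).hom ≫ (actComp G f g ((φ x).obj (s, h))).hom =
        (φ z).map (𝟙 s ×ₘ (α_ f g h).hom) ≫ (ν f s (g ≫ h)).hom ≫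
          (act G f).map (ν g s h).hom) :
    constProd K (Bicategory.yoneda.obj a) ⟶ G :=
  mkTrans (fun x => φ x) (fun g p => ν g p.1 p.2) (fun g _ _ σ => hν g σ.1 σ.2)
    (fun η p => hmap₂ η p.1 p.2) (fun p => hid p.1 p.2) (fun f g p => hcomp f g p.1 p.2)

variable {K : Cat.{w, v}} {a : A} {G : Aᵒᵖ ⥤ᵖ Cat.{w, v}}
  (β : constProd K (Bicategory.yoneda.obj a) ⟶ G)

/-- The components of a pseudonatural transformation out of `K × A(-, a)`. -/
def tfib (x : A) : K × (x ⟶ a) ⥤ G.obj (op x) := fib β x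

/-- The naturality constraint of a pseudonatural transformation out of `K × A(-, a)`. -/
def tfibNat {x y : A} (g : y ⟶ x) (s : K) (h : x ⟶ a) :
    (tfib β y).obj (s, g ≫ h) ≅ (act G g).obj ((tfib β x).obj (s, h)) :=
  fibNat β g (s, h)

theorem tfibNat_naturality {x y : A} (g : y ⟶ x) {s t : K} (σ : s ⟶ t) {h k : x ⟶ a}
    (θ : h ⟶ k) :
    (tfib β y).map (σ ×ₘ g ◁ θ) ≫ (tfibNat β g t k).hom =
      (tfibNat β g s h).hom ≫ (act G g).map ((tfib β x).map (σ ×ₘ θ)) :=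
  fibNat_naturality β g (s := (s, h)) (t := (t, k)) (σ ×ₘ θ)

theorem tfibNat_map₂ {x y : A} {f g : y ⟶ x} (η : f ⟶ g) (s : K) (h : x ⟶ a) :
    (tfib β y).map (𝟙 s ×ₘ η ▷ h) ≫ (tfibNat β g s h).hom =
      (tfibNat β f s h).hom ≫ actMap₂ G η ((tfib β x).obj (s, h)) :=
  fibNat_map₂ β η (s, h)

theorem tfibNat_id {x : A} (s : K) (h : x ⟶ a) :
    (tfibNat β (𝟙 x) s h).hom ≫ (actId G ((tfib β x).obj (s, h))).hom =
      (tfib β x).map (𝟙 s ×ₘ (λ_ h).hom) :=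
  fibNat_id β (a := x) (s, h)

theorem tfibNat_comp {x y z : A} (f : z ⟶ y) (g : y ⟶ x) (s : K) (h : x ⟶ a) :
    (tfibNat β (f ≫ g) s h).hom ≫ (actComp G f g ((tfib β x).obj (s, h))).hom =
      (tfib β z).map (𝟙 s ×ₘ (α_ f g h).hom) ≫ (tfibNat β f s (g ≫ h)).hom ≫
        (act G f).map (tfibNat β g s h).hom :=
  fibNat_comp β f g (s, h)

end

/-! ### Modifications between `Cat`-valued pseudofunctors -/

section
variable {A : Type u₁} [Bicategory.{w₁, v₁} A] {F G : Aᵒᵖ ⥤ᵖ Cat.{v, u}}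

/-- Invertible modifications from their components. -/
def mkModIso {γ δ : F ⟶ G} (e : ∀ (a : A) (s : F.obj (op a)), (fib γ a).obj s ≅ (fib δ a).obj s)
    (he : ∀ (a : A) {s t : F.obj (op a)} (σ : s ⟶ t),
      (fib γ a).map σ ≫ (e a t).hom = (e a s).hom ≫ (fib δ a).map σ)
    (hm : ∀ {a b : A} (f : a ⟶ b) (s : F.obj (op b)),
      (e a ((act F f).obj s)).hom ≫ (fibNat δ f s).hom =
        (fibNat γ f s).hom ≫ (act G f).map (e b s).hom) :
    γ ≅ δ :=
  Pseudofunctor.StrongTrans.isoMk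
    (fun a => Cat.Hom.isoMk (NatIso.ofComponents (F := fib γ a.unop) (G := fib δ a.unop)
      (e a.unop) (fun σ => he a.unop σ)))
    (fun {a b} f => by
      ext s
      exact hm f.unop s)

/-- Modifications from their components. -/
def mkMod {γ δ : F ⟶ G} (e : ∀ (a : A) (s : F.obj (op a)), (fib γ a).obj s ⟶ (fib δ a).obj s)
    (he : ∀ (a : A) {s t : F.obj (op a)} (σ : s ⟶ t),
      (fib γ a).map σ ≫ e a t = e a s ≫ (fib δ a).map σ)
    (hm : ∀ {a b : A} (f : a ⟶ b) (s : F.obj (op b)),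
      e a ((act F f).obj s) ≫ (fibNat δ f s).hom = (fibNat γ f s).hom ≫ (act G f).map (e b s)) :
    γ ⟶ δ where
  as := {
    app a := ⟨{ app s := e a.unop s, naturality _ _ σ := he a.unop σ }⟩
    naturality {a b} f := by
      ext s
      exact hm f.unop s }

end

/-! ### Evaluation -/

section
variable {A : Type u} [Bicategory.{w, v} A] (F : Aᵒᵖ ⥤ᵖ Cat.{w, v})

/-- The functor `(s, h) ↦ F(h)(s)`. -/
def evalFunctor (a x : A) : F.obj (op a) × (x ⟶ a) ⥤ F.obj (op x) where
  obj p := (act F p.2).obj p.1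
  map {p q} σ := (act F p.2).map σ.1 ≫ actMap₂ F σ.2 q.1
  map_id p := by
    change (act F p.2).map (𝟙 p.1) ≫ actMap₂ F (𝟙 p.2) p.1 = _
    simp
  map_comp {p q r} σ τ := by
    change (act F p.2).map (σ.1 ≫ τ.1) ≫ actMap₂ F (σ.2 ≫ τ.2) r.1 = _
    simp only [Functor.map_comp, Category.assoc, actMap₂_comp, reassoc_of% actMap₂_naturality]

/-- The evaluation transformation `F(a) × A(-, a) ⟶ F`. -/
def evalTrans (a : A) : constProd (F.obj (op a)) (Bicategory.yoneda.obj a) ⟶ F :=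
  mkTensorTrans (fun x => evalFunctor F a x) (fun g s h => actComp F g h s)
    (fun g s t σ h k θ => by
      change ((act F (g ≫ h)).map σ ≫ actMap₂ F (g ◁ θ) t) ≫ (actComp F g k t).hom =
        (actComp F g h s).hom ≫ (act F g).map ((act F h).map σ ≫ actMap₂ F θ t)
      rw [Category.assoc, actMap₂_whiskerLeft, reassoc_of% actComp_naturality, Functor.map_comp])
    (fun {x y f g} η s h => by
      change ((act F (f ≫ h)).map (𝟙 s) ≫ actMap₂ F (η ▷ h) s) ≫ (actComp F g h s).hom =
        (actComp F f h s).hom ≫ actMap₂ F η ((act F h).obj s)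
      rw [Category.assoc, actMap₂_whiskerRight, CategoryTheory.Functor.map_id, Category.id_comp])
    (fun {x} s h => by
      change (actComp F (𝟙 x) h s).hom ≫ (actId F ((act F h).obj s)).hom =
        (act F (𝟙 x ≫ h)).map (𝟙 s) ≫ actMap₂ F (λ_ h).hom s
      rw [actMap₂_leftUnitor, CategoryTheory.Functor.map_id, Category.id_comp])
    (fun f g s h => by
      change (actComp F (f ≫ g) h s).hom ≫ (actComp F f g ((act F h).obj s)).hom =
        ((act F ((f ≫ g) ≫ h)).map (𝟙 s) ≫ actMap₂ F (α_ f g h).hom s) ≫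
          (actComp F f (g ≫ h) s).hom ≫ (act F f).map (actComp F g h s).hom
      rw [CategoryTheory.Functor.map_id, Category.id_comp, ← actMap₂_associator_inv,
        ← reassoc_of% actMap₂_comp]
      simp)

/-- The normalized wedge of evaluations. -/
def evalWedge (x : A) : Wedge F x (F.obj (op x)) where
  app b := evalFunctor F b x
  cell f s h := (actComp F h f s).symm
  cell_nat {b c} f s t σ h k θ := by
    change ((act F h).map ((act F f).map σ) ≫ actMap₂ F θ ((act F f).obj t)) ≫
        (actComp F k f t).inv =
      (actComp F h f s).inv ≫ (act F (h ≫ f)).map σ ≫ actMap₂ F (θ ▷ f) t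
    rw [Iso.eq_inv_comp, ← cancel_mono (actComp F k f t).hom]
    simp only [Category.assoc, Iso.inv_hom_id, Category.comp_id, actMap₂_whiskerRight,
      reassoc_of% actComp_naturality]
  cell_map₂ {b c} f g η s h := by
    change ((act F h).map (actMap₂ F η s) ≫ actMap₂ F (𝟙 h) ((act F g).obj s)) ≫
        (actComp F h g s).inv =
      (actComp F h f s).inv ≫ (act F (h ≫ f)).map (𝟙 s) ≫ actMap₂ F (h ◁ η) s
    rw [Iso.eq_inv_comp, ← cancel_mono (actComp F h g s).hom]
    simp only [Category.assoc, Iso.inv_hom_id, Category.comp_id, actMap₂_whiskerLeft,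
      CategoryTheory.Functor.map_id, Category.id_comp, actMap₂_id]
  cell_id {b} s h := by
    change (actComp F h (𝟙 b) s).inv = (act F h).map (actId F s).hom ≫ actMap₂ F (ρ_ h).inv s
    rw [← cancel_epi (actComp F h (𝟙 b) s).hom, Iso.hom_inv_id, ← reassoc_of% actMap₂_rightUnitor, ← actMap₂_comp]
    simp
  cell_comp {b c d} f g s h := by
    change ((act F h).map (actComp F f g s).hom ≫ actMap₂ F (𝟙 h) ((act F f).obj
        ((act F g).obj s))) ≫ (actComp F h f ((act F g).obj s)).inv ≫
          (actComp F (h ≫ f) g s).inv =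
      (actComp F h (f ≫ g) s).inv ≫ (act F (h ≫ f ≫ g)).map (𝟙 s) ≫ actMap₂ F (α_ h f g).inv s
    rw [Iso.eq_inv_comp, actMap₂_id, Category.comp_id, CategoryTheory.Functor.map_id,
      Category.id_comp, ← reassoc_of% actMap₂_associator_inv]
    simp

end
/-! ### Extrapseudonatural transformations out of the integrand -/

section
variable {C : Type u₁} [Category.{v₁} C]

/-- The identities are the components of the associators of `Cat` in a pasting. -/
theorem comp_id_five {a b c d : C} (p : a ⟶ b) (q : b ⟶ c) (r : c ⟶ d) :
    𝟙 a ≫ p ≫ 𝟙 b ≫ q ≫ 𝟙 c ≫ r ≫ 𝟙 d = p ≫ q ≫ r := by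
  simp

end

section
variable {A : Type u} [Bicategory.{w, v} A] (F : Aᵒᵖ ⥤ᵖ Cat.{w, v})

theorem integrand_map₂_fst {b c d x : A} {f g : b ⟶ c} (γ : f ⟶ g) (s : F.obj (op c))
    (h : x ⟶ d) :
    (((fixFst (integrand A) F).map₂ (a := (op c, d)) (b := (op b, d)) (f := f.op ×ₘ 𝟙 d)
      (g := g.op ×ₘ 𝟙 d) (Bicategory.Opposite.op2 γ ×ₘ 𝟙 (𝟙 d))).as.app
      (op x)).toNatTrans.app ((s, h) : F.obj (op c) × (x ⟶ d)) =
        (actMap₂ F γ s ×ₘ 𝟙 (h ≫ 𝟙 d)) :=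
  Prod.ext (Category.comp_id (actMap₂ F γ s)) (whiskerLeft_id h (𝟙 d))

theorem integrand_map₂_snd {b c d x : A} {f g : b ⟶ c} (γ : f ⟶ g) (s : F.obj (op d))
    (h : x ⟶ b) :
    (((fixFst (integrand A) F).map₂ (a := (op d, b)) (b := (op d, c)) (f := 𝟙 (op d) ×ₘ f)
      (g := 𝟙 (op d) ×ₘ g) (𝟙 (𝟙 (op d)) ×ₘ γ)).as.app
      (op x)).toNatTrans.app ((s, h) : F.obj (op d) × (x ⟶ b)) =
        (𝟙 ((act F (𝟙 d)).obj s) ×ₘ h ◁ γ) :=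
  Prod.ext ((Category.comp_id (actMap₂ F (𝟙 (𝟙 d)) s)).trans (actMap₂_id F (𝟙 d) s)) rfl

end

/-! ### From extrapseudonatural transformations to normalized wedges -/

section
variable {A : Type u} [Bicategory.{w, v} A] {F : Aᵒᵖ ⥤ᵖ Cat.{w, v}} {x : A} {Y : Cat.{w, v}}
  (j : Extrapseudonat ((fixFst (integrand A) F).comp (Bicoend.evalPt (op x))) Y)

/-- The components of an extrapseudonatural transformation out of the integrand. -/
def Extrapseudonat.compFunctor (b : A) : F.obj (op b) × (x ⟶ b) ⥤ Y := (j.app b).toFunctor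

/-- The cells of an extrapseudonatural transformation out of the integrand. -/
def Extrapseudonat.cellIso {b c : A} (f : b ⟶ c) (s : F.obj (op c)) (h : x ⟶ b) :
    (j.compFunctor b).obj ((act F f).obj s, h ≫ 𝟙 b) ≅
      (j.compFunctor c).obj ((act F (𝟙 c)).obj s, h ≫ f) :=
  (Cat.Hom.toNatIso (j.cell f)).app (s, h)

/-- The normalized cells of an extrapseudonatural transformation out of the integrand. -/
def Extrapseudonat.normCell {b c : A} (f : b ⟶ c) (s : F.obj (op c)) (h : x ⟶ b) :
    (j.compFunctor b).obj ((act F f).obj s, h) ≅ (j.compFunctor c).obj (s, h ≫ f) :=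
  removeUnits j.compFunctor (j.cellIso f s h)

theorem Extrapseudonat.insertUnits_normCell {b c : A} (f : b ⟶ c) (s : F.obj (op c))
    (h : x ⟶ b) : insertUnits j.compFunctor (j.normCell f s h) = j.cellIso f s h :=
  insertUnits_removeUnits _ _

theorem Extrapseudonat.normCell_nat {b c : A} (f : b ⟶ c) {s t : F.obj (op c)} (σ : s ⟶ t)
    {h k : x ⟶ b} (θ : h ⟶ k) :
    (j.compFunctor b).map ((act F f).map σ ×ₘ θ) ≫ (j.normCell f t k).hom =
      (j.normCell f s h).hom ≫ (j.compFunctor c).map (σ ×ₘ θ ▷ f) := by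
  refine (insertUnits_nat_iff j.compFunctor j.normCell f σ θ).1 ?_
  rw [insertUnits_normCell, insertUnits_normCell]
  exact (j.cell f).hom.toNatTrans.naturality (X := (s, h)) (Y := (t, k)) (σ ×ₘ θ)

/-- The normalized wedge of an extrapseudonatural transformation out of the integrand. -/
def Extrapseudonat.wedge : Wedge F x Y where
  app := j.compFunctor
  cell := j.normCell
  cell_nat := j.normCell_nat
  cell_map₂ {b c} f g η s h := by
    refine (insertUnits_map₂_iff j.compFunctor j.normCell η s h).1 ?_
    rw [insertUnits_normCell, insertUnits_normCell, ← integrand_map₂_fst, ← integrand_map₂_snd]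
    exact congr($(j.cell_naturality η).toNatTrans.app (s, h))
  cell_id {b} s h := by
    refine (insertUnits_id_iff j.compFunctor j.normCell s h).1 ?_
    rw [insertUnits_normCell]
    exact congr(($(j.cell_id b).hom).toNatTrans.app (s, h))
  cell_comp {b c d} f g s h := by
    refine (insertUnits_comp_iff j.compFunctor j.normCell j.normCell_nat f g s h).1 ?_
    rw [insertUnits_normCell, insertUnits_normCell, insertUnits_normCell,
      ← fstComp_integrand_inv, ← sndComp_integrand_hom, ← interchange_integrand_hom]
    have e := j.cell_comp f g
    rw [fstComp_evalPt, sndComp_evalPt, interchange_evalPt] at e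
    refine congr($(e).toNatTrans.app (s, h)).trans ?_
    exact comp_id_five _ _ _

end

/-! ### The modification axiom for cells with and without units -/

section
variable {A : Type u} [Bicategory.{w, v} A] {F G : Aᵒᵖ ⥤ᵖ Cat.{w, v}} {x y : A}
  (Φ : ∀ b : A, constProd (F.obj (op b)) (Bicategory.yoneda.obj b) ⟶ G)

/-- The naturality constraints of `Φ b` and `Φ c` are natural in `(s, h)`, hence commute with the
unit isomorphisms; `rightUnitor_comp` absorbs the associator met on the way. This turns the
modification axiom of a cell into one for its normalization, and back. -/
theorem insertUnits_mod_iff (g : y ⟶ x) {b c : A} (f : b ⟶ c) (s : F.obj (op c)) (h : x ⟶ b)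
    (m : (tfib (Φ b) y).obj ((act F f).obj s, g ≫ h) ≅ (tfib (Φ c) y).obj (s, (g ≫ h) ≫ f))
    (n : (tfib (Φ b) x).obj ((act F f).obj s, h) ≅ (tfib (Φ c) x).obj (s, h ≫ f)) :
    (insertUnits (fun b => tfib (Φ b) y) m).hom ≫
        (tfib (Φ c) y).map (𝟙 ((act F (𝟙 c)).obj s) ×ₘ (α_ g h f).hom) ≫
          (tfibNat (Φ c) g ((act F (𝟙 c)).obj s) (h ≫ f)).hom =
      (tfib (Φ b) y).map (𝟙 ((act F f).obj s) ×ₘ (α_ g h (𝟙 b)).hom) ≫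
        (tfibNat (Φ b) g ((act F f).obj s) (h ≫ 𝟙 b)).hom ≫
          (act G g).map (insertUnits (fun b => tfib (Φ b) x) n).hom ↔
    m.hom ≫ (tfib (Φ c) y).map (𝟙 s ×ₘ (α_ g h f).hom) ≫ (tfibNat (Φ c) g s (h ≫ f)).hom =
      (tfibNat (Φ b) g ((act F f).obj s) h).hom ≫ (act G g).map n.hom := by
  have n1 := tfibNat_naturality (Φ c) g (actId F s).inv (𝟙 (h ≫ f))
  have n2 := tfibNat_naturality (Φ b) g (𝟙 ((act F f).obj s)) (ρ_ h).hom
  have h1 : (insertUnits (fun b => tfib (Φ b) y) m).hom ≫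
        (tfib (Φ c) y).map (𝟙 ((act F (𝟙 c)).obj s) ×ₘ (α_ g h f).hom) ≫
          (tfibNat (Φ c) g ((act F (𝟙 c)).obj s) (h ≫ f)).hom =
      (tfib (Φ b) y).map (𝟙 ((act F f).obj s) ×ₘ (ρ_ (g ≫ h)).hom) ≫
      (m.hom ≫ (tfib (Φ c) y).map (𝟙 s ×ₘ (α_ g h f).hom) ≫ (tfibNat (Φ c) g s (h ≫ f)).hom) ≫
      (act G g).map ((tfib (Φ c) x).map ((actId F s).inv ×ₘ 𝟙 (h ≫ f))) := by
    rw [insertUnits_hom]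
    simp only [Category.assoc]
    rw [← n1]
    simp [reassoc_of% map_mkHom_comp]
  have h2 : (tfib (Φ b) y).map (𝟙 ((act F f).obj s) ×ₘ (α_ g h (𝟙 b)).hom) ≫
        (tfibNat (Φ b) g ((act F f).obj s) (h ≫ 𝟙 b)).hom ≫
          (act G g).map (insertUnits (fun b => tfib (Φ b) x) n).hom =
      (tfib (Φ b) y).map (𝟙 ((act F f).obj s) ×ₘ (ρ_ (g ≫ h)).hom) ≫
      ((tfibNat (Φ b) g ((act F f).obj s) h).hom ≫ (act G g).map n.hom) ≫
      (act G g).map ((tfib (Φ c) x).map ((actId F s).inv ×ₘ 𝟙 (h ≫ f))) := by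
    rw [insertUnits_hom]
    simp only [Category.assoc, Functor.map_comp]
    rw [← reassoc_of% n2, reassoc_of% map_mkHom_comp, Category.comp_id, ← rightUnitor_comp]
  rw [h1, h2]
  have : IsIso ((tfib (Φ b) y).map (𝟙 ((act F f).obj s) ×ₘ (ρ_ (g ≫ h)).hom)) :=
    ((tfib (Φ b) y).mapIso (Iso.prod (Iso.refl _) (ρ_ (g ≫ h)))).isIso_hom
  have : IsIso ((tfib (Φ c) x).map ((actId F s).inv ×ₘ 𝟙 (h ≫ f))) :=
    ((tfib (Φ c) x).mapIso (Iso.prod (actId F s).symm (Iso.refl _))).isIso_hom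
  rw [cancel_epi, cancel_mono]

/-- Reindexing in the integrand is composition in the second factor, so its own naturality
constraint is an associator there and trivial in the first factor. -/
theorem fibNat_integrand_fst {b c : A} (f : b ⟶ c) (d : A)
    (β : constProd (F.obj (op b)) (Bicategory.yoneda.obj d) ⟶ G) (g : y ⟶ x)
    (s : F.obj (op c)) (h : x ⟶ d) :
    (fibNat ((fixFst (integrand A) F).map (f.op ×ₘ 𝟙 d) ≫ β) g (s, h)).hom =
      (tfib β y).map (𝟙 ((act F f).obj s) ×ₘ (α_ g h (𝟙 d)).hom) ≫
        (tfibNat β g ((act F f).obj s) (h ≫ 𝟙 d)).hom :=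
  (fibNat_vcomp_hom ((fixFst (integrand A) F).map (f.op ×ₘ 𝟙 d)) β g (s, h)).trans
    (congrArg (fun t => (tfib β y).map (t ×ₘ (α_ g h (𝟙 d)).hom) ≫
        (tfibNat β g ((act F f).obj s) (h ≫ 𝟙 d)).hom) (Category.id_comp (𝟙 ((act F f).obj s))))

theorem fibNat_integrand_snd {b c : A} (f : b ⟶ c) (d : A)
    (β : constProd (F.obj (op d)) (Bicategory.yoneda.obj c) ⟶ G) (g : y ⟶ x)
    (s : F.obj (op d)) (h : x ⟶ b) :
    (fibNat ((fixFst (integrand A) F).map (𝟙 (op d) ×ₘ f) ≫ β) g (s, h)).hom =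
      (tfib β y).map (𝟙 ((act F (𝟙 d)).obj s) ×ₘ (α_ g h f).hom) ≫
        (tfibNat β g ((act F (𝟙 d)).obj s) (h ≫ f)).hom :=
  (fibNat_vcomp_hom ((fixFst (integrand A) F).map (𝟙 (op d) ×ₘ f)) β g (s, h)).trans
    (congrArg (fun t => (tfib β y).map (t ×ₘ (α_ g h f).hom) ≫
        (tfibNat β g ((act F (𝟙 d)).obj s) (h ≫ f)).hom)
          (Category.id_comp (𝟙 ((act F (𝟙 d)).obj s))))

end

/-! ### The extrapseudonatural transformation of evaluations -/

section
variable {A : Type u} [Bicategory.{w, v} A] (F : Aᵒᵖ ⥤ᵖ Cat.{w, v})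

/-- This is the associativity coherence of `F` for `g`, `h`, `f`, arranged as the normalized
modification axiom for the evaluation cells. -/
theorem actComp_inv_comp {x y b c : A} (g : y ⟶ x) (f : b ⟶ c) (s : F.obj (op c)) (h : x ⟶ b) :
    (actComp F (g ≫ h) f s).inv ≫
        ((act F ((g ≫ h) ≫ f)).map (𝟙 s) ≫ actMap₂ F (α_ g h f).hom s) ≫
          (actComp F g (h ≫ f) s).hom =
      (actComp F g h ((act F f).obj s)).hom ≫ (act F g).map (actComp F h f s).inv := by
  rw [CategoryTheory.Functor.map_id, Category.id_comp, Iso.inv_comp_eq,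
    ← cancel_mono ((act F g).map (actComp F h f s).hom)]
  simp only [Category.assoc, ← Functor.map_comp, Iso.inv_hom_id,
    CategoryTheory.Functor.map_id, Category.comp_id]
  rw [← actMap₂_associator_inv, ← reassoc_of% actMap₂_comp]
  simp

/-- The composition axiom of a wedge, with units put back and the constraints of the integrand in
place of their computed values. -/
theorem Wedge.raw_comp {x : A} {Y : Type v} [Category.{w} Y] {F : Aᵒᵖ ⥤ᵖ Cat.{w, v}}
    (W : Wedge F x Y) {b c d : A} (f : b ⟶ c) (g : c ⟶ d) (s : F.obj (op d)) (h : x ⟶ b) :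
    (W.app b).map (((fstComp (fixFst (integrand A) F) g.op f.op b).inv.as.app
          (op x)).toNatTrans.app (s, h)) ≫
        (insertUnits W.app (W.cell (f ≫ g) s h)).hom ≫
          (W.app d).map (((sndComp (fixFst (integrand A) F) (op d) f g).hom.as.app
            (op x)).toNatTrans.app (s, h)) =
      (insertUnits W.app (W.cell f ((act F g).obj s) (h ≫ 𝟙 b))).hom ≫
        (W.app c).map (((interchange (fixFst (integrand A) F) g.op f).hom.as.app
          (op x)).toNatTrans.app (s, h)) ≫
        (insertUnits W.app (W.cell g ((act F (𝟙 d)).obj s) (h ≫ f))).hom := by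
  have e₁ := fstComp_integrand_inv F f g s h
  have e₂ := sndComp_integrand_hom F f g s h
  have e₃ := interchange_integrand_hom F g f s h
  exact (congrArg₂ (fun k l => (W.app b).map k ≫ (insertUnits W.app (W.cell (f ≫ g) s h)).hom ≫
    (W.app d).map l) e₁ e₂).trans (((insertUnits_comp_iff W.app W.cell W.cell_nat f g s h).2
      (W.cell_comp f g s h)).trans (congrArg (fun k =>
        (insertUnits W.app (W.cell f ((act F g).obj s) (h ≫ 𝟙 b))).hom ≫ (W.app c).map k ≫
          (insertUnits W.app (W.cell g ((act F (𝟙 d)).obj s) (h ≫ f))).hom) e₃.symm))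

/-- The extrapseudonaturality cells of the evaluation transformations. -/
def evalCell {b c : A} (f : b ⟶ c) :
    (fixFst (integrand A) F).map (f.op ×ₘ 𝟙 b) ≫ evalTrans F b ≅
      (fixFst (integrand A) F).map (𝟙 (op c) ×ₘ f) ≫ evalTrans F c :=
  mkModIso (fun x p => insertUnits (evalWedge F x).app ((evalWedge F x).cell f p.1 p.2))
    (fun x {p q} σ => (insertUnits_nat_iff (evalWedge F x).app (evalWedge F x).cell f σ.1 σ.2).2
      ((evalWedge F x).cell_nat f σ.1 σ.2))
    (fun {y x} g p => by
      have e₁ := fibNat_integrand_fst f b (evalTrans F b) g p.1 p.2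
      have e₂ := fibNat_integrand_snd f c (evalTrans F c) g p.1 p.2
      refine (congrArg (_ ≫ ·) e₂).trans (Eq.trans ?_ (congrArg (· ≫ _) e₁.symm))
      refine ((insertUnits_mod_iff (evalTrans F) g f p.1 p.2 ((evalWedge F y).cell f p.1 (g ≫ p.2))
        ((evalWedge F x).cell f p.1 p.2)).2 ?_).trans (Category.assoc _ _ _).symm
      exact actComp_inv_comp F g f p.1 p.2)

/-- The extrapseudonatural transformation of evaluations. -/
def evalExtra : Extrapseudonat (fixFst (integrand A) F) F where
  app b := evalTrans F b
  cell f := evalCell F f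
  cell_comp {b c d} f g := by
    ext x p
    exact ((evalWedge F x.unop).raw_comp f g p.1 p.2).trans (comp_id_five _ _ _).symm
  cell_id b := by
    ext x p
    exact (insertUnits_id_iff (evalWedge F x.unop).app (evalWedge F x.unop).cell p.1 p.2).2
      ((evalWedge F x.unop).cell_id p.1 p.2)
  cell_naturality {b c f g} γ := by
    ext x p
    have e := (insertUnits_map₂_iff (evalWedge F x.unop).app (evalWedge F x.unop).cell
      γ p.1 p.2).2 ((evalWedge F x.unop).cell_map₂ γ p.1 p.2)
    have e₁ := integrand_map₂_fst F γ p.1 p.2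
    have e₂ := integrand_map₂_snd F (d := c) γ p.1 p.2
    exact (congrArg (fun k => (evalFunctor F b x.unop).map k ≫ _) e₁).trans
      (e.trans (congrArg (fun k => _ ≫ (evalFunctor F c x.unop).map k) e₂.symm))

end
/-! ### The universal property at an object -/

section
variable {A : Type u} [Bicategory.{w, v} A] {F : Aᵒᵖ ⥤ᵖ Cat.{w, v}} {x : A} {Y : Type v}
  [Category.{w} Y] (W : Wedge F x Y)

/-- The functor induced by a wedge. -/
def Wedge.desc : F.obj (op x) ⥤ Y where
  obj s := (W.app x).obj (s, 𝟙 x)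
  map σ := (W.app x).map (σ ×ₘ 𝟙 (𝟙 x))
  map_id s := map_mkHom_id _ _ _
  map_comp σ τ := by rw [map_mkHom_comp, Category.comp_id]

/-- The comparison of the functor induced by a wedge with the components of the wedge. -/
def Wedge.descIso {b : A} (s : F.obj (op b)) (h : x ⟶ b) :
    W.desc.obj ((act F h).obj s) ≅ (W.app b).obj (s, h) :=
  W.cell h s (𝟙 x) ≪≫ (W.app b).mapIso (Iso.prod (Iso.refl s) (λ_ h))

/-- A morphism `(σ, θ)` acts through `F(h)(σ)` followed by `F(θ)`. The axiom `cell_map₂` carries the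
second past the cell and `cell_nat` the first; naturality of the left unitor does the rest. -/
theorem Wedge.descIso_naturality {b : A} {s t : F.obj (op b)} (σ : s ⟶ t) {h k : x ⟶ b}
    (θ : h ⟶ k) :
    W.desc.map ((act F h).map σ ≫ actMap₂ F θ t) ≫ (W.descIso t k).hom =
      (W.descIso s h).hom ≫ (W.app b).map (σ ×ₘ θ) := by
  change (W.app x).map ((act F h).map σ ≫ actMap₂ F θ t ×ₘ 𝟙 (𝟙 x)) ≫
      (W.cell k t (𝟙 x)).hom ≫ (W.app b).map (𝟙 t ×ₘ (λ_ k).hom) =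
    ((W.cell h s (𝟙 x)).hom ≫ (W.app b).map (𝟙 s ×ₘ (λ_ h).hom)) ≫ (W.app b).map (σ ×ₘ θ)
  have e : (W.app x).map ((act F h).map σ ≫ actMap₂ F θ t ×ₘ 𝟙 (𝟙 x)) =
      (W.app x).map ((act F h).map σ ×ₘ 𝟙 (𝟙 x)) ≫
        (W.app x).map (actMap₂ F θ t ×ₘ 𝟙 (𝟙 x)) := by
    rw [map_mkHom_comp, Category.comp_id]
  rw [e, Category.assoc, reassoc_of% W.cell_map₂, reassoc_of% W.cell_nat]
  simp only [map_mkHom_comp, Category.assoc]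
  simp

/-- This is the composition axiom of the wedge for `h` and `f`, taken at `1 : x ⟶ x`, together with
naturality of the cell at `f` along `λ_ h`. -/
theorem Wedge.descIso_cell {b c : A} (f : b ⟶ c) (s : F.obj (op c)) (h : x ⟶ b) :
    (W.descIso ((act F f).obj s) h).hom ≫ (W.cell f s h).hom =
      W.desc.map (actComp F h f s).inv ≫ (W.descIso s (h ≫ f)).hom := by
  change ((W.cell h ((act F f).obj s) (𝟙 x)).hom ≫
      (W.app b).map (𝟙 ((act F f).obj s) ×ₘ (λ_ h).hom)) ≫ (W.cell f s h).hom =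
    (W.app x).map ((actComp F h f s).inv ×ₘ 𝟙 (𝟙 x)) ≫ (W.cell (h ≫ f) s (𝟙 x)).hom ≫
      (W.app c).map (𝟙 s ×ₘ (λ_ (h ≫ f)).hom)
  have e := W.cell_nat f (𝟙 s) (λ_ h).hom
  rw [CategoryTheory.Functor.map_id] at e
  have i : IsIso ((W.app x).map ((actComp F h f s).hom ×ₘ 𝟙 (𝟙 x))) :=
    ((W.app x).mapIso (Iso.prod (actComp F h f s) (Iso.refl (𝟙 x)))).isIso_hom
  rw [Category.assoc, e, ← cancel_epi ((W.app x).map ((actComp F h f s).hom ×ₘ 𝟙 (𝟙 x))),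
    reassoc_of% W.cell_comp, map_mkHom_comp, reassoc_of% map_mkHom_comp,
    Iso.hom_inv_id, Category.comp_id, Category.comp_id, map_mkHom_id, Category.id_comp,
    leftUnitor_comp]

variable (F) in
/-- The cells of the evaluation transformations, on objects. -/
def evalCellHom {b c : A} (f : b ⟶ c) (s : F.obj (op c)) (h : x ⟶ b) :
    (act F (h ≫ 𝟙 b)).obj ((act F f).obj s) ⟶ (act F (h ≫ f)).obj ((act F (𝟙 c)).obj s) :=
  ((act F (h ≫ 𝟙 b)).map (𝟙 ((act F f).obj s)) ≫ actMap₂ F (ρ_ h).hom ((act F f).obj s)) ≫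
    (actComp F h f s).inv ≫ ((act F (h ≫ f)).map (actId F s).inv ≫
      actMap₂ F (𝟙 (h ≫ f)) ((act F (𝟙 c)).obj s))

variable (F) in
theorem map_evalCellHom (H : F.obj (op x) ⥤ Y) {b c : A} (f : b ⟶ c) (s : F.obj (op c))
    (h : x ⟶ b) :
    H.map (evalCellHom F f s h) =
      H.map ((act F (h ≫ 𝟙 b)).map (𝟙 ((act F f).obj s)) ≫
          actMap₂ F (ρ_ h).hom ((act F f).obj s)) ≫
        H.map (actComp F h f s).inv ≫ H.map ((act F (h ≫ f)).map (actId F s).inv ≫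
          actMap₂ F (𝟙 (h ≫ f)) ((act F (𝟙 c)).obj s)) := by
  simp only [evalCellHom, Functor.map_comp, Category.assoc]

/-- The compatibility demanded of the cells `J` in the one-dimensional universal property:
`Wedge.descIso_cell` with the units restored by naturality. -/
theorem Wedge.descIso_insertUnits {b c : A} (f : b ⟶ c) (s : F.obj (op c)) (h : x ⟶ b) :
    (W.descIso ((act F f).obj s) (h ≫ 𝟙 b)).hom ≫ (insertUnits W.app (W.cell f s h)).hom =
      W.desc.map (evalCellHom F f s h) ≫ (W.descIso ((act F (𝟙 c)).obj s) (h ≫ f)).hom := by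
  have e₁ := W.descIso_naturality (𝟙 ((act F f).obj s)) (ρ_ h).hom
  have e₂ := W.descIso_naturality (actId F s).inv (𝟙 (h ≫ f))
  rw [map_evalCellHom, Category.assoc, Category.assoc, e₂,
    ← reassoc_of% W.descIso_cell, reassoc_of% e₁, insertUnits_hom]

end

/-! ### The two-dimensional universal property at an object -/

section
variable {A : Type u} [Bicategory.{w, v} A] {F : Aᵒᵖ ⥤ᵖ Cat.{w, v}} {x : A} {Y : Type v}
  [Category.{w} Y] {H K : F.obj (op x) ⥤ Y}
  (Γ : ∀ {b : A} (s : F.obj (op b)) (h : x ⟶ b),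
    H.obj ((act F h).obj s) ⟶ K.obj ((act F h).obj s))

/-- The natural transformation induced by a family of natural transformations. -/
def descHomApp (s : F.obj (op x)) : H.obj s ⟶ K.obj s :=
  H.map (actId F s).inv ≫ Γ s (𝟙 x) ≫ K.map (actId F s).hom

/-- Uniqueness: naturality of `γ` along `F(1)(s) ≅ s` determines it from its values at the objects
`F(1)(s)`. -/
theorem eq_descHomApp (γ : H ⟶ K) (hγ : ∀ s, γ.app ((act F (𝟙 x)).obj s) = Γ s (𝟙 x))
    (s : F.obj (op x)) : γ.app s = descHomApp Γ s := by
  rw [descHomApp, ← hγ, ← γ.naturality, ← Functor.map_comp_assoc]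
  simp

theorem descHomApp_naturality
    (hnat : ∀ {b : A} {s t : F.obj (op b)} (σ : s ⟶ t) {h k : x ⟶ b} (θ : h ⟶ k),
      H.map ((act F h).map σ ≫ actMap₂ F θ t) ≫ Γ t k =
        Γ s h ≫ K.map ((act F h).map σ ≫ actMap₂ F θ t))
    {s t : F.obj (op x)} (σ : s ⟶ t) :
    H.map σ ≫ descHomApp Γ t = descHomApp Γ s ≫ K.map σ := by
  have e := hnat σ (𝟙 (𝟙 x))
  rw [actMap₂_id, Category.comp_id] at e
  have e₁ : σ ≫ (actId F t).inv = (actId F s).inv ≫ (act F (𝟙 x)).map σ := by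
    rw [Iso.eq_inv_comp, ← reassoc_of% actId_naturality]
    simp
  rw [descHomApp, descHomApp, ← Functor.map_comp_assoc, e₁, Functor.map_comp_assoc,
    reassoc_of% e, ← Functor.map_comp, actId_naturality]
  simp

/-- The compatibility condition for the arrow `h` itself, at `1 : x ⟶ x`, relates `Γ` at `(F(h)(s),
1)` to `Γ` at `(s, 1 ≫ h)`. The left unit axiom of `F` turns this relation into the conjugation
defining `descHomApp`. -/
theorem descHomApp_act
    (hnat : ∀ {b : A} {s t : F.obj (op b)} (σ : s ⟶ t) {h k : x ⟶ b} (θ : h ⟶ k),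
      H.map ((act F h).map σ ≫ actMap₂ F θ t) ≫ Γ t k =
        Γ s h ≫ K.map ((act F h).map σ ≫ actMap₂ F θ t))
    (hΓ : ∀ {b c : A} (f : b ⟶ c) (s : F.obj (op c)) (h : x ⟶ b),
      Γ ((act F f).obj s) (h ≫ 𝟙 b) ≫ K.map (evalCellHom F f s h) =
        H.map (evalCellHom F f s h) ≫ Γ ((act F (𝟙 c)).obj s) (h ≫ f))
    {b : A} (s : F.obj (op b)) (h : x ⟶ b) :
    descHomApp Γ ((act F h).obj s) = Γ s h := by
  -- Naturality along `ρ` and along the identity constraint (`e₁`, `e₂`) strips the units from this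
  -- instance; `e₃` then replaces `1 ≫ h` by `h`.
  have e₀ := hΓ h s (𝟙 x)
  have e₁ := hnat (𝟙 ((act F h).obj s)) (ρ_ (𝟙 x)).hom
  have e₂ := hnat (actId F s).inv (𝟙 (𝟙 x ≫ h))
  have e₃ := hnat (𝟙 s) (λ_ h).hom
  rw [map_evalCellHom, map_evalCellHom, Category.assoc, Category.assoc, e₂, ← reassoc_of% e₁] at e₀
  have i₁ : IsIso ((act F (𝟙 x ≫ 𝟙 x)).map (𝟙 ((act F h).obj s)) ≫
      actMap₂ F (ρ_ (𝟙 x)).hom ((act F h).obj s)) :=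
    ((evalFunctor F x x).mapIso (Iso.prod (Iso.refl ((act F h).obj s)) (ρ_ (𝟙 x)))).isIso_hom
  have i₂ : IsIso ((act F (𝟙 x ≫ h)).map (actId F s).inv ≫
          actMap₂ F (𝟙 (𝟙 x ≫ h)) ((act F (𝟙 b)).obj s)) :=
    ((evalFunctor F b x).mapIso (Iso.prod (actId F s).symm (Iso.refl (𝟙 x ≫ h)))).isIso_hom
  rw [cancel_epi, ← Category.assoc, ← Category.assoc (H.map _), cancel_mono] at e₀
  rw [CategoryTheory.Functor.map_id, Category.id_comp] at e₃
  have l : (actId F ((act F h).obj s)).hom =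
      (actComp F (𝟙 x) h s).inv ≫ actMap₂ F (λ_ h).hom s := by
    rw [actMap₂_leftUnitor, Iso.inv_hom_id_assoc]
  have l' : (actId F ((act F h).obj s)).inv ≫ (actComp F (𝟙 x) h s).inv ≫
      actMap₂ F (λ_ h).hom s = 𝟙 _ := by
    rw [← l, Iso.inv_hom_id]
  rw [descHomApp, l, K.map_comp, reassoc_of% e₀, ← e₃, ← H.map_comp_assoc, ← H.map_comp_assoc,
    Category.assoc, l', CategoryTheory.Functor.map_id, Category.id_comp]

end
section
variable {C : Type u₁} [Category.{v₁} C]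

theorem comp_id_three {a b c : C} (p : a ⟶ b) (q : b ⟶ c) : 𝟙 a ≫ p ≫ 𝟙 b ≫ q = p ≫ q := by
  simp

theorem eq_of_comp_id₂ {a b b' c : C} {p : a ⟶ b} {q : b ⟶ c} {p' : a ⟶ b'} {q' : b' ⟶ c}
    (h : p ≫ 𝟙 b ≫ q ≫ 𝟙 c = 𝟙 a ≫ p' ≫ 𝟙 b' ≫ q') : p ≫ q = p' ≫ q' := by
  simpa using h

end

section
variable {A : Type u} [Bicategory.{w, v} A] (F : Aᵒᵖ ⥤ᵖ Cat.{w, v})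

/-- At each object, the evaluation transformations exhibit `F` as a bicodescent object. -/
theorem evalExtra_evalPt_isBicodescent (x : Aᵒᵖ) : ((evalExtra F).evalPt x).IsBicodescent where
  exists_desc Y j := by
    let W : Wedge F x.unop Y := Extrapseudonat.wedge (x := x.unop) j
    refine ⟨W.desc.toCatHom, fun b => Cat.Hom.isoMk (NatIso.ofComponents
      (F := evalFunctor F b x.unop ⋙ W.desc) (G := W.app b) (fun p => W.descIso p.1 p.2)
      (fun σ => W.descIso_naturality σ.1 σ.2)), fun {b c} f => ?_⟩
    ext p
    refine Eq.trans ?_ (comp_id_three _ _).symm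
    refine Eq.trans ?_ (W.descIso_insertUnits f p.1 p.2)
    -- Inserting units into the normalized cell recovers the original cell of `j`.
    exact congrArg (fun e => _ ≫ e)
      (congrArg Iso.hom (Extrapseudonat.insertUnits_normCell (x := x.unop) j f p.1 p.2)).symm
  existsUnique_desc₂ Y h k Γ hΓ := by
    let Ξ : ∀ {b : A} (s : F.obj (op b)) (l : x.unop ⟶ b),
      h.toFunctor.obj ((act F l).obj s) ⟶ k.toFunctor.obj ((act F l).obj s) :=
        fun {b} s l => (Γ b).toNatTrans.app (s, l)
    have hnat : ∀ {b : A} {s t : F.obj (op b)} (σ : s ⟶ t) {l m : x.unop ⟶ b} (θ : l ⟶ m),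
        h.toFunctor.map ((act F l).map σ ≫ actMap₂ F θ t) ≫ Ξ t m =
          Ξ s l ≫ k.toFunctor.map ((act F l).map σ ≫ actMap₂ F θ t) :=
      fun {b} s t σ l m θ => (Γ b).toNatTrans.naturality (X := (s, l)) (Y := (t, m)) (σ ×ₘ θ)
    have hΞ : ∀ {b c : A} (f : b ⟶ c) (s : F.obj (op c)) (l : x.unop ⟶ b),
        Ξ ((act F f).obj s) (l ≫ 𝟙 b) ≫ k.toFunctor.map (evalCellHom F f s l) =
          h.toFunctor.map (evalCellHom F f s l) ≫ Ξ ((act F (𝟙 c)).obj s) (l ≫ f) := by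
      intro b c f s l
      have e := congr($(hΓ f).toNatTrans.app (s, l))
      exact eq_of_comp_id₂ e
    refine ⟨NatTrans.toCatHom₂ (F := h.toFunctor) (G := k.toFunctor)
      { app s := descHomApp Ξ s
        naturality _ _ σ := descHomApp_naturality Ξ hnat σ }, fun b => ?_, fun γ hγ => ?_⟩
    · ext p
      exact descHomApp_act Ξ hnat hΞ p.1 p.2
    · ext s
      -- Uniqueness needs only the component `b = x`, at pairs `(s, 1)`.
      exact eq_descHomApp Ξ γ.toNatTrans
        (fun s => congr($(hγ x.unop).toNatTrans.app (s, 𝟙 x.unop))) s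

end
/-! ### The universal property in pseudofunctors -/

section
variable {A : Type u} [Bicategory.{w, v} A] {F G : Aᵒᵖ ⥤ᵖ Cat.{w, v}} {h k : F ⟶ G}
  (Γ : ∀ {x b : A} (s : F.obj (op b)) (l : x ⟶ b),
    (fib h x).obj ((act F l).obj s) ⟶ (fib k x).obj ((act F l).obj s))

/-- Half of the modification axiom for the induced 2-cell. It is the modification axiom of `Γ` at `l
= 1`, with `g ≫ 1` replaced by `g` along `ρ_ g` and the units carried through the constraints of `h`
and `k`. -/
theorem fibNat_descHomApp
    (hnat : ∀ {x b : A} {s t : F.obj (op b)} (σ : s ⟶ t) {l m : x ⟶ b} (θ : l ⟶ m),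
      (fib h x).map ((act F l).map σ ≫ actMap₂ F θ t) ≫ Γ t m =
        Γ s l ≫ (fib k x).map ((act F l).map σ ≫ actMap₂ F θ t))
    (hmod : ∀ {x y b : A} (g : y ⟶ x) (s : F.obj (op b)) (l : x ⟶ b),
      Γ s (g ≫ l) ≫ (fib k y).map (actComp F g l s).hom ≫ (fibNat k g ((act F l).obj s)).hom =
        ((fib h y).map (actComp F g l s).hom ≫ (fibNat h g ((act F l).obj s)).hom) ≫
          (act G g).map (Γ s l))
    {x y : A} (g : y ⟶ x) (s : F.obj (op x)) :
    Γ s g ≫ (fibNat k g s).hom =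
      (fibNat h g s).hom ≫ (act G g).map (descHomApp (fun {b} => Γ (b := b)) s) := by
  have e := hmod g s (𝟙 x)
  have e₁ := hnat (𝟙 s) (ρ_ g).hom
  rw [CategoryTheory.Functor.map_id, Category.id_comp] at e₁
  have n₁ := fibNat_naturality h g (actId F s).inv
  have n₂ := fibNat_naturality k g (actId F s).hom
  have i : (act F g).map (actId F s).hom ≫ (act F g).map (actId F s).inv = 𝟙 _ := by
    rw [← Functor.map_comp, Iso.hom_inv_id, CategoryTheory.Functor.map_id]
  have : IsIso (actMap₂ F (ρ_ g).hom s) :=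
    ⟨actMap₂ F (ρ_ g).inv s, by rw [← actMap₂_comp]; simp, by rw [← actMap₂_comp]; simp⟩
  rw [descHomApp, Functor.map_comp, Functor.map_comp, ← reassoc_of% n₁,
    ← cancel_epi ((fib h y).map (actMap₂ F (ρ_ g).hom s)), reassoc_of% e₁]
  nth_rw 2 [actMap₂_rightUnitor]
  rw [← Functor.map_comp_assoc, Category.assoc, i, Category.comp_id]
  rw [Category.assoc] at e
  rw [← reassoc_of% e, ← n₂, ← Functor.map_comp_assoc, ← actMap₂_rightUnitor]

end

section
variable {A : Type u} [Bicategory.{w, v} A] {F : Aᵒᵖ ⥤ᵖ Cat.{w, v}} {x : A} {Y : Type v}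
  [Category.{w} Y] (W : Wedge F x Y)

/-- The comparison `Wedge.descIso`, with the induced functor unfolded. -/
def Wedge.unitIso {b : A} (s : F.obj (op b)) (h : x ⟶ b) :
    (W.app x).obj ((act F h).obj s, 𝟙 x) ≅ (W.app b).obj (s, h) :=
  W.descIso s h

theorem Wedge.unitIso_hom {b : A} (s : F.obj (op b)) (h : x ⟶ b) :
    (W.unitIso s h).hom = (W.cell h s (𝟙 x)).hom ≫ (W.app b).map (𝟙 s ×ₘ (λ_ h).hom) := rfl

theorem Wedge.unitIso_naturality {b : A} {s t : F.obj (op b)} (σ : s ⟶ t) {h k : x ⟶ b}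
    (θ : h ⟶ k) :
    (W.app x).map ((act F h).map σ ≫ actMap₂ F θ t ×ₘ 𝟙 (𝟙 x)) ≫ (W.unitIso t k).hom =
      (W.unitIso s h).hom ≫ (W.app b).map (σ ×ₘ θ) :=
  W.descIso_naturality σ θ

theorem Wedge.unitIso_cell {b c : A} (f : b ⟶ c) (s : F.obj (op c)) (h : x ⟶ b) :
    (W.unitIso ((act F f).obj s) h).hom ≫ (W.cell f s h).hom =
      (W.app x).map ((actComp F h f s).inv ×ₘ 𝟙 (𝟙 x)) ≫ (W.unitIso s (h ≫ f)).hom :=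
  W.descIso_cell f s h

end

/-! ### The induced pseudonatural transformation -/

section
variable {A : Type u} [Bicategory.{w, v} A] {F G : Aᵒᵖ ⥤ᵖ Cat.{w, v}}
  (j : Extrapseudonat (fixFst (integrand A) F) G)

/-- The wedge at an object of an extrapseudonatural transformation. -/
def Extrapseudonat.wedgeAt (x : A) : Wedge F x (G.obj (op x)) :=
  Extrapseudonat.wedge (j.evalPt (op x))

/-- The components of an extrapseudonatural transformation out of the integrand. -/
def Extrapseudonat.comp (b : A) : constProd (F.obj (op b)) (Bicategory.yoneda.obj b) ⟶ G :=
  j.app b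

/-- The naturality constraints of the components of an extrapseudonatural transformation. -/
def Extrapseudonat.wedgeNat {x y b : A} (g : y ⟶ x) (s : F.obj (op b)) (h : x ⟶ b) :
    ((j.wedgeAt y).app b).obj (s, g ≫ h) ≅ (act G g).obj (((j.wedgeAt x).app b).obj (s, h)) :=
  tfibNat (j.comp b) g s h

theorem Extrapseudonat.wedgeNat_naturality {x y b : A} (g : y ⟶ x) {s t : F.obj (op b)}
    (σ : s ⟶ t) {h k : x ⟶ b} (θ : h ⟶ k) :
    ((j.wedgeAt y).app b).map (σ ×ₘ g ◁ θ) ≫ (j.wedgeNat g t k).hom =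
      (j.wedgeNat g s h).hom ≫ (act G g).map (((j.wedgeAt x).app b).map (σ ×ₘ θ)) :=
  tfibNat_naturality (j.comp b) g σ θ

theorem Extrapseudonat.wedgeNat_map₂ {x y b : A} {f g : y ⟶ x} (η : f ⟶ g) (s : F.obj (op b))
    (h : x ⟶ b) :
    ((j.wedgeAt y).app b).map (𝟙 s ×ₘ η ▷ h) ≫ (j.wedgeNat g s h).hom =
      (j.wedgeNat f s h).hom ≫ actMap₂ G η (((j.wedgeAt x).app b).obj (s, h)) :=
  tfibNat_map₂ (j.comp b) η s h

theorem Extrapseudonat.wedgeNat_id {x b : A} (s : F.obj (op b)) (h : x ⟶ b) :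
    (j.wedgeNat (𝟙 x) s h).hom ≫ (actId G (((j.wedgeAt x).app b).obj (s, h))).hom =
      ((j.wedgeAt x).app b).map (𝟙 s ×ₘ (λ_ h).hom) :=
  tfibNat_id (j.comp b) s h

theorem Extrapseudonat.wedgeNat_comp {x y z b : A} (f : z ⟶ y) (g : y ⟶ x) (s : F.obj (op b))
    (h : x ⟶ b) :
    (j.wedgeNat (f ≫ g) s h).hom ≫ (actComp G f g (((j.wedgeAt x).app b).obj (s, h))).hom =
      ((j.wedgeAt z).app b).map (𝟙 s ×ₘ (α_ f g h).hom) ≫ (j.wedgeNat f s (g ≫ h)).hom ≫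
        (act G f).map (j.wedgeNat g s h).hom :=
  tfibNat_comp (j.comp b) f g s h

/-- The cell of `j` at `f` is a modification; removing the units from its axiom gives this relation
between the wedges at `x` and `y`. -/
theorem Extrapseudonat.wedgeNat_cell {x y b c : A} (g : y ⟶ x) (f : b ⟶ c) (s : F.obj (op c))
    (h : x ⟶ b) :
    ((j.wedgeAt y).cell f s (g ≫ h)).hom ≫
        ((j.wedgeAt y).app c).map (𝟙 s ×ₘ (α_ g h f).hom) ≫ (j.wedgeNat g s (h ≫ f)).hom =
      (j.wedgeNat g ((act F f).obj s) h).hom ≫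
        (act G g).map ((j.wedgeAt x).cell f s h).hom := by
  refine (insertUnits_mod_iff j.comp g f s h ((j.wedgeAt y).cell f s (g ≫ h))
    ((j.wedgeAt x).cell f s h)).1 ?_
  have e₁ := (j.evalPt (op x)).insertUnits_normCell f s h
  have e₂ := (j.evalPt (op y)).insertUnits_normCell f s (g ≫ h)
  have e := fibMap₂_fibNat (j.cell f).hom g (s, h)
  have n₁ := fibNat_integrand_fst f b (j.comp b) g s h
  have n₂ := fibNat_integrand_snd f c (j.comp c) g s h
  refine Eq.trans (congrArg₂ (fun k l => Iso.hom k ≫ l) e₂ n₂.symm) (e.trans ?_)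
  exact (congrArg₂ (fun k l => l ≫ (act G g).map (Iso.hom k)) e₁.symm n₁).trans
    (Category.assoc _ _ _)

/-- The naturality constraints of the induced pseudonatural transformation. -/
def Extrapseudonat.descNat {x y : A} (g : y ⟶ x) (s : F.obj (op x)) :
    ((j.wedgeAt y).app y).obj ((act F g).obj s, 𝟙 y) ≅
      (act G g).obj (((j.wedgeAt x).app x).obj (s, 𝟙 x)) :=
  -- The right unitor rewrites `g` as `g ≫ 1`, so that the naturality constraint of `j_x` can
  -- extract `g`.
  (j.wedgeAt y).unitIso s g ≪≫
    ((j.wedgeAt y).app x).mapIso (Iso.prod (Iso.refl s) (ρ_ g).symm) ≪≫ j.wedgeNat g s (𝟙 x)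

theorem Extrapseudonat.descNat_hom {x y : A} (g : y ⟶ x) (s : F.obj (op x)) :
    (j.descNat g s).hom = ((j.wedgeAt y).unitIso s g).hom ≫
      ((j.wedgeAt y).app x).map (𝟙 s ×ₘ (ρ_ g).inv) ≫ (j.wedgeNat g s (𝟙 x)).hom := rfl

theorem Extrapseudonat.descNat_naturality {x y : A} (g : y ⟶ x) {s t : F.obj (op x)}
    (σ : s ⟶ t) :
    ((j.wedgeAt y).app y).map ((act F g).map σ ×ₘ 𝟙 (𝟙 y)) ≫ (j.descNat g t).hom =
      (j.descNat g s).hom ≫ (act G g).map (((j.wedgeAt x).app x).map (σ ×ₘ 𝟙 (𝟙 x))) := by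
  have e := (j.wedgeAt y).unitIso_naturality σ (𝟙 g)
  rw [actMap₂_id, Category.comp_id] at e
  rw [descNat_hom, descNat_hom, reassoc_of% e, Category.assoc, Category.assoc,
    ← wedgeNat_naturality, reassoc_of% map_mkHom_comp, reassoc_of% map_mkHom_comp]
  simp

theorem Extrapseudonat.descNat_map₂ {x y : A} {f g : y ⟶ x} (η : f ⟶ g) (s : F.obj (op x)) :
    ((j.wedgeAt y).app y).map (actMap₂ F η s ×ₘ 𝟙 (𝟙 y)) ≫ (j.descNat g s).hom =
      (j.descNat f s).hom ≫ actMap₂ G η (((j.wedgeAt x).app x).obj (s, 𝟙 x)) := by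
  have e := (j.wedgeAt y).unitIso_naturality (𝟙 s) η
  rw [CategoryTheory.Functor.map_id, Category.id_comp] at e
  rw [descNat_hom, descNat_hom, reassoc_of% e, Category.assoc, Category.assoc,
    ← wedgeNat_map₂, reassoc_of% map_mkHom_comp, reassoc_of% map_mkHom_comp]
  simp

/-- The identity axioms of the wedge and of the components of `j` reduce the left side to unitors at
`1`, which cancel because `λ_ 1 = ρ_ 1`. -/
theorem Extrapseudonat.descNat_id {x : A} (s : F.obj (op x)) :
    (j.descNat (𝟙 x) s).hom ≫ (actId G (((j.wedgeAt x).app x).obj (s, 𝟙 x))).hom =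
      ((j.wedgeAt x).app x).map ((actId F s).hom ×ₘ 𝟙 (𝟙 x)) := by
  have c := (j.wedgeAt x).cell_id s (𝟙 x)
  rw [descNat_hom, Wedge.unitIso_hom, Category.assoc, Category.assoc, Category.assoc,
    wedgeNat_id, c, map_mkHom_comp, map_mkHom_comp, map_mkHom_comp, unitors_equal]
  simp

/-- The fundamental compatibility of the comparison isomorphisms with the naturality constraints. -/
theorem Extrapseudonat.descNat_unitIso {x y b : A} (g : y ⟶ x) (f : x ⟶ b) (s : F.obj (op b)) :
    ((j.wedgeAt y).app y).map ((actComp F g f s).hom ×ₘ 𝟙 (𝟙 y)) ≫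
        (j.descNat g ((act F f).obj s)).hom ≫ (act G g).map ((j.wedgeAt x).unitIso s f).hom =
      ((j.wedgeAt y).unitIso s (g ≫ f)).hom ≫ (j.wedgeNat g s f).hom := by
  -- After `wedgeNat_cell` moves the cell at `f` from `x` to `y`, `c` slides it past `ρ_ g`, and `d`
  -- merges it with the comparison at `g` into the comparison at `g ≫ f`.
  have c := (j.wedgeAt y).cell_nat f (𝟙 s) (ρ_ g).inv
  rw [CategoryTheory.Functor.map_id] at c
  have d := (j.wedgeAt y).unitIso_cell f s g
  rw [descNat_hom, Wedge.unitIso_hom (j.wedgeAt x), Functor.map_comp, Category.assoc,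
    Category.assoc, ← reassoc_of% wedgeNat_cell, reassoc_of% c, ← wedgeNat_naturality, reassoc_of% d,
    reassoc_of% map_mkHom_comp, Iso.hom_inv_id, Category.comp_id, map_mkHom_id, Category.id_comp,
    reassoc_of% map_mkHom_comp, reassoc_of% map_mkHom_comp]
  -- The triangle identity removes the remaining structural 2-cells.
  have t : (ρ_ g).inv ▷ f ≫ (α_ g (𝟙 x) f).hom ≫ g ◁ (λ_ f).hom = 𝟙 _ := by simp
  simp only [Category.assoc, t, Category.comp_id, map_mkHom_id, Category.id_comp]

/-- Unfolding the constraint at `g` exposes a comparison isomorphism, which `descNat_unitIso` moves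
across the constraint at `f`. The composition axiom of the components of `j` remains. -/
theorem Extrapseudonat.descNat_comp {x y z : A} (f : z ⟶ y) (g : y ⟶ x) (s : F.obj (op x)) :
    (j.descNat (f ≫ g) s).hom ≫ (actComp G f g (((j.wedgeAt x).app x).obj (s, 𝟙 x))).hom =
      ((j.wedgeAt z).app z).map ((actComp F f g s).hom ×ₘ 𝟙 (𝟙 z)) ≫
        (j.descNat f ((act F g).obj s)).hom ≫ (act G f).map (j.descNat g s).hom := by
  have e := j.descNat_unitIso f g s
  rw [j.descNat_hom g, Functor.map_comp, Functor.map_comp, reassoc_of% e, j.descNat_hom (f ≫ g),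
    Category.assoc, Category.assoc, wedgeNat_comp, ← reassoc_of% wedgeNat_naturality,
    reassoc_of% map_mkHom_comp]
  simp

/-- The pseudonatural transformation induced by an extrapseudonatural transformation. -/
def Extrapseudonat.descTrans : F ⟶ G :=
  mkTrans (fun x => (j.wedgeAt x).desc) (fun g s => j.descNat g s)
    (fun g _ _ σ => j.descNat_naturality g σ) (fun η s => j.descNat_map₂ η s)
    (fun s => j.descNat_id s) (fun f g s => j.descNat_comp f g s)

/-- The comparison of the induced transformation with the given components. -/
def Extrapseudonat.descTransIso (b : A) : evalTrans F b ≫ j.descTrans ≅ j.app b :=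
  mkModIso (fun x p => (j.wedgeAt x).descIso p.1 p.2)
    (fun x _ _ σ => (j.wedgeAt x).descIso_naturality σ.1 σ.2)
    (fun {y x} g p => by
      -- The modification axiom of the comparison is exactly `descNat_unitIso`.
      refine (j.descNat_unitIso g p.2 p.1).symm.trans (Eq.trans ?_
        (congrArg (· ≫ _) (fibNat_vcomp_hom (evalTrans F b) j.descTrans g p)).symm)
      exact (Category.assoc _ _ _).symm)

end

/-! ### Evaluation as a bicodescent object of pseudofunctors -/

section
variable {A : Type u} [Bicategory.{w, v} A] (F : Aᵒᵖ ⥤ᵖ Cat.{w, v})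

/-- The evaluation transformations exhibit `F` as the bicodescent object of `F(-) × A(-, -)`. -/
theorem evalExtra_isBicodescent : (evalExtra F).IsBicodescent where
  exists_desc G j := by
    refine ⟨j.descTrans, j.descTransIso, fun {b c} f => ?_⟩
    ext x p
    let W := j.wedgeAt x.unop
    refine Eq.trans ?_ (comp_id_three _ _).symm
    refine Eq.trans ?_ (W.descIso_insertUnits f p.1 p.2)
    exact congrArg (fun e => _ ≫ e)
      (congrArg Iso.hom ((j.evalPt x).insertUnits_normCell (x := x.unop) f p.1 p.2)).symm
  existsUnique_desc₂ G h k Γ hΓ := by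
    let Ξ : ∀ {x b : A} (s : F.obj (op b)) (l : x ⟶ b),
      (fib h x).obj ((act F l).obj s) ⟶ (fib k x).obj ((act F l).obj s) :=
        fun {x b} s l => ((Γ b).as.app (op x)).toNatTrans.app (s, l)
    have hnat : ∀ {x b : A} {s t : F.obj (op b)} (σ : s ⟶ t) {l m : x ⟶ b} (θ : l ⟶ m),
        (fib h x).map ((act F l).map σ ≫ actMap₂ F θ t) ≫ Ξ t m =
          Ξ s l ≫ (fib k x).map ((act F l).map σ ≫ actMap₂ F θ t) :=
      fun {x b} s t σ l m θ => ((Γ b).as.app (op x)).toNatTrans.naturality (X := (s, l))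
        (Y := (t, m)) (σ ×ₘ θ)
    have hΞ : ∀ {x b c : A} (f : b ⟶ c) (s : F.obj (op c)) (l : x ⟶ b),
        Ξ ((act F f).obj s) (l ≫ 𝟙 b) ≫ (fib k x).map (evalCellHom F f s l) =
          (fib h x).map (evalCellHom F f s l) ≫ Ξ ((act F (𝟙 c)).obj s) (l ≫ f) := by
      intro x b c f s l
      have e := congr(($(hΓ f).as.app (op x)).toNatTrans.app (s, l))
      exact eq_of_comp_id₂ e
    -- This is the modification axiom of `Γ b`; the constraint of evaluation followed by `h` is the
    -- composition constraint of `F` followed by that of `h`.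
    have hmod : ∀ {x y b : A} (g : y ⟶ x) (s : F.obj (op b)) (l : x ⟶ b),
        Ξ s (g ≫ l) ≫ (fib k y).map (actComp F g l s).hom ≫
            (fibNat k g ((act F l).obj s)).hom =
          ((fib h y).map (actComp F g l s).hom ≫ (fibNat h g ((act F l).obj s)).hom) ≫
            (act G g).map (Ξ s l) := by
      intro x y b g s l
      have e := fibMap₂_fibNat (Γ b) g (s, l)
      have e₁ := fibNat_vcomp_hom (evalTrans F b) h g (s, l)
      have e₂ := fibNat_vcomp_hom (evalTrans F b) k g (s, l)
      exact ((congrArg (_ ≫ ·) e₂).symm.trans e).trans (congrArg (· ≫ _) e₁)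
    refine ⟨mkMod (fun x s => descHomApp (fun {b} => Ξ (x := x) (b := b)) s)
      (fun x {s t} σ => descHomApp_naturality _ hnat σ) (fun {y x} g s => ?_), fun b => ?_,
      fun γ hγ => ?_⟩
    -- The value at `F(g)(s)` is `Γ` at `(s, g)`, which supplies the other half of the modification
    -- axiom.
    · rw [← fibNat_descHomApp Ξ hnat hmod g s]
      exact congrArg (· ≫ _) (descHomApp_act _ hnat hΞ s g)
    · ext x p
      exact descHomApp_act (fun {b} => Ξ (x := x.unop) (b := b)) hnat hΞ p.1 p.2
    · ext x s
      exact eq_descHomApp (fun {b} => Ξ (x := x.unop) (b := b)) (γ.as.app x).toNatTrans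
        (fun s => congr(($(hγ x.unop).as.app x).toNatTrans.app (s, 𝟙 x.unop))) s

end
/-! ### Pseudonaturality of evaluation -/

section
variable {A : Type u} [Bicategory.{w, v} A] (F : Aᵒᵖ ⥤ᵖ Cat.{w, v})

/-- The composition constraint of the action, as a naturality constraint of evaluation. -/
def evalComp {x y b : A} (g : y ⟶ x) (s : F.obj (op b)) (h : x ⟶ b) :
    (evalFunctor F b y).obj (s, g ≫ h) ≅ (act F g).obj ((evalFunctor F b x).obj (s, h)) :=
  actComp F g h s

theorem evalComp_naturality {x y b : A} (g : y ⟶ x) {s t : F.obj (op b)} (σ : s ⟶ t)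
    {h k : x ⟶ b} (θ : h ⟶ k) :
    (evalFunctor F b y).map (σ ×ₘ g ◁ θ) ≫ (evalComp F g t k).hom =
      (evalComp F g s h).hom ≫ (act F g).map ((evalFunctor F b x).map (σ ×ₘ θ)) :=
  tfibNat_naturality (evalTrans F b) g σ θ

/-- The composition constraint of the action, as a dinaturality constraint of evaluation. -/
def evalAssoc {x b c : A} (h : x ⟶ b) (f : b ⟶ c) (s : F.obj (op c)) :
    (evalFunctor F b x).obj ((act F f).obj s, h) ≅ (evalFunctor F c x).obj (s, h ≫ f) :=
  (actComp F h f s).symm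

theorem evalAssoc_naturality {x b c : A} (f : b ⟶ c) {s t : F.obj (op c)} (σ : s ⟶ t)
    {h k : x ⟶ b} (θ : h ⟶ k) :
    (evalFunctor F b x).map ((act F f).map σ ×ₘ θ) ≫ (evalAssoc F k f t).hom =
      (evalAssoc F h f s).hom ≫ (evalFunctor F c x).map (σ ×ₘ θ ▷ f) :=
  (evalWedge F x).cell_nat f σ θ

variable {F} {G H : Aᵒᵖ ⥤ᵖ Cat.{w, v}} (γ : F ⟶ G)

/-- The naturality constraint of a pseudonatural transformation, as a naturality constraint of
evaluation. -/
def evalNat {x b : A} (s : F.obj (op b)) (h : x ⟶ b) :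
    (evalFunctor G b x).obj ((fib γ b).obj s, h) ≅
      (fib γ x).obj ((evalFunctor F b x).obj (s, h)) :=
  (fibNat γ h s).symm

theorem evalNat_naturality {x b : A} {s t : F.obj (op b)} (σ : s ⟶ t) {h k : x ⟶ b}
    (θ : h ⟶ k) :
    (evalFunctor G b x).map ((fib γ b).map σ ×ₘ θ) ≫ (evalNat γ t k).hom =
      (evalNat γ s h).hom ≫ (fib γ x).map ((evalFunctor F b x).map (σ ×ₘ θ)) := by
  change ((act G h).map ((fib γ b).map σ) ≫ actMap₂ G θ ((fib γ b).obj t)) ≫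
      (fibNat γ k t).inv =
    (fibNat γ h s).inv ≫ (fib γ x).map ((act F h).map σ ≫ actMap₂ F θ t)
  rw [Iso.eq_inv_comp, ← cancel_mono (fibNat γ k t).hom]
  simp only [Category.assoc, Iso.inv_hom_id, Category.comp_id, Functor.map_comp, fibNat_map₂,
    reassoc_of% fibNat_naturality]

/-- The composition axiom of `γ` for `g ≫ h`, solved so as to say that the constraints of `γ` form a
modification in `x`. -/
theorem evalNat_evalComp {x y b : A} (g : y ⟶ x) (s : F.obj (op b)) (h : x ⟶ b) :
    (evalNat γ s (g ≫ h)).hom ≫ (fib γ y).map (evalComp F g s h).hom ≫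
        (fibNat γ g ((evalFunctor F b x).obj (s, h))).hom =
      (evalComp G g ((fib γ b).obj s) h).hom ≫ (act G g).map (evalNat γ s h).hom := by
  change (fibNat γ (g ≫ h) s).inv ≫ (fib γ y).map (actComp F g h s).hom ≫
      (fibNat γ g ((act F h).obj s)).hom =
    (actComp G g h ((fib γ b).obj s)).hom ≫ (act G g).map (fibNat γ h s).inv
  rw [Iso.inv_comp_eq, reassoc_of% fibNat_comp, ← Functor.map_comp, Iso.hom_inv_id,
    CategoryTheory.Functor.map_id, Category.comp_id]

/-- The same axiom for `h ≫ f`, with the second arrow now in the dinatural variable; this is the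
core of the compatibility between `Γ^γ` and the cells of `i`. -/
theorem evalNat_evalAssoc {x b c : A} (h : x ⟶ b) (f : b ⟶ c) (s : F.obj (op c)) :
    (evalFunctor G b x).map ((fibNat γ f s).inv ×ₘ 𝟙 h) ≫ (evalNat γ ((act F f).obj s) h).hom ≫
        (fib γ x).map (evalAssoc F h f s).hom =
      (evalAssoc G h f ((fib γ c).obj s)).hom ≫ (evalNat γ s (h ≫ f)).hom := by
  change ((act G h).map (fibNat γ f s).inv ≫ actMap₂ G (𝟙 h) _) ≫
      (fibNat γ h ((act F f).obj s)).inv ≫ (fib γ x).map (actComp F h f s).inv =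
    (actComp G h f ((fib γ c).obj s)).inv ≫ (fibNat γ (h ≫ f) s).inv
  have e := fibNat_comp γ h f s
  have i : IsIso ((fib γ x).map (actComp F h f s).hom) :=
    ((fib γ x).mapIso (actComp F h f s)).isIso_hom
  rw [actMap₂_id, Category.comp_id, Iso.eq_inv_comp, ← cancel_mono (fibNat γ (h ≫ f) s).hom]
  simp only [Category.assoc, Iso.inv_hom_id]
  rw [← cancel_mono (actComp G h f ((fib γ c).obj s)).hom]
  simp only [Category.assoc, e, ← Functor.map_comp_assoc, Iso.inv_hom_id]
  simp [← Functor.map_comp]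

theorem evalNat_comp (δ : G ⟶ H) {x b : A} (s : F.obj (op b)) (h : x ⟶ b) :
    (evalNat (γ ≫ δ) s h).hom =
      (evalNat δ ((fib γ b).obj s) h).hom ≫ (fib δ x).map (evalNat γ s h).hom := by
  change (fibNat (γ ≫ δ) h s).inv =
    (fibNat δ h ((fib γ b).obj s)).inv ≫ (fib δ x).map (fibNat γ h s).inv
  have e : fibNat (γ ≫ δ) h s =
      (fib δ x).mapIso (fibNat γ h s) ≪≫ fibNat δ h ((fib γ b).obj s) :=
    Iso.ext (fibNat_vcomp_hom γ δ h s)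
  exact congrArg Iso.inv e

theorem evalNat_id {x b : A} (s : F.obj (op b)) (h : x ⟶ b) :
    (evalNat (𝟙 F) s h).hom = 𝟙 _ := by
  have e : (fibNat (𝟙 F) h s).inv ≫ 𝟙 _ = 𝟙 _ :=
    comp_eq_of_inv_eq_id (fibNat (𝟙 F) h s) (fibNat_vid_hom h s) _
  exact (Category.comp_id _).symm.trans e

theorem evalNat_fibMap₂ {γ δ : F ⟶ G} (Γ : γ ⟶ δ) {x b : A} (s : F.obj (op b)) (h : x ⟶ b) :
    (evalFunctor G b x).map (fibMap₂ Γ s ×ₘ 𝟙 h) ≫ (evalNat δ s h).hom =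
      (evalNat γ s h).hom ≫ fibMap₂ Γ ((evalFunctor F b x).obj (s, h)) := by
  change ((act G h).map (fibMap₂ Γ s) ≫ actMap₂ G (𝟙 h) _) ≫ (fibNat δ h s).inv =
    (fibNat γ h s).inv ≫ fibMap₂ Γ ((act F h).obj s)
  rw [actMap₂_id, Category.comp_id, Iso.eq_inv_comp, ← cancel_mono (fibNat δ h s).hom]
  simp only [Category.assoc, Iso.inv_hom_id, Category.comp_id, fibMap₂_fibNat]

end

/-! ### The constraints of the integrand in the first variable -/

section
variable {C : Type u₁} [Category.{v₁} C] {D : Type u₂} [Category.{v₂} D] (T : C ⥤ D)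

theorem comp_id_left {a b : C} {i : a ⟶ a} (hi : i = 𝟙 a) (r : a ⟶ b) :
    (i ≫ 𝟙 a) ≫ 𝟙 a ≫ r = r := by
  simp [hi]

theorem comp_map_map {a b c : C} {p : a ⟶ b} {q : b ⟶ c} {q' : T.obj b ⟶ T.obj c}
    (hq : q' = T.map q) {r : a ⟶ c} (hr : p ≫ q = r) :
    (T.map p ≫ 𝟙 _) ≫ q' = T.map r := by
  simp [hq, ← hr]

theorem comp_map_inner {a b c d : C} {z : D} {p : a ⟶ b} {q : b ⟶ c} {r : c ⟶ d} {t : z ⟶ T.obj a}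
    {p' : z ⟶ T.obj b} (hp : p' = t ≫ T.map p) {r' : T.obj c ⟶ T.obj d} (hr : r' = T.map r)
    {k : a ⟶ d} (hk : p ≫ q ≫ r = k) :
    p' ≫ (T.map q ≫ 𝟙 _ ≫ 𝟙 _) ≫ r' = t ≫ T.map k := by
  simp [hp, hr, ← hk]

end

section
variable {A : Type u₁} [Bicategory.{w₁, v₁} A] {F G : Aᵒᵖ ⥤ᵖ Cat.{v, u}}

/-- The first factor of the integrand's composition constraint in the parameter: the unit axioms of
`γ` and `F` collapse it to an inverse identity constraint of `G`. -/
theorem fib_map_actMap₂_actComp (γ : F ⟶ G) {b : A} (s : F.obj (op b)) :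
    (fib γ b).map (actMap₂ F (ρ_ (𝟙 b)).inv s) ≫
        (fib γ b).map (actComp F (𝟙 b) (𝟙 b) s).hom ≫
          (fibNat γ (𝟙 b) ((act F (𝟙 b)).obj s)).hom =
      (actId G ((fib γ b).obj ((act F (𝟙 b)).obj s))).inv := by
  rw [← cancel_mono (actId G ((fib γ b).obj ((act F (𝟙 b)).obj s))).hom]
  simp only [Category.assoc, fibNat_id, Iso.inv_hom_id, ← Functor.map_comp]
  rw [← actMap₂_leftUnitor, ← actMap₂_comp, unitors_equal, Iso.inv_hom_id]
  simp

variable (F) in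
theorem actComp_inv_actMap₂_unitors {b c : A} (f : b ⟶ c) (s : F.obj (op c)) :
    (actComp F f (𝟙 c) s).inv ≫ actMap₂ F ((ρ_ f).hom ≫ (λ_ f).inv) s ≫
        (actComp F (𝟙 b) f s).hom =
      (act F f).map (actId F s).hom ≫ (actId F ((act F f).obj s)).inv := by
  rw [Iso.inv_comp_eq, ← cancel_mono (actId F ((act F f).obj s)).hom]
  simp only [Category.assoc, Iso.inv_hom_id, Category.comp_id, ← actMap₂_leftUnitor,
    ← actMap₂_rightUnitor, ← actMap₂_comp]

end

section
variable {A : Type u} [Bicategory.{w, v} A] {F G H : Aᵒᵖ ⥤ᵖ Cat.{w, v}}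

theorem integrand_map₂_param {γ δ : F ⟶ G} (η : γ ⟶ δ) {x b : A} (s : F.obj (op b)) (h : x ⟶ b) :
    (((fixSnd (integrand A) (op b, b)).map₂ η).as.app (op x)).toNatTrans.app
      ((s, h) : F.obj (op b) × (x ⟶ b)) =
        (fibMap₂ η ((act F (𝟙 b)).obj s) ×ₘ 𝟙 (h ≫ 𝟙 b)) := by
  refine Prod.ext ?_ (whiskerLeft_id h (𝟙 b))
  have e : (fib γ b).map (actMap₂ F (𝟙 (𝟙 b)) s) ≫ fibMap₂ η ((act F (𝟙 b)).obj s) =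
    fibMap₂ η ((act F (𝟙 b)).obj s) := by simp
  exact e

theorem integrand_mapId_param {x b : A} (s : F.obj (op b)) (h : x ⟶ b) :
    (((fixSnd (integrand A) (op b, b)).mapId F).hom.as.app (op x)).toNatTrans.app
      ((s, h) : F.obj (op b) × (x ⟶ b)) = ((actId F s).hom ×ₘ (ρ_ h).hom) := by
  refine Prod.ext ?_ ?_
  · have e : ((((fixSnd (integrand A) (op b, b)).mapId F).hom.as.app (op x)).toNatTrans.app
      ((s, h) : F.obj (op b) × (x ⟶ b))).1 = (actMap₂ F (𝟙 (𝟙 b)) s ≫ 𝟙 _) ≫ 𝟙 _ ≫ (actId F s).hom := rfl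
    exact e.trans (comp_id_left (actMap₂_id F (𝟙 b) s) _)
  · have e : ((((fixSnd (integrand A) (op b, b)).mapId F).hom.as.app (op x)).toNatTrans.app
      ((s, h) : F.obj (op b) × (x ⟶ b))).2 = h ◁ 𝟙 _ ≫ (ρ_ h).hom := rfl
    refine e.trans ?_
    rw [whiskerLeft_id, Category.id_comp]

theorem integrand_mapComp_param (γ : F ⟶ G) (δ : G ⟶ H) {x b : A} (s : F.obj (op b)) (h : x ⟶ b) :
    (((fixSnd (integrand A) (op b, b)).mapComp γ δ).hom.as.app (op x)).toNatTrans.app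
      ((s, h) : F.obj (op b) × (x ⟶ b)) =
        ((fib δ b).map (actId G ((fib γ b).obj ((act F (𝟙 b)).obj s))).inv ×ₘ
          (ρ_ (h ≫ 𝟙 b)).inv) := by
  refine Prod.ext ?_ ?_
  · have e : ((((fixSnd (integrand A) (op b, b)).mapComp γ δ).hom.as.app (op x)).toNatTrans.app
      ((s, h) : F.obj (op b) × (x ⟶ b))).1 =
      ((fib (γ ≫ δ) b).map (actMap₂ F (ρ_ (𝟙 b)).inv s) ≫ 𝟙 _) ≫
       (evalFstMapComp (X := (F, (op b, b))) (Y := (G, (op b, b)))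
          (W := (H, (op b, b))) (γ, ((𝟙 b : b ⟶ b).op, 𝟙 b))
          (δ, ((𝟙 b : b ⟶ b).op, 𝟙 b))).hom.toNatTrans.app s := rfl
    exact e.trans (comp_map_map (fib δ b) (evalFstMapComp_hom _ _ _) (fib_map_actMap₂_actComp γ s))
  · have e : ((((fixSnd (integrand A) (op b, b)).mapComp γ δ).hom.as.app (op x)).toNatTrans.app
      ((s, h) : F.obj (op b) × (x ⟶ b))).2 = h ◁ (λ_ (𝟙 b)).inv ≫ (α_ h (𝟙 b) (𝟙 b)).inv := rfl
    refine e.trans ?_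
    change _ = (ρ_ (h ≫ 𝟙 b)).inv
    rw [unitors_inv_equal]
    bicategory

/-- Moving `γ` past `f` costs the inverse naturality constraint of `γ`, plus a shift of the unit
from inside `F(f)` to outside. Both variables are kept general because `(1, g)` and `(g, 1)` are
each needed. -/
theorem interchange_integrand_param (γ : F ⟶ G) {x b b' c c' : A} (f : c ⟶ c') (k : b ⟶ b')
    (s : F.obj (op c')) (h : x ⟶ b) :
    ((interchange (integrand A) γ (f.op ×ₘ k : (op c', b) ⟶ (op c, b'))).hom.as.app
      (op x)).toNatTrans.app ((s, h) : F.obj (op c') × (x ⟶ b)) =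
      ((fibNat γ f ((act F (𝟙 c')).obj s)).inv ≫ (fib γ c).map ((act F f).map (actId F s).hom ≫
          (actId F ((act F f).obj s)).inv) ×ₘ
        (ρ_ h).hom ▷ k ≫ (ρ_ (h ≫ k)).inv) := by
  refine Prod.ext ?_ ?_
  · have e : (((interchange (integrand A) γ (f.op ×ₘ k : (op c', b) ⟶ (op c, b'))).hom.as.app
      (op x)).toNatTrans.app ((s, h) : F.obj (op c') × (x ⟶ b))).1 =
       (evalFstMapComp (X := (F, (op c', b))) (Y := (G, (op c', b)))
          (W := (G, (op c, b'))) (γ, ((𝟙 c' : c' ⟶ c').op, 𝟙 b))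
          (𝟙 G, (f.op, k))).inv.toNatTrans.app s ≫
       ((fib γ c).map (actMap₂ F ((ρ_ f).hom ≫ (λ_ f).inv) s) ≫ 𝟙 _ ≫ 𝟙 _) ≫
       (evalFstMapComp (X := (F, (op c', b))) (Y := (F, (op c, b')))
          (W := (G, (op c, b'))) (𝟙 F, (f.op, k)) (γ, ((𝟙 c : c ⟶ c).op, 𝟙 b'))).hom.toNatTrans.app s := rfl
    have e₁ := evalFstMapComp_inv (X := (F, (op c', b))) (Y := (G, (op c', b)))
      (W := (G, (op c, b'))) (γ, ((𝟙 c' : c' ⟶ c').op, 𝟙 b)) (𝟙 G, (f.op, k)) s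
    have e₂ := evalFstMapComp_hom (X := (F, (op c', b))) (Y := (F, (op c, b')))
      (W := (G, (op c, b'))) (𝟙 F, (f.op, k)) (γ, ((𝟙 c : c ⟶ c).op, 𝟙 b')) s
    have e₃ : (actComp F (𝟙 c) f s).hom ≫ (fibNat (𝟙 F) (𝟙 c) ((act F f).obj s)).hom =
      (actComp F (𝟙 c) f s).hom := comp_eq_of_eq_id _ (fibNat_vid_hom _ _)
    exact e.trans (comp_map_inner (fib γ c) e₁ (e₂.trans (congrArg (fib γ c).map e₃))
      (actComp_inv_actMap₂_unitors F f s))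
  · have e : (((interchange (integrand A) γ (f.op ×ₘ k : (op c', b) ⟶ (op c, b'))).hom.as.app
      (op x)).toNatTrans.app ((s, h) : F.obj (op c') × (x ⟶ b))).2 = (α_ h (𝟙 b) k).hom ≫
       h ◁ ((λ_ k).hom ≫ (ρ_ k).inv) ≫ (α_ h k (𝟙 b')).inv := rfl
    refine e.trans ?_
    change _ = (ρ_ h).hom ▷ k ≫ (ρ_ (h ≫ k)).inv
    simp

end
-- Pseudonaturality of evaluation, with unit constraints
section
variable {A : Type u} [Bicategory.{w, v} A] {F G H : Aᵒᵖ ⥤ᵖ Cat.{w, v}} (γ : F ⟶ G)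

/-- The components of the pseudonaturality constraints of evaluation. -/
def paramNat {x b : A} (s : F.obj (op b)) (h : x ⟶ b) :
    (evalFunctor G b x).obj ((fib γ b).obj ((act F (𝟙 b)).obj s), h ≫ 𝟙 b) ≅
      (fib γ x).obj ((evalFunctor F b x).obj (s, h)) :=
  (evalFunctor G b x).mapIso (Iso.prod ((fib γ b).mapIso (actId F s)) (ρ_ h)) ≪≫ evalNat γ s h

theorem paramNat_hom {x b : A} (s : F.obj (op b)) (h : x ⟶ b) :
    (paramNat γ s h).hom =
      (evalFunctor G b x).map ((fib γ b).map (actId F s).hom ×ₘ (ρ_ h).hom) ≫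
        (evalNat γ s h).hom := rfl

theorem paramNat_naturality {x b : A} {s t : F.obj (op b)} (σ : s ⟶ t) {h k : x ⟶ b}
    (θ : h ⟶ k) :
    (evalFunctor G b x).map ((fib γ b).map ((act F (𝟙 b)).map σ) ×ₘ θ ▷ 𝟙 b) ≫
        (paramNat γ t k).hom =
      (paramNat γ s h).hom ≫ (fib γ x).map ((evalFunctor F b x).map (σ ×ₘ θ)) := by
  rw [paramNat_hom, paramNat_hom, Category.assoc, ← evalNat_naturality, reassoc_of% map_mkHom_comp,
    reassoc_of% map_mkHom_comp, ← Functor.map_comp, ← Functor.map_comp, actId_naturality]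
  simp

theorem paramNat_evalComp {x y b : A} (g : y ⟶ x) (s : F.obj (op b)) (h : x ⟶ b) :
    (paramNat γ s (g ≫ h)).hom ≫ (fib γ y).map (evalComp F g s h).hom ≫
        (fibNat γ g ((evalFunctor F b x).obj (s, h))).hom =
      ((evalFunctor G b y).map (𝟙 ((fib γ b).obj ((act F (𝟙 b)).obj s)) ×ₘ (α_ g h (𝟙 b)).hom) ≫
        (evalComp G g ((fib γ b).obj ((act F (𝟙 b)).obj s)) (h ≫ 𝟙 b)).hom) ≫
          (act G g).map (paramNat γ s h).hom := by
  rw [paramNat_hom, paramNat_hom, Category.assoc, Category.assoc, evalNat_evalComp,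
    Functor.map_comp, ← reassoc_of% evalComp_naturality G g, reassoc_of% map_mkHom_comp,
    Category.id_comp, ← rightUnitor_comp]

theorem paramNat_fibMap₂ {γ δ : F ⟶ G} (η : γ ⟶ δ) {x b : A} (s : F.obj (op b)) (h : x ⟶ b) :
    (evalFunctor G b x).map (fibMap₂ η ((act F (𝟙 b)).obj s) ×ₘ 𝟙 (h ≫ 𝟙 b)) ≫
        (paramNat δ s h).hom =
      (paramNat γ s h).hom ≫ fibMap₂ η ((evalFunctor F b x).obj (s, h)) := by
  rw [paramNat_hom, paramNat_hom, Category.assoc, ← evalNat_fibMap₂, reassoc_of% map_mkHom_comp,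
    reassoc_of% map_mkHom_comp, fibMap₂_naturality]
  simp

theorem paramNat_id {x b : A} (s : F.obj (op b)) (h : x ⟶ b) :
    (paramNat (𝟙 F) s h).hom = (evalFunctor F b x).map ((actId F s).hom ×ₘ (ρ_ h).hom) :=
  (paramNat_hom (𝟙 F) s h).trans ((congrArg
    ((evalFunctor F b x).map ((actId F s).hom ×ₘ (ρ_ h).hom) ≫ ·) (evalNat_id s h)).trans
      (Category.comp_id _))

theorem paramNat_comp (δ : G ⟶ H) {x b : A} (s : F.obj (op b)) (h : x ⟶ b) :
    (paramNat (γ ≫ δ) s h).hom =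
      (evalFunctor H b x).map ((fib δ b).map
          (actId G ((fib γ b).obj ((act F (𝟙 b)).obj s))).inv ×ₘ (ρ_ (h ≫ 𝟙 b)).inv) ≫
        (paramNat δ ((fib γ b).obj ((act F (𝟙 b)).obj s)) (h ≫ 𝟙 b)).hom ≫
          (fib δ x).map (paramNat γ s h).hom := by
  have e : (evalFunctor H b x).map ((fib δ b).map
          (actId G ((fib γ b).obj ((act F (𝟙 b)).obj s))).inv ×ₘ (ρ_ (h ≫ 𝟙 b)).inv) ≫
        (evalFunctor H b x).map ((fib δ b).map
          (actId G ((fib γ b).obj ((act F (𝟙 b)).obj s))).hom ×ₘ (ρ_ (h ≫ 𝟙 b)).hom) = 𝟙 _ := by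
    rw [map_mkHom_comp, ← Functor.map_comp, Iso.inv_hom_id, Iso.inv_hom_id,
      CategoryTheory.Functor.map_id, map_mkHom_id]
  rw [paramNat_hom δ, paramNat_hom γ, Functor.map_comp, Category.assoc,
    ← reassoc_of% evalNat_naturality, reassoc_of% e]
  exact congrArg ((evalFunctor H b x).map ((fib δ b).map ((fib γ b).map (actId F s).hom) ×ₘ
    (ρ_ h).hom) ≫ ·) (evalNat_comp γ δ s h)

theorem whiskerRight_id_comp_rightUnitor {x b : A} (h : x ⟶ b) :
    (ρ_ h).hom ▷ 𝟙 b ≫ (ρ_ h).hom = (ρ_ (h ≫ 𝟙 b)).hom ≫ (ρ_ h).hom := by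
  simp

/-- The cells of the evaluation transformations, at an object. -/
def evalInsert (F : Aᵒᵖ ⥤ᵖ Cat.{w, v}) {x b c : A} (f : b ⟶ c) (s : F.obj (op c)) (h : x ⟶ b) :
    (evalFunctor F b x).obj ((act F f).obj s, h ≫ 𝟙 b) ⟶
      (evalFunctor F c x).obj ((act F (𝟙 c)).obj s, h ≫ f) :=
  (evalFunctor F b x).map (𝟙 ((act F f).obj s) ×ₘ (ρ_ h).hom) ≫ (evalAssoc F h f s).hom ≫
    (evalFunctor F c x).map ((actId F s).inv ×ₘ 𝟙 (h ≫ f))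

/-- Both ways of removing one unit from `F(1)F(1)(s)` agree: by naturality they agree after the
invertible map `F(1)(s) ≅ s`. -/
theorem act_map_actId {b : A} (s : F.obj (op b)) :
    (act F (𝟙 b)).map (actId F s).hom ≫ (actId F ((act F (𝟙 b)).obj s)).inv = 𝟙 _ := by
  rw [← cancel_mono (actId F ((act F (𝟙 b)).obj s)).hom, Category.assoc, Iso.inv_hom_id,
    Category.comp_id, Category.id_comp, ← cancel_mono (actId F s).hom, actId_naturality]

/-- Once units are cancelled (`l` and `r`), both pastings begin with the same unitors, and what
remains is `evalNat_evalAssoc` at `F(1)(s)`. -/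
theorem paramNat_cell {x b c : A} (f : b ⟶ c) (s : F.obj (op c)) (h : x ⟶ b) :
    evalInsert G f ((fib γ c).obj ((act F (𝟙 c)).obj s)) (h ≫ 𝟙 b) ≫
      (evalFunctor G c x).map ((fibNat γ (𝟙 c) ((act F (𝟙 c)).obj s)).inv ≫
        (fib γ c).map ((act F (𝟙 c)).map (actId F s).hom ≫
          (actId F ((act F (𝟙 c)).obj s)).inv) ×ₘ (ρ_ h).hom ▷ f ≫ (ρ_ (h ≫ f)).inv) ≫
      (paramNat γ ((act F (𝟙 c)).obj s) (h ≫ f)).hom =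
    (evalFunctor G b x).map ((fibNat γ f ((act F (𝟙 c)).obj s)).inv ≫
        (fib γ b).map ((act F f).map (actId F s).hom ≫ (actId F ((act F f).obj s)).inv) ×ₘ
          (ρ_ h).hom ▷ 𝟙 b ≫ (ρ_ (h ≫ 𝟙 b)).inv) ≫
      (paramNat γ ((act F f).obj s) (h ≫ 𝟙 b)).hom ≫
        (fib γ x).map (evalInsert F f s h) := by
  have e₀ := fibNat_id γ ((act F (𝟙 c)).obj s)
  have e₁ : (actId G ((fib γ c).obj ((act F (𝟙 c)).obj s))).inv ≫
      (fibNat γ (𝟙 c) ((act F (𝟙 c)).obj s)).inv ≫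
        (fib γ c).map (actId F ((act F (𝟙 c)).obj s)).hom = 𝟙 _ := by
    rw [Iso.inv_comp_eq, Iso.inv_comp_eq, Category.comp_id, e₀]
  have l : evalInsert G f ((fib γ c).obj ((act F (𝟙 c)).obj s)) (h ≫ 𝟙 b) ≫
      (evalFunctor G c x).map ((fibNat γ (𝟙 c) ((act F (𝟙 c)).obj s)).inv ≫
        (fib γ c).map ((act F (𝟙 c)).map (actId F s).hom ≫
          (actId F ((act F (𝟙 c)).obj s)).inv) ×ₘ (ρ_ h).hom ▷ f ≫ (ρ_ (h ≫ f)).inv) ≫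
      (paramNat γ ((act F (𝟙 c)).obj s) (h ≫ f)).hom =
      (evalFunctor G b x).map (𝟙 _ ×ₘ (ρ_ (h ≫ 𝟙 b)).hom ≫ (ρ_ h).hom) ≫
        (evalAssoc G h f ((fib γ c).obj ((act F (𝟙 c)).obj s))).hom ≫
          (evalNat γ ((act F (𝟙 c)).obj s) (h ≫ f)).hom := by
    have n := evalAssoc_naturality G f (𝟙 ((fib γ c).obj ((act F (𝟙 c)).obj s))) (ρ_ h).hom
    rw [CategoryTheory.Functor.map_id] at n
    rw [act_map_actId, CategoryTheory.Functor.map_id, Category.comp_id, evalInsert, paramNat_hom,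
      Category.assoc, Category.assoc, reassoc_of% map_mkHom_comp, reassoc_of% map_mkHom_comp, Category.assoc,
      Category.assoc, e₁, Category.id_comp, Category.assoc, Iso.inv_hom_id, Category.comp_id,
      ← reassoc_of% n, reassoc_of% map_mkHom_comp, Category.id_comp]
  have n₀ := evalNat_naturality γ (𝟙 ((act F f).obj s)) (ρ_ h).hom
  rw [CategoryTheory.Functor.map_id] at n₀
  have n₁ := evalNat_naturality γ ((act F f).map (actId F s).hom) (𝟙 h)
  have n₂ := evalAssoc_naturality F f (actId F s).hom (𝟙 h)
  have n₃ := evalNat_evalAssoc γ h f ((act F (𝟙 c)).obj s)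
  have i : (evalFunctor F c x).map ((actId F s).hom ×ₘ 𝟙 h ▷ f) ≫
      (evalFunctor F c x).map ((actId F s).inv ×ₘ 𝟙 (h ≫ f)) = 𝟙 _ := by
    rw [map_mkHom_comp, Iso.hom_inv_id, id_whiskerRight, Category.comp_id, map_mkHom_id]
  have r : (evalFunctor G b x).map ((fibNat γ f ((act F (𝟙 c)).obj s)).inv ≫
        (fib γ b).map ((act F f).map (actId F s).hom ≫ (actId F ((act F f).obj s)).inv) ×ₘ
          (ρ_ h).hom ▷ 𝟙 b ≫ (ρ_ (h ≫ 𝟙 b)).inv) ≫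
      (paramNat γ ((act F f).obj s) (h ≫ 𝟙 b)).hom ≫
        (fib γ x).map (evalInsert F f s h) =
      (evalFunctor G b x).map (𝟙 _ ×ₘ (ρ_ (h ≫ 𝟙 b)).hom ≫ (ρ_ h).hom) ≫
      (evalFunctor G b x).map ((fibNat γ f ((act F (𝟙 c)).obj s)).inv ×ₘ 𝟙 h) ≫
        (evalNat γ ((act F f).obj ((act F (𝟙 c)).obj s)) h).hom ≫
        (fib γ x).map (evalAssoc F h f ((act F (𝟙 c)).obj s)).hom := by
    -- The unit at `F(f)(s)` created by interchange cancels the one in `paramNat`; the unit inside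
    -- `F(f)` remains, to be cancelled against the end of the cell of `F`.
    have q : (evalFunctor G b x).map ((fibNat γ f ((act F (𝟙 c)).obj s)).inv ≫
          (fib γ b).map ((act F f).map (actId F s).hom ≫ (actId F ((act F f).obj s)).inv) ×ₘ
            (ρ_ h).hom ▷ 𝟙 b ≫ (ρ_ (h ≫ 𝟙 b)).inv) ≫
        (evalFunctor G b x).map ((fib γ b).map (actId F ((act F f).obj s)).hom ×ₘ
          (ρ_ (h ≫ 𝟙 b)).hom) ≫
        (evalFunctor G b x).map (𝟙 ((fib γ b).obj ((act F f).obj s)) ×ₘ (ρ_ h).hom) =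
      (evalFunctor G b x).map (𝟙 _ ×ₘ (ρ_ (h ≫ 𝟙 b)).hom ≫ (ρ_ h).hom) ≫
        (evalFunctor G b x).map ((fibNat γ f ((act F (𝟙 c)).obj s)).inv ×ₘ 𝟙 h) ≫
        (evalFunctor G b x).map ((fib γ b).map ((act F f).map (actId F s).hom) ×ₘ 𝟙 h) := by
      rw [map_mkHom_comp, map_mkHom_comp, map_mkHom_comp, map_mkHom_comp]
      simp only [Category.assoc, ← Functor.map_comp (fib γ b), Iso.inv_hom_id,
        Iso.inv_hom_id_assoc, Category.comp_id, Category.id_comp]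
      rw [whiskerRight_id_comp_rightUnitor]
    rw [paramNat_hom, evalInsert, Functor.map_comp (fib γ x), Functor.map_comp (fib γ x),
      Category.assoc, ← reassoc_of% n₀, reassoc_of% q, reassoc_of% n₁, ← Functor.map_comp (fib γ x),
      ← Functor.map_comp (fib γ x), reassoc_of% n₂, i, Category.comp_id]
  rw [l, r, n₃]

end
section
variable {C : Type u₁} [Category.{v₁} C]

theorem comp_id_id {a b : C} (p : a ⟶ b) : p ≫ 𝟙 b ≫ 𝟙 b = p := by
  simp

theorem id_comp_three {a b c d : C} (p : a ⟶ b) (q : b ⟶ c) (r : c ⟶ d) :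
    p ≫ 𝟙 b ≫ q ≫ 𝟙 c ≫ r ≫ 𝟙 d = p ≫ q ≫ r := by
  simp

theorem comp_id_nest {a b c d : C} (p : a ⟶ b) (q : b ⟶ c) (r : c ⟶ d) :
    p ≫ 𝟙 b ≫ q ≫ 𝟙 c ≫ r = p ≫ q ≫ r := by
  simp

end

/-! ### Evaluation as a parametrized extrapseudonatural transformation -/

section
variable {A : Type u} [Bicategory.{w, v} A] {F G H : Aᵒᵖ ⥤ᵖ Cat.{w, v}}

theorem evalCell_app {x b c : A} (f : b ⟶ c) (s : F.obj (op c)) (h : x ⟶ b) :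
    fibMap₂ (evalCell F f).hom (a := x) ((s, h) : F.obj (op c) × (x ⟶ b)) =
      evalInsert F f s h :=
  insertUnits_hom (evalWedge F x).app ((evalWedge F x).cell f s h)

theorem fibNat_integrand_param (γ : F ⟶ G) {x y b : A}
    (β : constProd (G.obj (op b)) (Bicategory.yoneda.obj b) ⟶ H) (g : y ⟶ x)
    (s : F.obj (op b)) (h : x ⟶ b) :
    (fibNat ((integrand A).map (γ ×ₘ 𝟙 (op b, b)) ≫ β) g
        ((s, h) : F.obj (op b) × (x ⟶ b))).hom =
      (tfib β y).map (𝟙 ((fib γ b).obj ((act F (𝟙 b)).obj s)) ×ₘ (α_ g h (𝟙 b)).hom) ≫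
        (tfibNat β g ((fib γ b).obj ((act F (𝟙 b)).obj s)) (h ≫ 𝟙 b)).hom :=
  (fibNat_vcomp_hom ((integrand A).map (γ ×ₘ 𝟙 (op b, b))) β g
    ((s, h) : F.obj (op b) × (x ⟶ b))).trans
    (congrArg (fun t => (tfib β y).map (t ×ₘ (α_ g h (𝟙 b)).hom) ≫
        (tfibNat β g ((fib γ b).obj ((act F (𝟙 b)).obj s)) (h ≫ 𝟙 b)).hom)
      (Category.id_comp (𝟙 ((fib γ b).obj ((act F (𝟙 b)).obj s)))))

/-- The pseudonaturality constraints of evaluation. -/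
def evalParamNat (γ : F ⟶ G) (b : A) :
    (integrand A).map (γ ×ₘ 𝟙 (op b, b)) ≫ evalTrans G b ≅ evalTrans F b ≫ γ :=
  mkModIso (fun x p => paramNat γ p.1 p.2)
    (fun x {p q} σ => by
      have e : (fib γ b).map ((act F (𝟙 b)).map σ.1) ≫ 𝟙 _ =
        (fib γ b).map ((act F (𝟙 b)).map σ.1) := Category.comp_id _
      exact paramNat_naturality γ σ.1 σ.2)
    (fun {y x} g p => by
      have e₁ := fibNat_integrand_param γ (evalTrans G b) g p.1 p.2
      have e₂ := fibNat_vcomp_hom (evalTrans F b) γ g p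
      refine (congrArg (_ ≫ ·) e₂).trans (Eq.trans ?_ (congrArg (· ≫ _) e₁.symm))
      exact paramNat_evalComp γ g p.1 p.2)

variable (A) in
/-- The evaluation transformations, as an extrapseudonatural transformation depending
pseudonaturally on a parameter. -/
def evalParam : ParamExtrapseudonat (integrand A) (Pseudofunctor.id (Aᵒᵖ ⥤ᵖ Cat.{w, v})) where
  fix F := evalExtra F
  nat γ b := evalParamNat γ b
  nat_naturality {F G γ δ} η b := by
    ext x p
    exact (congrArg (fun k => (evalFunctor G b x.unop).map k ≫ _)
      (integrand_map₂_param η p.1 p.2)).trans (paramNat_fibMap₂ η p.1 p.2)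
  nat_id F b := by
    ext x p
    have e := paramNat_id (F := F) p.1 p.2
    have e₁ := integrand_mapId_param (F := F) p.1 p.2
    refine (Category.comp_id _).trans (e.trans ?_)
    refine (congrArg (evalFunctor F b x.unop).map e₁).symm.trans ?_
    exact (comp_id_id _).symm
  nat_comp {F G H} γ δ b := by
    ext x p
    have e := paramNat_comp γ δ p.1 p.2
    have e₁ := integrand_mapComp_param γ δ p.1 p.2
    refine (Category.comp_id _).trans (e.trans ?_)
    refine Eq.trans ?_ (id_comp_three _ _ _).symm
    exact (congrArg (fun k => (evalFunctor H b x.unop).map k ≫ _) e₁).symm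
  nat_cell {F G} γ {b c} g := by
    ext x p
    have e := paramNat_cell γ g p.1 p.2
    -- The two pastings interchange `γ` with the covariant action of `g` (`e₁`) and with the
    -- contravariant one (`e₂`).
    have e₁ := interchange_integrand_param γ (𝟙 c) g p.1 p.2
    have e₂ := interchange_integrand_param γ g (𝟙 b) p.1 p.2
    have c₁ := evalCell_app (F := G) g ((fib γ c).obj ((act F (𝟙 c)).obj p.1)) (p.2 ≫ 𝟙 b)
    have c₂ := evalCell_app (F := F) g p.1 p.2
    refine (comp_id_nest _ _ _).trans (Eq.trans ?_ (comp_id_five _ _ _).symm)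
    refine (congrArg₂ (fun k l => k ≫ (evalFunctor G c x.unop).map l ≫
      (paramNat γ ((act F (𝟙 c)).obj p.1) (p.2 ≫ g)).hom) c₁ e₁).trans (e.trans ?_)
    exact (congrArg₂ (fun k l => (evalFunctor G b x.unop).map k ≫
      (paramNat γ ((act F g).obj p.1) (p.2 ≫ 𝟙 b)).hom ≫ (fib γ x.unop).map l) e₂ c₂).symm

end
end Bicoend

theorem mainTheorem9 {A : Type u} [Bicategory.{w, v} A] :
    ∃ (I : (Aᵒᵖ ⥤ᵖ Cat.{w, v}) ⥤ᵖ (Aᵒᵖ ⥤ᵖ Cat.{w, v}))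
      (i : Bicoend.ParamExtrapseudonat (Bicoend.integrand A) I),
      ∀ F : Aᵒᵖ ⥤ᵖ Cat.{w, v},
        (i.fix F).IsBicodescent ∧ ∀ x : Aᵒᵖ, ((i.fix F).evalPt x).IsBicodescent :=
  -- By co-Yoneda the coend pseudofunctor may be chosen to be the identity.
  ⟨Pseudofunctor.id _, Bicoend.evalParam A, fun F =>
    ⟨Bicoend.evalExtra_isBicodescent F,
      Bicoend.evalExtra_evalPt_isBicodescent F⟩⟩
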